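/- Let $R$ be a commutative noetherian domain of Krull dimension $1$, and let $M$ be a finitely generated torsion-free $R$-module with endomorphism ring $S=\mathrm{End}_R(M)$. Assume that $S$ is semilocal, with a ring isomorphism $S/J(S)\cong M_{n_1}(D_1)\times\cdots\times M_{n_s}(D_s)$, where the $D_i$ are division rings and $n_i\ge 1$. Notation. Let $\mathbb N_0^*=\mathbb N_0\cup\{\infty\}$, with $0\cdot\infty=0$ and $x\cdot\infty=\infty$ for $x\neq 0$. Let $V_i$ be the simple right $S$-module of row vectors of length $n_i$ over $D_i$ belonging to the $i$-th factor. For a right $S$-module $P$ let $\mathbf{dim}_S(P)\in(\mathbb N_0^*)^s$ have entries $\dim_{D_i}\mathrm{Hom}_S(V_i,P/PJ(S))$, infinite dimensions being written $\infty$, and for an $R$-module $X$ put $\mathbf D_M(X)=\mathbf{dim}_S(\mathrm{Hom}_R(M,X))$. Let $\mathrm{Add}(M)$ (respectively $\mathrm{add}(M)$) be the class of modules isomorphic to direct summands of arbitrary (respectively finite) direct sums of copies of $M$; $V^*(M)$ is the set of isomorphism classes of countably generated modules in $\mathrm{Add}(M)$, and $V(M)$ that of modules in $\mathrm{add}(M)$.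 A system of supports $\mathcal S(n_1,\dots,n_s)$ is a collection $\mathcal S$ of subsets of $\{1,\dots,s\}$ with a submonoid $A_H\subseteq\mathbb N_0^{\{1,\dots,s\}\setminus H}$ for each $H\in\mathcal S$, such that: $\emptyset\in\mathcal S$ and $(n_1,\dots,n_s)\in A_\emptyset$; $\mathcal S$ is closed under unions, and $H\cup\mathrm{supp}(x)\in\mathcal S$ whenever $x\in A_H$; and if $H\subseteq K$ are in $\mathcal S$, the canonical projection maps $A_H$ into $A_K$. The monoid given by the system is $\bigcup_{H\in\mathcal S}\varepsilon_H(A_H)\subseteq(\mathbb N_0^*)^s$, where $\varepsilon_H$ extends a vector by $\infty$ on $H$. The system is almost-free if each $A_H$ is a full submonoid (that is, $a,b\in A_H$ and $a+c=b$ with $c\in\mathbb N_0^{\{1,\dots,s\}\setminus H}$ imply $c\in A_H$) and $A_H=\mathbb N_0^{\{1,\dots,s\}\setminus H}$ for every nonempty $H\in\mathcal S$. Then $B=\mathbf D_M(V^*(M))$ is a submonoid of $(\mathbb N_0^*)^s$ given by an almost-free system of supports $\mathcal S(n_1,\dots,n_s)$. Put $A=B\cap\mathbb N_0^s$; then $A=\mathbf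 D_M(V(M))$. Moreover $\mathbf D_M(M)=(n_1,\dots,n_s)$, and this element is an order-unit of $A$, and an order-unit of $B$ when infinite multiples are allowed: for every $b\in A$ there are $k\in\mathbb N_0$ and $c\in A$ with $b+c=k\cdot(n_1,\dots,n_s)$, and for every $b\in B$ there are $k\in\mathbb N_0^*$ and $c\in B$ with $b+c=k\cdot(n_1,\dots,n_s)$. Finally, the following are equivalent: every object of $\mathrm{Add}(M)$ is a direct sum of modules in $\mathrm{add}(M)$; every object of $\mathrm{Add}(M)$ is a direct sum of finitely generated modules; $B=A+\infty\cdot A:=\{a_1+\infty\cdot a_2 : a_1,a_2\in A\}$. -/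

import Mathlib

universe u v w

noncomputable section

/-! ## Right modules and the dimension vector over a semilocal ring

Right modules over a (noncommutative) ring `S` are modules over the opposite ring `Sᵐᵒᵖ`. -/

section RightModules

variable {S : Type u} [Ring S]

/-- The submodule `P J(S)` of a right `S`-module `P`. -/
def mulJacobson (S : Type u) [Ring S] (P : Type v) [AddCommGroup P] [Module Sᵐᵒᵖ P] :
    Submodule Sᵐᵒᵖ P :=
  Submodule.span Sᵐᵒᵖ {y | ∃ f ∈ Ring.jacobson S, ∃ x : P, y = MulOpposite.op f • x}

variable {s : ℕ} {n : Fin s → ℕ} {D : Fin s → Type w} [∀ i, DivisionRing (D i)]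

/-- The simple right `S`-module `V_i` of row vectors of length `n_i` over `D_i` that belongs to the
`i`-th factor of a decomposition `S / J(S) ≅ M_{n_1}(D_1) × ⋯ × M_{n_s}(D_s)`. -/
def SimpleRow (_e : S ⧸ Ring.jacobson S ≃+* ∀ i, Matrix (Fin (n i)) (Fin (n i)) (D i))
    (i : Fin s) : Type w :=
  Fin (n i) → D i

namespace SimpleRow

variable (e : S ⧸ Ring.jacobson S ≃+* ∀ i, Matrix (Fin (n i)) (Fin (n i)) (D i)) (i : Fin s)

instance : AddCommGroup (SimpleRow e i) := inferInstanceAs (AddCommGroup (Fin (n i) → D i))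

/-- Left multiplication by scalars in `D_i`. -/
instance : Module (D i) (SimpleRow e i) := inferInstanceAs (Module (D i) (Fin (n i) → D i))

/-- The row vector underlying an element of `V_i`. -/
def toRow : SimpleRow e i ≃ₗ[D i] (Fin (n i) → D i) := LinearEquiv.refl (D i) (Fin (n i) → D i)

/-- The `i`-th matrix of the class of `f` in `S / J(S)`. -/
def matrixOf : S →+* Matrix (Fin (n i)) (Fin (n i)) (D i) :=
  (Pi.evalRingHom (fun i => Matrix (Fin (n i)) (Fin (n i)) (D i)) i).comp
    (e.toRingHom.comp (Ideal.Quotient.mk (Ring.jacobson S)))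

/-- The right action of `S`: row vectors times the `i`-th matrix of the class of `f`. -/
instance : Module Sᵐᵒᵖ (SimpleRow e i) where
  smul f x := (toRow e i).symm (Matrix.vecMul (toRow e i x) (matrixOf e i f.unop))
  one_smul x := by
    change (toRow e i).symm (Matrix.vecMul (toRow e i x) (matrixOf e i 1)) = x
    rw [map_one, Matrix.vecMul_one, LinearEquiv.symm_apply_apply]
  mul_smul f g x := by
    change (toRow e i).symm (Matrix.vecMul (toRow e i x) (matrixOf e i (g.unop * f.unop)))
      = (toRow e i).symm (Matrix.vecMul (toRow e i ((toRow e i).symm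
        (Matrix.vecMul (toRow e i x) (matrixOf e i g.unop)))) (matrixOf e i f.unop))
    rw [map_mul, LinearEquiv.apply_symm_apply, Matrix.vecMul_vecMul]
  smul_zero f := by
    change (toRow e i).symm (Matrix.vecMul (toRow e i 0) (matrixOf e i f.unop)) = 0
    rw [map_zero, Matrix.zero_vecMul, map_zero]
  smul_add f x y := by
    change (toRow e i).symm (Matrix.vecMul (toRow e i (x + y)) (matrixOf e i f.unop)) =
      (toRow e i).symm (Matrix.vecMul (toRow e i x) (matrixOf e i f.unop)) +
      (toRow e i).symm (Matrix.vecMul (toRow e i y) (matrixOf e i f.unop))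
    rw [map_add, Matrix.add_vecMul, map_add]
  add_smul f g x := by
    change (toRow e i).symm (Matrix.vecMul (toRow e i x) (matrixOf e i (f.unop + g.unop))) =
      (toRow e i).symm (Matrix.vecMul (toRow e i x) (matrixOf e i f.unop)) +
      (toRow e i).symm (Matrix.vecMul (toRow e i x) (matrixOf e i g.unop))
    rw [map_add, Matrix.vecMul_add, map_add]
  zero_smul x := by
    change (toRow e i).symm (Matrix.vecMul (toRow e i x) (matrixOf e i 0)) = 0
    rw [map_zero, Matrix.vecMul_zero, map_zero]

instance : SMulCommClass Sᵐᵒᵖ (D i) (SimpleRow e i) where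
  smul_comm f d x := by
    change (toRow e i).symm (Matrix.vecMul (toRow e i (d • x)) (matrixOf e i f.unop)) =
      d • (toRow e i).symm (Matrix.vecMul (toRow e i x) (matrixOf e i f.unop))
    rw [map_smul, Matrix.smul_vecMul, map_smul]

end SimpleRow

/-- The right `D_i`-vector space `Hom_S(V_i, N)`, with `(h · d)(x) = h (d x)`. -/
abbrev homRightVectorSpace
    (e : S ⧸ Ring.jacobson S ≃+* ∀ i, Matrix (Fin (n i)) (Fin (n i)) (D i)) (i : Fin s)
    (N : Type v) [AddCommGroup N] [Module Sᵐᵒᵖ N] :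
    Module (D i)ᵐᵒᵖ (SimpleRow e i →ₗ[Sᵐᵒᵖ] N) :=
  inferInstanceAs (Module (D i)ᵈᵐᵃ (SimpleRow e i →ₗ[Sᵐᵒᵖ] N))

/-- The dimension vector of a right `S`-module `P`, with entries
`dim_{D_i} Hom_S(V_i, P / P J(S))`; an infinite dimension is recorded as `∞`. -/
def dimVec (e : S ⧸ Ring.jacobson S ≃+* ∀ i, Matrix (Fin (n i)) (Fin (n i)) (D i))
    (P : Type v) [AddCommGroup P] [Module Sᵐᵒᵖ P] : Fin s → ℕ∞ :=
  fun i =>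
    letI := homRightVectorSpace e i (P ⧸ mulJacobson S P)
    Cardinal.toENat (Module.rank (D i)ᵐᵒᵖ (SimpleRow e i →ₗ[Sᵐᵒᵖ] (P ⧸ mulJacobson S P)))

end RightModules

/-! ## The categories `add(M)` and `Add(M)` and the map `D_M` -/

section AddCategories

variable (R : Type u) [CommRing R] (M : Type v) [AddCommGroup M] [Module R M]

/-- The right `End_R(M)`-module `Hom_R(M, X)`, with `h · f = h ∘ f`. -/
abbrev homRightModule (X : Type v) [AddCommGroup X] [Module R X] :
    Module (Module.End R M)ᵐᵒᵖ (M →ₗ[R] X) where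
  smul f h := h ∘ₗ f.unop
  one_smul _ := LinearMap.comp_id _
  mul_smul _ _ _ := (LinearMap.comp_assoc _ _ _).symm
  smul_zero _ := LinearMap.zero_comp _
  smul_add _ _ _ := LinearMap.add_comp _ _ _
  add_smul _ _ _ := LinearMap.comp_add _ _ _
  zero_smul _ := LinearMap.comp_zero _

/-- `X` lies in `Add(M)`: it is isomorphic to a direct summand of a direct sum of copies of `M`. -/
def InAdd (X : Type v) [AddCommGroup X] [Module R X] : Prop :=
  ∃ (ι : Type v) (f : X →ₗ[R] (ι →₀ M)) (g : (ι →₀ M) →ₗ[R] X), g ∘ₗ f = LinearMap.id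

/-- `X` lies in `add(M)`: it is isomorphic to a direct summand of `M ^ k` for some `k`. -/
def InFinAdd (X : Type v) [AddCommGroup X] [Module R X] : Prop :=
  ∃ (k : ℕ) (f : X →ₗ[R] (Fin k → M)) (g : (Fin k → M) →ₗ[R] X), g ∘ₗ f = LinearMap.id

/-- `X` is generated by a countable set. -/
def IsCountablyGenerated (X : Type v) [AddCommGroup X] [Module R X] : Prop :=
  ∃ c : Set X, c.Countable ∧ Submodule.span R c = ⊤

open Classical in
/-- `X` is the direct sum of a family of submodules that all lie in `add(M)`. -/
def IsDirectSumInFinAdd (X : Type v) [AddCommGroup X] [Module R X] : Prop :=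
  ∃ (κ : Type v) (N : κ → Submodule R X), DirectSum.IsInternal N ∧ ∀ k, InFinAdd R M (N k)

open Classical in
/-- `X` is the direct sum of a family of finitely generated submodules. -/
def IsDirectSumOfFinite (X : Type v) [AddCommGroup X] [Module R X] : Prop :=
  ∃ (κ : Type v) (N : κ → Submodule R X), DirectSum.IsInternal N ∧ ∀ k, (N k).FG

variable {R M}
variable {s : ℕ} {n : Fin s → ℕ} {D : Fin s → Type w} [∀ i, DivisionRing (D i)]
variable (e : Module.End R M ⧸ Ring.jacobson (Module.End R M) ≃+*
  ∀ i, Matrix (Fin (n i)) (Fin (n i)) (D i))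

/-- `D_M(X) = dim_S (Hom_R(M, X))`, where `S = End_R(M)`. -/
def dimHom (X : Type v) [AddCommGroup X] [Module R X] : Fin s → ℕ∞ :=
  letI : Module (Module.End R M)ᵐᵒᵖ (M →ₗ[R] X) := homRightModule R M X
  dimVec e (M →ₗ[R] X)

/-- `D_M(V^*(M))`: the values of `D_M` on the countably generated modules in `Add(M)`. -/
def imageVStar : Set (Fin s → ℕ∞) :=
  {x | ∃ (X : Type v) (_ : AddCommGroup X) (_ : Module R X),
    InAdd R M X ∧ IsCountablyGenerated R X ∧ dimHom e X = x}

/-- `D_M(V(M))`: the values of `D_M` on the modules in `add(M)`. -/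
def imageV : Set (Fin s → ℕ∞) :=
  {x | ∃ (X : Type v) (_ : AddCommGroup X) (_ : Module R X), InFinAdd R M X ∧ dimHom e X = x}

end AddCategories

/-! ## Systems of supports -/

section Supports

/-- A submonoid `A` is full if the inclusion is a divisor homomorphism. -/
def IsFullSubmonoid {F : Type u} [AddCommMonoid F] (A : AddSubmonoid F) : Prop :=
  ∀ a ∈ A, ∀ b ∈ A, (∃ c, a + c = b) → ∃ c ∈ A, a + c = b

/-- `u` is an order-unit of the submonoid `A`, with multiples taken over the scalars `K`: every
element of `A` is a summand, within `A`, of a multiple of `u`. The usual notion is `K = ℕ`. -/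
def IsOrderUnit (K : Type v) {F : Type u} [AddCommMonoid F] [SMul K F]
    (A : AddSubmonoid F) (u : F) : Prop :=
  u ∈ A ∧ ∀ b ∈ A, ∃ k : K, ∃ c ∈ A, b + c = k • u

variable {s : ℕ}

/-- A system of supports `𝒮(n_1, …, n_s)` on `{1, …, s}`. -/
structure SystemOfSupports (n : Fin s → ℕ) where
  pos : ∀ i, 0 < n i
  supports : Set (Set (Fin s))
  A : ∀ H : supports, AddSubmonoid ({i : Fin s // i ∉ H.1} → ℕ)
  empty_mem : ∅ ∈ supports
  unit_mem : (fun i => n i.1) ∈ A ⟨∅, empty_mem⟩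
  union_mem : ∀ H ∈ supports, ∀ K ∈ supports, H ∪ K ∈ supports
  supp_mem : ∀ H : supports, ∀ x ∈ A H, H.1 ∪ Subtype.val '' {i | x i ≠ 0} ∈ supports
  proj_mem : ∀ (H K : supports) (h : H.1 ⊆ K.1), ∀ x ∈ A H,
    (fun i : {i : Fin s // i ∉ K.1} => x ⟨i.1, fun hi => i.2 (h hi)⟩) ∈ A K

namespace SystemOfSupports

open Classical in
/-- The map `ε_H`, extending a vector indexed by the complement of `H` by `∞` on `H`. -/
def extend (H : Set (Fin s)) (x : {i : Fin s // i ∉ H} → ℕ) : Fin s → ℕ∞ :=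
  fun i => if h : i ∈ H then ⊤ else (x ⟨i, h⟩ : ℕ∞)

variable {n : Fin s → ℕ} (𝒮 : SystemOfSupports n)

/-- The set `⋃_H ε_H(A_H)` given by the system of supports. -/
def carrier : Set (Fin s → ℕ∞) :=
  ⋃ H : 𝒮.supports, extend H.1 '' (𝒮.A H : Set ({i : Fin s // i ∉ H.1} → ℕ))

/-- Every `A_H` is a full submonoid. -/
def IsFull : Prop := ∀ H, IsFullSubmonoid (𝒮.A H)

/-- The system is full, and `A_H` is everything for all nonempty `H`. -/
def IsAlmostFree : Prop := 𝒮.IsFull ∧ ∀ H : 𝒮.supports, H.1 ≠ ∅ → 𝒮.A H = ⊤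

end SystemOfSupports

/-- The entrywise inclusion `ℕ^s → (ℕ ∪ {∞})^s`. -/
def castVec : (Fin s → ℕ) →+ (Fin s → ℕ∞) := (Nat.castAddMonoidHom ℕ∞).compLeft (Fin s)

/-- `B ∩ ℕ^s`. -/
def finitePart (B : AddSubmonoid (Fin s → ℕ∞)) : AddSubmonoid (Fin s → ℕ) := B.comap castVec

/-- `A + ∞ · A`. -/
def addInftyMul (A : AddSubmonoid (Fin s → ℕ)) : Set (Fin s → ℕ∞) :=
  {b | ∃ a₁ ∈ A, ∃ a₂ ∈ A, b = castVec a₁ + (⊤ : ℕ∞) • castVec a₂}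

end Supports

end

/-!
Let `S = End_R(M)`. A linear map between finite dimensional multiplicity spaces lifts to a map of
modules, and for modules in `add(M)` such a lift is invertible as soon as it is so on all
multiplicity spaces. Hence a module in `add(M)` whose dimension vector is dominated by that of `X`
in `Add(M)` is a direct summand of `X`; this gives fullness.

Since `R` has dimension one and `M` is torsion-free, a nonzero two-sided ideal of `S` contains a
nonzero scalar and has an artinian quotient. Idempotent ideals then account for the infinite entries
of dimension vectors.

* Let `X` be in `Add(M)` but not in `add(M)`. Some `f : X → X` that factors through a power of `M`
  acts as the identity on the finite dimensional multiplicity spaces of `X`, so the support of the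
  trace ideal of `1 - f` is the set of infinite entries. If `f'` is of the same kind and fixes the
  image of `f`, then `(1 - f') (1 - f) = 1 - f'`, so all powers of this trace ideal contain that of
  `1 - f' ≠ 0`, and they stabilise at a nonzero idempotent ideal.
* Let `I` be a nonzero idempotent ideal. Since `S / I` is artinian, `I` contains a power of `J(S)`,
  and idempotents on multiplicity spaces lift to an `E : M^(ℕ) → M^(ℕ)` that is idempotent
  modulo `I`. A map `A` that combines `E` with generators of `I` satisfies `B A² = A` for some `B`,
  so the colimit of the iterates of `A` is a retract of a direct sum of copies of `M^(ℕ)`. Outside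
  the support of `I` its dimensions are the ranks of `E`, which are arbitrary; on the support they
  are nonzero, and infinite after adding infinitely many copies of such a module.

This is almost-freeness. For the direct sum criterion, Kaplansky's theorem reduces to countably
generated `X`. If `X` has dimension vector `a₁ + ∞ a₂`, then a summand with vector `a₁` splits off.
In the complement, every map `x : M → X` is fixed by an idempotent that factors through a power of
`M`: choose `ε` of this kind with the left ideal of all endomorphisms of `M` that factor through
`ε x` maximal, and use a copy of the module with vector `a₂` inside the image of `1 - ε` to deduce
that `(1 - ε) x` factors through `ε x`. Iterating exhausts the complement by increasing idempotents.
-/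

noncomputable section

/-! ## Multiplicity spaces -/

namespace SimpleRow

variable {S : Type u} [Ring S] {s : ℕ} {n : Fin s → ℕ} {D : Fin s → Type w}
  [∀ i, DivisionRing (D i)]
  (e : S ⧸ Ring.jacobson S ≃+* ∀ i, Matrix (Fin (n i)) (Fin (n i)) (D i))

theorem exists_matrixOf_eq (A : ∀ i, Matrix (Fin (n i)) (Fin (n i)) (D i)) :
    ∃ f : S, ∀ i, matrixOf e i f = A i := by
  obtain ⟨f, hf⟩ := Ideal.Quotient.mk_surjective (e.symm A)
  refine ⟨f, fun i => ?_⟩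
  change e (Ideal.Quotient.mk _ f) i = A i
  rw [hf, RingEquiv.apply_symm_apply]

theorem mem_jacobson_iff {f : S} : f ∈ Ring.jacobson S ↔ ∀ i, matrixOf e i f = 0 := by
  rw [← Ideal.Quotient.eq_zero_iff_mem, ← map_eq_zero_iff e e.injective, funext_iff]
  rfl

/-- An element of `S` whose `i`-th matrix is `A` and whose other matrices vanish. -/
def lift {i : Fin s} (A : Matrix (Fin (n i)) (Fin (n i)) (D i)) : S :=
  (exists_matrixOf_eq e (Pi.single i A)).choose

theorem matrixOf_lift {i : Fin s} (A : Matrix (Fin (n i)) (Fin (n i)) (D i)) :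
    matrixOf e i (lift e A) = A := by
  rw [lift, (exists_matrixOf_eq e (Pi.single i A)).choose_spec, Pi.single_eq_same]

theorem matrixOf_lift_of_ne {i j : Fin s} (h : j ≠ i)
    (A : Matrix (Fin (n i)) (Fin (n i)) (D i)) : matrixOf e j (lift e A) = 0 := by
  rw [lift, (exists_matrixOf_eq e (Pi.single i A)).choose_spec, Pi.single_eq_of_ne h]

end SimpleRow

theorem mulJacobson_le_comap {S P Q : Type*} [Ring S] [AddCommGroup P] [Module Sᵐᵒᵖ P]
    [AddCommGroup Q] [Module Sᵐᵒᵖ Q] (f : P →ₗ[Sᵐᵒᵖ] Q) :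
    mulJacobson S P ≤ (mulJacobson S Q).comap f := by
  refine Submodule.span_le.2 ?_
  rintro _ ⟨j, hj, x, rfl⟩
  exact Submodule.subset_span ⟨j, hj, f x, map_smul f _ _⟩

section MultiplicitySpaces

open scoped Matrix

attribute [local instance] homRightModule homRightVectorSpace

variable {R : Type u} [CommRing R] {M : Type v} [AddCommGroup M] [Module R M]
variable {s : ℕ} {n : Fin s → ℕ} {D : Fin s → Type w} [∀ i, DivisionRing (D i)]
variable {X Y Z : Type v} [AddCommGroup X] [Module R X] [AddCommGroup Y] [Module R Y]
  [AddCommGroup Z] [Module R Z]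

/-- Postcomposition with `f`, as a map of right `End_R(M)`-modules. -/
def postcomp (M : Type v) [AddCommGroup M] [Module R M] (f : X →ₗ[R] Y) :
    (M →ₗ[R] X) →ₗ[(Module.End R M)ᵐᵒᵖ] (M →ₗ[R] Y) where
  toFun p := f ∘ₗ p
  map_add' p q := LinearMap.comp_add p q f
  map_smul' _ _ := rfl

variable (e : Module.End R M ⧸ Ring.jacobson (Module.End R M) ≃+*
  ∀ i, Matrix (Fin (n i)) (Fin (n i)) (D i)) (i : Fin s)

/-- The right `D_i`-vector space `Hom_S(V_i, P / P J(S))` for `P = Hom_R(M, X)`. -/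
def MultSpace (X : Type v) [AddCommGroup X] [Module R X] : Type _ :=
  SimpleRow e i →ₗ[(Module.End R M)ᵐᵒᵖ]
    ((M →ₗ[R] X) ⧸ mulJacobson (Module.End R M) (M →ₗ[R] X))

namespace MultSpace

instance : AddCommGroup (MultSpace e i X) :=
  inferInstanceAs (AddCommGroup (SimpleRow e i →ₗ[(Module.End R M)ᵐᵒᵖ]
    ((M →ₗ[R] X) ⧸ mulJacobson (Module.End R M) (M →ₗ[R] X))))

instance : Module (D i)ᵐᵒᵖ (MultSpace e i X) :=
  homRightVectorSpace e i ((M →ₗ[R] X) ⧸ mulJacobson (Module.End R M) (M →ₗ[R] X))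

variable (X) in
theorem dimHom_apply :
    dimHom e X i = Cardinal.toENat (Module.rank (D i)ᵐᵒᵖ (MultSpace e i X)) := rfl

variable {e i}

/-- The homomorphism underlying an element of the multiplicity space. -/
def hom : MultSpace e i X →+ (SimpleRow e i →ₗ[(Module.End R M)ᵐᵒᵖ]
    ((M →ₗ[R] X) ⧸ mulJacobson (Module.End R M) (M →ₗ[R] X))) :=
  AddMonoidHom.id (SimpleRow e i →ₗ[(Module.End R M)ᵐᵒᵖ]
    ((M →ₗ[R] X) ⧸ mulJacobson (Module.End R M) (M →ₗ[R] X)))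

@[ext]
theorem ext {w w' : MultSpace e i X} (h : ∀ v, hom w v = hom w' v) : w = w' :=
  LinearMap.ext (f := hom w) (g := hom w') h

/-- The class of `p : M → X` modulo `Hom_R(M, X) J(S)`. -/
abbrev cls (p : M →ₗ[R] X) : (M →ₗ[R] X) ⧸ mulJacobson (Module.End R M) (M →ₗ[R] X) :=
  Submodule.Quotient.mk p

variable (e i)

/-- The functoriality of the multiplicity space. -/
def map : (X →ₗ[R] Y) →+ (MultSpace e i X →ₗ[(D i)ᵐᵒᵖ] MultSpace e i Y) :=
  AddMonoidHom.mk'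
    (fun f =>
      { toFun w := (Submodule.mapQ _ _ (postcomp M f) (mulJacobson_le_comap _)) ∘ₗ hom w
        map_add' w w' := LinearMap.comp_add (hom w) (hom w') _
        map_smul' _ _ := rfl })
    fun f g => by
      ext w v
      obtain ⟨p, hp⟩ := Submodule.Quotient.mk_surjective _ (hom w v)
      change Submodule.mapQ _ _ (postcomp M (f + g)) (mulJacobson_le_comap _) (hom w v) =
        Submodule.mapQ _ _ (postcomp M f) (mulJacobson_le_comap _) (hom w v) +
        Submodule.mapQ _ _ (postcomp M g) (mulJacobson_le_comap _) (hom w v)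
      rw [← hp]
      exact congrArg cls (LinearMap.add_comp p g f)

variable {e i} in
theorem map_apply_of_eq {f : X →ₗ[R] Y} {w : MultSpace e i X} {v : SimpleRow e i} {p : M →ₗ[R] X}
    (h : hom w v = cls p) : hom (map e i f w) v = cls (f ∘ₗ p) := by
  change (Submodule.mapQ _ _ (postcomp M f) (mulJacobson_le_comap _)) (hom w v) = _
  rw [h]
  rfl

theorem map_id : map e i (LinearMap.id : X →ₗ[R] X) = LinearMap.id := by
  ext w v
  obtain ⟨p, hp⟩ := Submodule.Quotient.mk_surjective _ (hom w v)
  rw [map_apply_of_eq hp.symm, LinearMap.id_comp, LinearMap.id_apply, ← hp]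

theorem map_comp (g : Y →ₗ[R] Z) (f : X →ₗ[R] Y) :
    map e i (g ∘ₗ f) = map e i g ∘ₗ map e i f := by
  ext w v
  obtain ⟨p, hp⟩ := Submodule.Quotient.mk_surjective _ (hom w v)
  rw [map_apply_of_eq hp.symm, LinearMap.comp_apply,
    map_apply_of_eq (map_apply_of_eq hp.symm), LinearMap.comp_assoc]

theorem map_comp_apply (g : Y →ₗ[R] Z) (f : X →ₗ[R] Y) (w : MultSpace e i X) :
    map e i (g ∘ₗ f) w = map e i g (map e i f w) := by
  rw [map_comp, LinearMap.comp_apply]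

theorem cls_eq_of_matrixOf_eq {f g : Module.End R M}
    (h : ∀ i, SimpleRow.matrixOf e i f = SimpleRow.matrixOf e i g) : cls f = cls g := by
  rw [Submodule.Quotient.eq]
  refine Submodule.subset_span ⟨f - g, (SimpleRow.mem_jacobson_iff e).2 fun i => ?_, 1, rfl⟩
  rw [map_sub, h, sub_self]

theorem mem_jacobson_of_cls_eq_zero {f : Module.End R M} (h : cls f = 0) :
    f ∈ Ring.jacobson (Module.End R M) := by
  rw [Submodule.Quotient.mk_eq_zero] at h
  induction h using Submodule.span_induction with
  | mem _ hx =>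
    obtain ⟨j, hj, x, rfl⟩ := hx
    exact Ideal.mul_mem_left _ x hj
  | zero => exact zero_mem _
  | add _ _ _ _ hx hy => exact add_mem hx hy
  | smul a x _ hx => exact Ideal.mul_mem_right a.unop _ hx

/-- The element of the multiplicity space of `M` given by a column `c`: it sends a row `v` to the
class of an endomorphism whose `i`-th matrix is the rank one matrix `c v`. -/
def col (c : Fin (n i) → D i) : MultSpace e i M :=
  show SimpleRow e i →ₗ[(Module.End R M)ᵐᵒᵖ]
      ((M →ₗ[R] M) ⧸ mulJacobson (Module.End R M) (M →ₗ[R] M)) from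
  { toFun v := cls (SimpleRow.lift e (Matrix.vecMulVec c (SimpleRow.toRow e i v)))
    map_add' v v' := by
      rw [← Submodule.Quotient.mk_add]
      refine cls_eq_of_matrixOf_eq e fun j => ?_
      rw [map_add]
      rcases eq_or_ne j i with rfl | h
      · simp only [SimpleRow.matrixOf_lift, map_add, Matrix.vecMulVec_add]
      · simp only [map_add, SimpleRow.matrixOf_lift_of_ne e h, add_zero]
    map_smul' f v := by
      refine Eq.trans (b := cls (SimpleRow.lift e (Matrix.vecMulVec c (SimpleRow.toRow e i v)) *
        f.unop)) (cls_eq_of_matrixOf_eq e fun j => ?_) rfl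
      rw [map_mul]
      rcases eq_or_ne j i with rfl | h
      · rw [SimpleRow.matrixOf_lift, SimpleRow.matrixOf_lift, Matrix.vecMulVec_mul]
        rfl
      · rw [SimpleRow.matrixOf_lift_of_ne e h, SimpleRow.matrixOf_lift_of_ne e h, zero_mul] }

theorem hom_col (c : Fin (n i) → D i) (v : SimpleRow e i) :
    hom (col e i c) v = cls (SimpleRow.lift e (Matrix.vecMulVec c (SimpleRow.toRow e i v))) := rfl

theorem col_add (c c' : Fin (n i) → D i) : col e i (c + c') = col e i c + col e i c' := by
  ext v
  rw [map_add, LinearMap.add_apply, hom_col, hom_col, hom_col, ← Submodule.Quotient.mk_add]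
  refine cls_eq_of_matrixOf_eq e fun j => ?_
  rw [map_add]
  rcases eq_or_ne j i with rfl | h
  · simp only [SimpleRow.matrixOf_lift, Matrix.add_vecMulVec]
  · simp only [SimpleRow.matrixOf_lift_of_ne e h, add_zero]

theorem col_smul (d : (D i)ᵐᵒᵖ) (c : Fin (n i) → D i) : col e i (d • c) = d • col e i c := by
  ext v
  change cls (SimpleRow.lift e (Matrix.vecMulVec (d • c) (SimpleRow.toRow e i v))) =
    cls (SimpleRow.lift e (Matrix.vecMulVec c (d.unop • SimpleRow.toRow e i v)))
  congr 2
  ext a b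
  simp only [Matrix.vecMulVec_apply, Pi.smul_apply, MulOpposite.smul_eq_mul_unop, smul_eq_mul,
    mul_assoc]

theorem map_col (f : Module.End R M) (c : Fin (n i) → D i) :
    map e i f (col e i c) = col e i (SimpleRow.matrixOf e i f *ᵥ c) := by
  ext v
  rw [map_apply_of_eq (hom_col e i c v), hom_col]
  refine cls_eq_of_matrixOf_eq (f := f * SimpleRow.lift e _) e fun j => ?_
  rw [map_mul]
  rcases eq_or_ne j i with rfl | h
  · rw [SimpleRow.matrixOf_lift, SimpleRow.matrixOf_lift, Matrix.mul_vecMulVec]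
  · rw [SimpleRow.matrixOf_lift_of_ne e h, SimpleRow.matrixOf_lift_of_ne e h, mul_zero]

theorem col_injective : Function.Injective (col e i) := by
  refine (injective_iff_map_eq_zero (AddMonoidHom.mk' (col e i) (col_add e i))).2 fun c hc => ?_
  ext k
  have hcls : cls (SimpleRow.lift e (Matrix.vecMulVec c (Pi.single k 1))) = 0 :=
    (hom_col e i c ((SimpleRow.toRow e i).symm (Pi.single k 1))).symm.trans
      (congrArg (fun w => hom w _) hc)
  have hvec := (SimpleRow.mem_jacobson_iff e).1 (mem_jacobson_of_cls_eq_zero hcls) i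
  rw [SimpleRow.matrixOf_lift] at hvec
  simpa [Matrix.vecMulVec_apply] using congrFun (congrFun hvec k) k

variable [∀ i, NeZero (n i)]

/-- The element of the multiplicity space of `M` given by the first standard basis column. By
`exists_eq_map_gen` it generates all multiplicity spaces under maps out of `M`. -/
def gen : MultSpace e i M := col e i (Pi.single 0 1)

variable {e i}

theorem exists_eq_map_gen (w : MultSpace e i X) : ∃ p : M →ₗ[R] X, w = map e i p (gen e i) := by
  obtain ⟨p, hp⟩ := Submodule.Quotient.mk_surjective _
    (hom w ((SimpleRow.toRow e i).symm (Pi.single 0 1)))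
  refine ⟨p, ?_⟩
  ext v
  rw [gen, map_apply_of_eq (hom_col e i _ v)]
  set f := SimpleRow.lift e (Matrix.vecMulVec (Pi.single 0 1) (SimpleRow.toRow e i v)) with hf
  have hv : v = MulOpposite.op f • (SimpleRow.toRow e i).symm (Pi.single 0 1) := by
    change v = (SimpleRow.toRow e i).symm (Matrix.vecMul (Pi.single 0 1)
      (SimpleRow.matrixOf e i f))
    rw [hf, SimpleRow.matrixOf_lift, LinearEquiv.eq_symm_apply, Matrix.single_one_vecMul]
    ext b
    simp [Matrix.vecMulVec_apply]
  rw [hv, map_smul, ← hp]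
  rfl

variable (e i)

/-- The multiplicity space of `M` is the space of columns. -/
def colEquiv : (Fin (n i) → D i) ≃ₗ[(D i)ᵐᵒᵖ] MultSpace e i M :=
  LinearEquiv.ofBijective
    { toFun := col e i
      map_add' := col_add e i
      map_smul' := col_smul e i } <| by
    refine ⟨col_injective e i, fun w => ?_⟩
    obtain ⟨p, rfl⟩ := exists_eq_map_gen w
    exact ⟨_, (map_col e i p _).symm⟩

theorem colEquiv_apply (c : Fin (n i) → D i) : colEquiv e i c = col e i c := rfl

instance (K : Type*) [Semiring K] : Module.Finite Kᵐᵒᵖ K :=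
  .equiv (MulOpposite.opLinearEquiv Kᵐᵒᵖ).symm

instance : Module.Finite (D i)ᵐᵒᵖ (MultSpace e i M) := .equiv (colEquiv e i)

theorem rank_self : Module.rank (D i)ᵐᵒᵖ (MultSpace e i M) = n i := by
  rw [← Module.finrank_eq_rank, ← (colEquiv e i).finrank_eq, Module.finrank_pi_fintype,
    (MulOpposite.opLinearEquiv (D i)ᵐᵒᵖ (M := D i)).finrank_eq]
  simp

variable {e i}

theorem linearMap_ext_col {W : Type*} [AddCommGroup W] [Module (D i)ᵐᵒᵖ W]
    {a b : MultSpace e i M →ₗ[(D i)ᵐᵒᵖ] W} (h : ∀ c, a (col e i c) = b (col e i c)) : a = b :=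
  (LinearMap.cancel_right (colEquiv e i).surjective).1
    (LinearMap.ext h : a ∘ₗ (colEquiv e i).toLinearMap = b ∘ₗ (colEquiv e i).toLinearMap)

protected theorem map_eq_zero_iff {f : Module.End R M} :
    map e i f = 0 ↔ SimpleRow.matrixOf e i f = 0 := by
  constructor
  · intro h
    refine Matrix.ext_of_mulVec_single fun k => col_injective e i ?_
    rw [← map_col, h, LinearMap.zero_apply, Matrix.zero_mulVec]
    exact (map_zero (colEquiv e i)).symm
  · intro h
    refine linearMap_ext_col fun c => ?_
    rw [map_col, h, Matrix.zero_mulVec, LinearMap.zero_apply]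
    exact map_zero (colEquiv e i)

end MultSpace

end MultiplicitySpaces

/-! ## The categories `add(M)` and `Add(M)` -/

section FinsuppDecomposition

variable {R : Type*} [Semiring R] {M X ι : Type*} [AddCommMonoid M] [Module R M]
  [AddCommMonoid X] [Module R X]

theorem exists_sum_single_eq_of_fg {N : Submodule R (ι →₀ X)} (hN : N.FG) :
    ∃ t : Finset ι, ∀ x ∈ N, ∑ k ∈ t, Finsupp.single k (x k) = x := by
  classical
  obtain ⟨c, rfl⟩ := hN
  refine ⟨c.biUnion Finsupp.support, fun x hx => ?_⟩
  have hsupp : Submodule.span R (c : Set (ι →₀ X)) ≤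
      Finsupp.supported X R (c.biUnion Finsupp.support : Set ι) :=
    Submodule.span_le.2 fun y hy =>
      Finset.coe_subset.2 (Finset.subset_biUnion_of_mem Finsupp.support hy)
  rw [← Finsupp.sum_of_support_subset x (Finset.coe_subset.1 (hsupp hx)) Finsupp.single (by simp),
    Finsupp.sum_single]

theorem exists_eq_sum_lsingle_comp [Module.Finite R M] (p : M →ₗ[R] (ι →₀ X)) :
    ∃ t : Finset ι, p = ∑ k ∈ t, Finsupp.lsingle k ∘ₗ (Finsupp.lapply k ∘ₗ p) := by
  obtain ⟨t, ht⟩ := exists_sum_single_eq_of_fg (N := LinearMap.range p)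
    (by rw [LinearMap.range_eq_map]; exact Module.Finite.fg_top.map p)
  refine ⟨t, LinearMap.ext fun m => (ht _ ⟨m, rfl⟩).symm.trans ?_⟩
  simp only [LinearMap.sum_apply, LinearMap.comp_apply, Finsupp.lsingle_apply,
    Finsupp.lapply_apply]

end FinsuppDecomposition

section FiniteMaps

variable (R : Type u) [CommRing R] (M : Type v) [AddCommGroup M] [Module R M]
variable (X Y Z : Type v) [AddCommGroup X] [Module R X] [AddCommGroup Y] [Module R Y]
  [AddCommGroup Z] [Module R Z]

/-- The maps `X → Y` that factor through a finite power of `M`. -/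
def finMaps : Submodule R (X →ₗ[R] Y) :=
  Submodule.span R {φ | ∃ (g : M →ₗ[R] Y) (f : X →ₗ[R] M), φ = g ∘ₗ f}

variable {R M X Y Z}

theorem comp_mem_finMaps (g : M →ₗ[R] Y) (f : X →ₗ[R] M) : g ∘ₗ f ∈ finMaps R M X Y :=
  Submodule.subset_span ⟨g, f, rfl⟩

theorem comp_left_mem_finMaps {φ : X →ₗ[R] Y} (hφ : φ ∈ finMaps R M X Y) (ψ : Y →ₗ[R] Z) :
    ψ ∘ₗ φ ∈ finMaps R M X Z := by
  refine Submodule.span_le (p := (finMaps R M X Z).comap (LinearMap.llcomp R X Y Z ψ)).2 ?_ hφ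
  rintro _ ⟨g, f, rfl⟩
  exact comp_mem_finMaps (ψ ∘ₗ g) f

theorem comp_right_mem_finMaps {φ : Y →ₗ[R] Z} (hφ : φ ∈ finMaps R M Y Z) (ψ : X →ₗ[R] Y) :
    φ ∘ₗ ψ ∈ finMaps R M X Z := by
  refine Submodule.span_le (p := (finMaps R M X Z).comap (LinearMap.lcomp R Z ψ)).2 ?_ hφ
  rintro _ ⟨g, f, rfl⟩
  exact comp_mem_finMaps g (f ∘ₗ ψ)

theorem exists_sum_of_mem_finMaps {φ : X →ₗ[R] Y} (hφ : φ ∈ finMaps R M X Y) :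
    ∃ (k : ℕ) (g : Fin k → M →ₗ[R] Y) (f : Fin k → X →ₗ[R] M), φ = ∑ j, g j ∘ₗ f j := by
  induction hφ using Submodule.span_induction with
  | mem x hx =>
    obtain ⟨g, f, rfl⟩ := hx
    exact ⟨1, fun _ => g, fun _ => f, by simp⟩
  | zero => exact ⟨0, 0, 0, by simp⟩
  | add x y _ _ hx hy =>
    obtain ⟨k, g, f, rfl⟩ := hx
    obtain ⟨k', g', f', rfl⟩ := hy
    exact ⟨k + k', Fin.append g g', Fin.append f f', by simp [Fin.sum_univ_add]⟩
  | smul r x _ hx =>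
    obtain ⟨k, g, f, rfl⟩ := hx
    exact ⟨k, fun j => r • g j, f, by simp [Finset.smul_sum, LinearMap.smul_comp]⟩

theorem sum_mem_finMaps {ι : Type*} (t : Finset ι) (g : ι → M →ₗ[R] Y) (f : ι → X →ₗ[R] M) :
    ∑ j ∈ t, g j ∘ₗ f j ∈ finMaps R M X Y :=
  Submodule.sum_mem _ fun _ _ => comp_mem_finMaps _ _

theorem mem_finMaps_of_pi {ι : Type*} [Finite ι] (β : (ι → M) →ₗ[R] Y)
    (α : X →ₗ[R] (ι → M)) : β ∘ₗ α ∈ finMaps R M X Y := by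
  classical
  cases nonempty_fintype ι
  have : β ∘ₗ α = ∑ j, (β ∘ₗ LinearMap.single R (fun _ => M) j) ∘ₗ (LinearMap.proj j ∘ₗ α) := by
    ext x
    simp only [LinearMap.comp_apply, LinearMap.sum_apply, ← map_sum]
    congr 1
    exact (Finset.univ_sum_single _).symm
  rw [this]
  exact sum_mem_finMaps _ _ _

theorem inFinAdd_iff_id_mem : InFinAdd R M X ↔ LinearMap.id ∈ finMaps R M X X := by
  constructor
  · rintro ⟨k, f, g, h⟩
    rw [← h]
    exact mem_finMaps_of_pi g f
  · intro h
    obtain ⟨k, g, f, hk⟩ := exists_sum_of_mem_finMaps h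
    refine ⟨k, LinearMap.pi f, ∑ j, g j ∘ₗ LinearMap.proj j, ?_⟩
    rw [hk]
    ext x
    simp

theorem InFinAdd.mem_finMaps (h : InFinAdd R M X) (φ : X →ₗ[R] Y) : φ ∈ finMaps R M X Y :=
  comp_left_mem_finMaps (inFinAdd_iff_id_mem.1 h) φ

theorem inFinAdd_of_retract {α : X →ₗ[R] Y} {β : Y →ₗ[R] X} (hβα : β ∘ₗ α = LinearMap.id)
    (h : α ∘ₗ β ∈ finMaps R M Y Y) : InFinAdd R M X := by
  rw [inFinAdd_iff_id_mem]
  have : (LinearMap.id : X →ₗ[R] X) = β ∘ₗ (α ∘ₗ β) ∘ₗ α := by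
    rw [← LinearMap.comp_assoc, ← LinearMap.comp_assoc, hβα, LinearMap.comp_assoc, hβα,
      LinearMap.id_comp]
  rw [this]
  exact comp_left_mem_finMaps (comp_right_mem_finMaps h α) β

theorem InFinAdd.of_retract {α : X →ₗ[R] Y} {β : Y →ₗ[R] X} (h : InFinAdd R M Y)
    (hβα : β ∘ₗ α = LinearMap.id) : InFinAdd R M X :=
  inFinAdd_of_retract hβα (h.mem_finMaps _)

theorem inFinAdd_self : InFinAdd R M M :=
  inFinAdd_iff_id_mem.2 (comp_mem_finMaps LinearMap.id LinearMap.id)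

theorem InFinAdd.finite [Module.Finite R M] (h : InFinAdd R M X) : Module.Finite R X := by
  obtain ⟨k, f, g, h⟩ := h
  exact Module.Finite.of_surjective g fun x => ⟨f x, LinearMap.congr_fun h x⟩

theorem range_fg_of_mem_finMaps [IsNoetherian R M] {φ : X →ₗ[R] Y} (hφ : φ ∈ finMaps R M X Y) :
    (LinearMap.range φ).FG := by
  obtain ⟨k, g, f, rfl⟩ := exists_sum_of_mem_finMaps hφ
  have : (∑ j, g j ∘ₗ f j) = (∑ j, g j ∘ₗ LinearMap.proj j : (Fin k → M) →ₗ[R] Y) ∘ₗ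
      LinearMap.pi f := by
    ext x
    simp
  rw [this, LinearMap.range_comp]
  exact (IsNoetherian.noetherian (LinearMap.range (LinearMap.pi f))).map _

theorem InAdd.of_retract {α : X →ₗ[R] Y} {β : Y →ₗ[R] X} (h : InAdd R M Y)
    (hβα : β ∘ₗ α = LinearMap.id) : InAdd R M X := by
  obtain ⟨ι, f, g, h⟩ := h
  refine ⟨ι, f ∘ₗ α, β ∘ₗ g, ?_⟩
  rw [LinearMap.comp_assoc, ← LinearMap.comp_assoc _ f, h, LinearMap.id_comp, hβα]

theorem inAdd_finsupp (ι : Type v) : InAdd R M (ι →₀ M) :=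
  ⟨ι, LinearMap.id, LinearMap.id, rfl⟩

theorem InFinAdd.inAdd (h : InFinAdd R M X) : InAdd R M X := by
  obtain ⟨k, f, g, h⟩ := h
  let E : (ULift.{v} (Fin k) →₀ M) ≃ₗ[R] (Fin k → M) :=
    Finsupp.linearEquivFunOnFinite R M _ ≪≫ₗ LinearEquiv.funCongrLeft R M Equiv.ulift.symm
  refine InAdd.of_retract (inAdd_finsupp (ULift.{v} (Fin k))) (α := E.symm.toLinearMap ∘ₗ f)
    (β := g ∘ₗ E.toLinearMap) ?_
  rw [← h]
  ext x
  simp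

theorem InAdd.finsupp (h : InAdd R M X) (ι : Type v) : InAdd R M (ι →₀ X) := by
  obtain ⟨κ, f, g, h⟩ := h
  refine InAdd.of_retract (Y := ι × κ →₀ M) (inAdd_finsupp (ι × κ))
    (α := (Finsupp.curryLinearEquiv R).symm.toLinearMap ∘ₗ Finsupp.mapRange.linearMap f)
    (β := Finsupp.mapRange.linearMap g ∘ₗ (Finsupp.curryLinearEquiv R).toLinearMap) ?_
  ext x y
  simp [← LinearMap.comp_apply, h]

theorem InAdd.finsupp_nat (h : InAdd R M X) : InAdd R M (ℕ →₀ X) :=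
  let E : (ULift.{v} ℕ →₀ X) ≃ₗ[R] (ℕ →₀ X) := Finsupp.domLCongr Equiv.ulift
  InAdd.of_retract (h.finsupp (ULift.{v} ℕ)) (α := E.symm.toLinearMap)
    (β := E.toLinearMap) (by ext; simp)

theorem inAdd_self : InAdd R M M := inFinAdd_self.inAdd

theorem InAdd.prod (hX : InAdd R M X) (hY : InAdd R M Y) : InAdd R M (X × Y) := by
  obtain ⟨κ, f, g, h⟩ := hX
  obtain ⟨κ', f', g', h'⟩ := hY
  refine InAdd.of_retract (Y := κ ⊕ κ' →₀ M) (inAdd_finsupp (κ ⊕ κ'))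
    (α := (Finsupp.sumFinsuppLEquivProdFinsupp R).symm.toLinearMap ∘ₗ LinearMap.prodMap f f')
    (β := LinearMap.prodMap g g' ∘ₗ (Finsupp.sumFinsuppLEquivProdFinsupp R).toLinearMap) ?_
  ext x <;> simp [← LinearMap.comp_apply, h, h']

theorem InAdd.exists_finMaps_eqOn (h : InAdd R M X) {N : Submodule R X} (hN : N.FG) :
    ∃ φ ∈ finMaps R M X X, ∀ x ∈ N, φ x = x := by
  obtain ⟨ι, f, g, h⟩ := h
  obtain ⟨t, ht⟩ := exists_sum_single_eq_of_fg (hN.map f)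
  refine ⟨∑ k ∈ t, (g ∘ₗ Finsupp.lsingle k) ∘ₗ (Finsupp.lapply k ∘ₗ f), sum_mem_finMaps _ _ _,
    fun x hx => ?_⟩
  simp only [LinearMap.sum_apply, LinearMap.comp_apply, ← map_sum, Finsupp.lsingle_apply,
    Finsupp.lapply_apply]
  rw [ht _ (Submodule.mem_map_of_mem hx), ← LinearMap.comp_apply, h, LinearMap.id_apply]

theorem InAdd.exists_finMaps_comp_eq (h : InAdd R M X) [Module.Finite R Y] (p : Y →ₗ[R] X) :
    ∃ φ ∈ finMaps R M X X, φ ∘ₗ p = p := by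
  obtain ⟨φ, hφ, h⟩ := h.exists_finMaps_eqOn (N := LinearMap.range p)
    (by rw [LinearMap.range_eq_map]; exact Module.Finite.fg_top.map p)
  exact ⟨φ, hφ, LinearMap.ext fun y => h _ ⟨y, rfl⟩⟩

theorem InAdd.inFinAdd [Module.Finite R X] (h : InAdd R M X) : InFinAdd R M X := by
  obtain ⟨φ, hφ, h⟩ := h.exists_finMaps_comp_eq (LinearMap.id (R := R) (M := X))
  rw [LinearMap.comp_id] at h
  exact inFinAdd_iff_id_mem.2 (h ▸ hφ)

theorem InAdd.eq_zero_of_comp_eq_zero (h : InAdd R M X) {p : Y →ₗ[R] X}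
    (hp : ∀ k : X →ₗ[R] M, k ∘ₗ p = 0) : p = 0 := by
  obtain ⟨ι, f, g, h⟩ := h
  have : f ∘ₗ p = 0 := by
    ext y k
    exact LinearMap.congr_fun (hp (Finsupp.lapply k ∘ₗ f)) y
  rw [← LinearMap.id_comp p, ← h, LinearMap.comp_assoc, this, LinearMap.comp_zero]

theorem InAdd.eq_zero_of_eq_zero_comp (h : InAdd R M X) {p : X →ₗ[R] Y}
    (hp : ∀ k : M →ₗ[R] X, p ∘ₗ k = 0) : p = 0 := by
  obtain ⟨ι, f, g, h⟩ := h
  have : p ∘ₗ g = 0 := by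
    ext k y
    exact LinearMap.congr_fun (hp (g ∘ₗ Finsupp.lsingle k)) y
  rw [← LinearMap.comp_id p, ← h, ← LinearMap.comp_assoc, this, LinearMap.zero_comp]

end FiniteMaps

/-! ## Lifting families of linear maps between multiplicity spaces -/

theorem le_of_le_sup_jacobson_smul_of_fg {S P : Type*} [Ring S] [AddCommGroup P] [Module S P]
    {N N' : Submodule S P} (hN : N.FG) (h : N ≤ N' ⊔ Ring.jacobson S • N) : N ≤ N' := by
  have hbot := (hN.map N'.mkQ).eq_bot_of_le_jacobson_smul (by
    calc N.map N'.mkQ ≤ (N' ⊔ Ring.jacobson S • N).map N'.mkQ := Submodule.map_mono h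
      _ = Ring.jacobson S • N.map N'.mkQ := by
        rw [Submodule.map_sup, Submodule.mkQ_map_self, bot_sup_eq, Submodule.map_smul''])
  rwa [← le_bot_iff, Submodule.map_le_iff_le_comap, Submodule.comap_bot, Submodule.ker_mkQ] at hbot

section Lifting

variable {R : Type u} [CommRing R] {M : Type v} [AddCommGroup M] [Module R M]
variable {s : ℕ} {n : Fin s → ℕ} [∀ i, NeZero (n i)] {D : Fin s → Type w}
  [∀ i, DivisionRing (D i)]
variable (e : Module.End R M ⧸ Ring.jacobson (Module.End R M) ≃+*
  ∀ i, Matrix (Fin (n i)) (Fin (n i)) (D i))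
variable {X Y Z : Type v} [AddCommGroup X] [Module R X] [AddCommGroup Y] [Module R Y]
  [AddCommGroup Z] [Module R Z]

namespace MultSpace

open scoped Matrix

variable {i : Fin s}

theorem map_eq_zero_of_map_comp_eq_zero {f : X →ₗ[R] Y}
    (h : ∀ p : M →ₗ[R] X, map e i (f ∘ₗ p) = 0) : map e i f = 0 := by
  ext1 w
  obtain ⟨p, rfl⟩ := exists_eq_map_gen w
  rw [← map_comp_apply, h, LinearMap.zero_apply, LinearMap.zero_apply]

theorem eq_zero_of_map_eq_zero [Module.Finite R M] (hX : InAdd R M X)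
    {w : MultSpace e i X} (h : ∀ q : X →ₗ[R] M, map e i q w = 0) : w = 0 := by
  obtain ⟨p, rfl⟩ := exists_eq_map_gen w
  obtain ⟨φ, hφ, h'⟩ := hX.exists_finMaps_comp_eq p
  obtain ⟨m, g, f, rfl⟩ := exists_sum_of_mem_finMaps hφ
  rw [← h', map_comp_apply, map_sum, LinearMap.sum_apply]
  exact Finset.sum_eq_zero fun j _ => by rw [map_comp_apply, h, map_zero]

theorem map_eq_zero_of_matrixOf [Module.Finite R M] (hY : InAdd R M Y) {f : X →ₗ[R] Y}
    (h : ∀ (p : M →ₗ[R] X) (q : Y →ₗ[R] M), SimpleRow.matrixOf e i (q ∘ₗ f ∘ₗ p) = 0) :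
    map e i f = 0 := by
  refine map_eq_zero_of_map_comp_eq_zero e fun p => ?_
  ext1 w
  refine eq_zero_of_map_eq_zero e hY fun q => ?_
  rw [← map_comp_apply, MultSpace.map_eq_zero_iff.2 (h p q), LinearMap.zero_apply]

theorem matrixOf_eq_zero_of_map {f : X →ₗ[R] Y} (h : map e i f = 0)
    (p : M →ₗ[R] X) (q : Y →ₗ[R] M) : SimpleRow.matrixOf e i (q ∘ₗ f ∘ₗ p) = 0 := by
  rw [← MultSpace.map_eq_zero_iff, map_comp, map_comp, h, LinearMap.zero_comp, LinearMap.comp_zero]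

theorem map_lift_one : map e i (SimpleRow.lift e (1 : Matrix (Fin (n i)) (Fin (n i)) (D i))) =
    LinearMap.id :=
  linearMap_ext_col fun c => by
    rw [map_col, SimpleRow.matrixOf_lift, Matrix.one_mulVec, LinearMap.id_apply]

theorem map_lift_of_ne {j : Fin s} (h : j ≠ i) (A : Matrix (Fin (n i)) (Fin (n i)) (D i)) :
    map e j (SimpleRow.lift e A) = 0 :=
  MultSpace.map_eq_zero_iff.2 (SimpleRow.matrixOf_lift_of_ne e h A)

theorem exists_map_eq_of_self_apply (a : MultSpace e i M →ₗ[(D i)ᵐᵒᵖ] MultSpace e i Y) :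
    ∃ f : M →ₗ[R] Y, map e i f = a := by
  choose p hp using fun k : Fin (n i) => exists_eq_map_gen (a (col e i (Pi.single k 1)))
  refine ⟨∑ k, p k ∘ₗ SimpleRow.lift e (Matrix.single 0 k 1), linearMap_ext_col fun c => ?_⟩
  have hsingle (k : Fin (n i)) : Matrix.single (0 : Fin (n i)) k (1 : D i) *ᵥ c =
      MulOpposite.op (c k) • Pi.single 0 1 := by
    rw [Matrix.single_mulVec, one_mul, ← Pi.single_smul, op_smul_eq_mul, one_mul]
    rfl
  have hc : c = ∑ k, MulOpposite.op (c k) • Pi.single k (1 : D i) := by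
    ext l
    simp [Finset.sum_apply, Pi.single_apply]
  calc map e i (∑ k, p k ∘ₗ SimpleRow.lift e (Matrix.single 0 k 1)) (col e i c)
      = ∑ k, MulOpposite.op (c k) • a (col e i (Pi.single k 1)) := by
        rw [map_sum, LinearMap.sum_apply]
        refine Finset.sum_congr rfl fun k _ => ?_
        rw [map_comp_apply, map_col, SimpleRow.matrixOf_lift, hsingle, col_smul, map_smul, hp, gen]
    _ = a (col e i c) := by
        conv_rhs => rw [hc, ← colEquiv_apply]
        simp only [map_sum, map_smul, colEquiv_apply]

theorem exists_map_eq_of_self (a : ∀ i, MultSpace e i M →ₗ[(D i)ᵐᵒᵖ] MultSpace e i Y) :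
    ∃ f : M →ₗ[R] Y, ∀ i, map e i f = a i := by
  choose p hp using fun i => exists_map_eq_of_self_apply e (a i)
  refine ⟨∑ i, p i ∘ₗ SimpleRow.lift e (1 : Matrix (Fin (n i)) (Fin (n i)) (D i)), fun j => ?_⟩
  rw [map_sum, Finset.sum_eq_single_of_mem j (Finset.mem_univ j), map_comp, map_lift_one,
    LinearMap.comp_id, hp]
  intro i _ hij
  rw [map_comp, map_lift_of_ne e hij.symm, LinearMap.comp_zero]

theorem exists_map_eq [Module.Finite R M] (hX : InAdd R M X)
    (a : ∀ i, MultSpace e i X →ₗ[(D i)ᵐᵒᵖ] MultSpace e i Y) :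
    ∃ f : X →ₗ[R] Y, ∀ i, map e i f = a i := by
  obtain ⟨ι, f, g, h⟩ := hX
  choose q hq using fun k : ι => exists_map_eq_of_self e (Y := Y)
    fun i => a i ∘ₗ map e i (g ∘ₗ Finsupp.lsingle k)
  have hlsum : ∀ i (w : MultSpace e i (ι →₀ M)),
      map e i (Finsupp.lsum R q) w = a i (map e i g w) := by
    intro i w
    obtain ⟨p, rfl⟩ := exists_eq_map_gen w
    obtain ⟨t, ht⟩ := exists_eq_sum_lsingle_comp p
    rw [ht, map_sum, LinearMap.sum_apply, map_sum, map_sum, map_sum]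
    refine Finset.sum_congr rfl fun k _ => ?_
    rw [map_comp_apply, ← map_comp_apply e i (Finsupp.lsum R q), Finsupp.lsum_comp_lsingle, hq,
      LinearMap.comp_apply, map_comp_apply]
  refine ⟨Finsupp.lsum R q ∘ₗ f, fun i => LinearMap.ext fun w => ?_⟩
  rw [map_comp_apply, hlsum, ← map_comp_apply, h, map_id, LinearMap.id_apply]

end MultSpace

end Lifting

/-! ## Dimension vectors -/

section Dimensions

open MultSpace

variable {R : Type u} [CommRing R] {M : Type v} [AddCommGroup M] [Module R M]
variable {s : ℕ} {n : Fin s → ℕ} {D : Fin s → Type w} [∀ i, DivisionRing (D i)]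
variable (e : Module.End R M ⧸ Ring.jacobson (Module.End R M) ≃+*
  ∀ i, Matrix (Fin (n i)) (Fin (n i)) (D i))
variable {X Y Z : Type v} [AddCommGroup X] [Module R X] [AddCommGroup Y] [Module R Y]
  [AddCommGroup Z] [Module R Z]

theorem dimHom_self [∀ i, NeZero (n i)] : dimHom e M = castVec n := by
  ext1 i
  rw [dimHom_apply, rank_self, Cardinal.toENat_nat]
  rfl

theorem dimHom_ne_top_iff (i : Fin s) :
    dimHom e X i ≠ ⊤ ↔ Module.Finite (D i)ᵐᵒᵖ (MultSpace e i X) := by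
  rw [dimHom_apply, Cardinal.toENat_ne_top, Module.rank_lt_aleph0_iff]

theorem dimHom_eq_zero_iff (i : Fin s) : dimHom e X i = 0 ↔ ∀ w : MultSpace e i X, w = 0 := by
  rw [dimHom_apply, Cardinal.toENat_eq_zero, rank_zero_iff_forall_zero]

theorem dimHom_eq_zero_iff_map_id (i : Fin s) :
    dimHom e X i = 0 ↔ map e i (LinearMap.id : X →ₗ[R] X) = 0 := by
  rw [dimHom_eq_zero_iff, map_id]
  exact ⟨fun h => LinearMap.ext h, fun h w => LinearMap.congr_fun h w⟩

theorem comp_eq_zero_of_comp_add_comp_eq_id {a : Y →ₗ[R] X} {b : X →ₗ[R] Y} {c : Z →ₗ[R] X}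
    {d : X →ₗ[R] Z} (hba : b ∘ₗ a = LinearMap.id) (hdc : d ∘ₗ c = LinearMap.id)
    (h : a ∘ₗ b + c ∘ₗ d = LinearMap.id) : b ∘ₗ c = 0 := by
  have hbcd : b + (b ∘ₗ c) ∘ₗ d = b := by
    calc b + (b ∘ₗ c) ∘ₗ d = b ∘ₗ (a ∘ₗ b + c ∘ₗ d) := by
          rw [LinearMap.comp_add, ← LinearMap.comp_assoc, hba, LinearMap.id_comp,
            LinearMap.comp_assoc]
      _ = b := by rw [h, LinearMap.comp_id]
  rw [← LinearMap.comp_id (b ∘ₗ c), ← hdc, ← LinearMap.comp_assoc, add_eq_left.1 hbcd,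
    LinearMap.zero_comp]

theorem dimHom_eq_add {a : Y →ₗ[R] X} {b : X →ₗ[R] Y} {c : Z →ₗ[R] X} {d : X →ₗ[R] Z}
    (hba : b ∘ₗ a = LinearMap.id) (hdc : d ∘ₗ c = LinearMap.id)
    (h : a ∘ₗ b + c ∘ₗ d = LinearMap.id) : dimHom e X = dimHom e Y + dimHom e Z := by
  have hbc : b ∘ₗ c = 0 := comp_eq_zero_of_comp_add_comp_eq_id hba hdc h
  have hda : d ∘ₗ a = 0 :=
    comp_eq_zero_of_comp_add_comp_eq_id hdc hba ((add_comm _ _).trans h)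
  ext1 i
  have E : MultSpace e i X ≃ₗ[(D i)ᵐᵒᵖ] MultSpace e i Y × MultSpace e i Z :=
    LinearEquiv.ofLinearMap ((map e i b).prod (map e i d)) ((map e i a).coprod (map e i c))
      (by ext x <;> simp [← map_comp_apply, hba, hdc, hbc, hda, map_id])
      (by
        ext1 x
        change map e i a (map e i b x) + map e i c (map e i d x) = x
        simp only [← map_comp_apply, ← LinearMap.add_apply, ← map_add, h, map_id,
          LinearMap.id_apply])
  rw [Pi.add_apply, dimHom_apply, dimHom_apply, dimHom_apply, E.rank_eq, rank_prod', map_add]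

theorem dimHom_prod : dimHom e (X × Y) = dimHom e X + dimHom e Y :=
  dimHom_eq_add e (a := LinearMap.inl R X Y) (b := LinearMap.fst R X Y)
    (c := LinearMap.inr R X Y) (d := LinearMap.snd R X Y) (by ext; simp) (by ext; simp)
    (by ext <;> simp)

theorem dimHom_zero [Subsingleton X] : dimHom e X = 0 := by
  ext1 i
  rw [Pi.zero_apply, dimHom_eq_zero_iff_map_id, Subsingleton.elim (LinearMap.id : X →ₗ[R] X) 0,
    map_zero]

theorem dimHom_le_of_retract {a : Y →ₗ[R] X} {b : X →ₗ[R] Y} (hba : b ∘ₗ a = LinearMap.id) :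
    dimHom e Y ≤ dimHom e X := by
  intro i
  rw [dimHom_apply, dimHom_apply]
  refine Cardinal.enat_gc.monotone_u (LinearMap.rank_le_of_injective (map e i a) ?_)
  refine Function.LeftInverse.injective (g := map e i b) fun w => ?_
  rw [← map_comp_apply, hba, map_id, LinearMap.id_apply]

theorem dimHom_eq_of_equiv (E : X ≃ₗ[R] Y) : dimHom e X = dimHom e Y :=
  le_antisymm (dimHom_le_of_retract e E.symm_comp) (dimHom_le_of_retract e E.comp_symm)

theorem dimHom_eq_finrank {i : Fin s} (h : dimHom e X i ≠ ⊤) :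
    dimHom e X i = Module.finrank (D i)ᵐᵒᵖ (MultSpace e i X) := by
  have := (dimHom_ne_top_iff e i).1 h
  rw [dimHom_apply, ← Module.finrank_eq_rank, Cardinal.toENat_nat]

section Families

variable {κ : Type*} {N : κ → Type v} [∀ k, AddCommGroup (N k)] [∀ k, Module R (N k)]
  (a : ∀ k, N k →ₗ[R] X) (b : ∀ k, X →ₗ[R] N k) {i : Fin s}

theorem toENat_rank_pi_multSpace (T : Finset κ) (hfin : ∀ k, dimHom e (N k) i ≠ ⊤) :
    Cardinal.toENat (Module.rank (D i)ᵐᵒᵖ (∀ k : T, MultSpace e i (N k))) =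
      ∑ k ∈ T, dimHom e (N k) i := by
  have := fun k => (dimHom_ne_top_iff e i).1 (hfin k)
  rw [← Module.finrank_eq_rank, Cardinal.toENat_nat, Module.finrank_pi_fintype, Nat.cast_sum,
    ← Finset.sum_coe_sort T]
  exact Finset.sum_congr rfl fun k _ => (dimHom_eq_finrank e (hfin k)).symm

theorem sum_dimHom_le (hba : ∀ k, b k ∘ₗ a k = LinearMap.id)
    (hba' : ∀ k l, k ≠ l → b k ∘ₗ a l = 0) (hfin : ∀ k, dimHom e (N k) i ≠ ⊤) (T : Finset κ) :
    ∑ k ∈ T, dimHom e (N k) i ≤ dimHom e X i := by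
  rw [← toENat_rank_pi_multSpace e T hfin, dimHom_apply]
  have : Function.LeftInverse (LinearMap.pi fun k : T => map e i (b k))
      (∑ k : T, map e i (a k) ∘ₗ LinearMap.proj k :
        (∀ k : T, MultSpace e i (N k)) →ₗ[(D i)ᵐᵒᵖ] MultSpace e i X) := by
    intro f
    ext1 k
    simp only [LinearMap.pi_apply, LinearMap.sum_apply, LinearMap.comp_apply, LinearMap.proj_apply,
      map_sum, ← map_comp_apply]
    rw [Finset.sum_eq_single_of_mem k (Finset.mem_univ k), hba, map_id, LinearMap.id_apply]
    intro l _ hl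
    rw [hba' _ _ fun h => hl (Subtype.ext h.symm), map_zero, LinearMap.zero_apply]
  simpa using Cardinal.enat_gc.monotone_u (LinearMap.lift_rank_le_of_injective _ this.injective)

theorem dimHom_le_sum [∀ i, NeZero (n i)]
    (h : ∀ p : M →ₗ[R] X, ∃ t : Finset κ, p = ∑ k ∈ t, a k ∘ₗ b k ∘ₗ p)
    (hfin : ∀ k, dimHom e (N k) i ≠ ⊤) (T : Finset κ) (hT : ∀ k ∉ T, dimHom e (N k) i = 0) :
    dimHom e X i ≤ ∑ k ∈ T, dimHom e (N k) i := by
  rw [← toENat_rank_pi_multSpace e T hfin, dimHom_apply]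
  have : Function.Injective (LinearMap.pi fun k : T => map e i (b k)) := by
    rw [← LinearMap.ker_eq_bot, LinearMap.ker_eq_bot']
    intro x hx
    have hx' : ∀ k, map e i (b k) x = 0 := by
      intro k
      by_cases hk : k ∈ T
      · exact congrFun hx ⟨k, hk⟩
      · exact (dimHom_eq_zero_iff e i).1 (hT k hk) _
    obtain ⟨p, rfl⟩ := exists_eq_map_gen x
    obtain ⟨t, ht⟩ := h p
    rw [ht, map_sum, LinearMap.sum_apply]
    refine Finset.sum_eq_zero fun k _ => ?_
    rw [map_comp_apply, map_comp_apply, hx', map_zero]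
  simpa using Cardinal.enat_gc.monotone_u (LinearMap.lift_rank_le_of_injective _ this)

end Families

variable [∀ i, NeZero (n i)]

theorem dimHom_finsupp_nat [Module.Finite R M] :
    dimHom e (ℕ →₀ X) = (⊤ : ℕ∞) • dimHom e X := by
  ext1 i
  rw [Pi.smul_apply, smul_eq_mul]
  by_cases h : dimHom e X i = 0
  · rw [h, mul_zero, dimHom_eq_zero_iff]
    intro w
    obtain ⟨p, rfl⟩ := exists_eq_map_gen w
    obtain ⟨t, ht⟩ := exists_eq_sum_lsingle_comp p
    rw [ht, map_sum, LinearMap.sum_apply]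
    refine Finset.sum_eq_zero fun k _ => ?_
    rw [map_comp_apply, map_comp_apply, (dimHom_eq_zero_iff e i).1 h (map e i _ _), map_zero]
  · rw [ENat.top_mul h]
    have E : (ℕ →₀ X) ≃ₗ[R] (ℕ →₀ X) × (PUnit.{1} →₀ X) :=
      Finsupp.domLCongr Equiv.natSumPUnitEquivNat.symm ≪≫ₗ
        Finsupp.sumFinsuppLEquivProdFinsupp R
    have hadd := congrFun (dimHom_eq_of_equiv e E) i
    rw [dimHom_prod, Pi.add_apply,
      dimHom_eq_of_equiv e (Finsupp.uniqueLinearEquiv R X PUnit.unit)] at hadd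
    by_contra htop
    exact h (ENat.add_right_injective_of_ne_top htop (hadd.symm.trans (add_zero _).symm))

theorem InFinAdd.exists_eq_sum_smul (hX : InFinAdd R M X) :
    ∃ (m : ℕ) (g : Fin m → M →ₗ[R] X) (f : Fin m → X →ₗ[R] M),
      ∀ k : X →ₗ[R] M, k = ∑ j, (k ∘ₗ g j : Module.End R M) • f j := by
  obtain ⟨m, g, f, h⟩ := exists_sum_of_mem_finMaps (inFinAdd_iff_id_mem.1 hX)
  refine ⟨m, g, f, fun k => ?_⟩
  conv_lhs => rw [← LinearMap.comp_id k, h]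
  ext x
  simp

theorem InFinAdd.finite_hom (hX : InFinAdd R M X) :
    Module.Finite (Module.End R M) (X →ₗ[R] M) := by
  obtain ⟨m, g, f, h⟩ := hX.exists_eq_sum_smul
  refine ⟨Submodule.fg_def.2 ⟨Set.range f, Set.finite_range f, eq_top_iff.2 fun k _ => ?_⟩⟩
  rw [h k]
  exact Submodule.sum_mem _ fun j _ => Submodule.smul_mem _ _ (Submodule.subset_span ⟨j, rfl⟩)

theorem mem_jacobson_smul_top_of_map_eq_zero (hX : InFinAdd R M X) {k : X →ₗ[R] M}
    (hk : ∀ i, map e i k = 0) :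
    k ∈ Ring.jacobson (Module.End R M) • (⊤ : Submodule (Module.End R M) (X →ₗ[R] M)) := by
  obtain ⟨m, g, f, h⟩ := hX.exists_eq_sum_smul
  rw [h k]
  refine Submodule.sum_mem _ fun j _ => Submodule.smul_mem_smul ?_ Submodule.mem_top
  rw [SimpleRow.mem_jacobson_iff e]
  intro i
  rw [← MultSpace.map_eq_zero_iff, map_comp, hk, LinearMap.zero_comp]

theorem exists_comp_eq_id_of_map_eq_id (hX : InFinAdd R M X)
    {ψ : X →ₗ[R] X} (hψ : ∀ i, map e i ψ = LinearMap.id) : ∃ θ, θ ∘ₗ ψ = LinearMap.id := by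
  have hfg := hX.finite_hom.fg_top
  have hrange : LinearMap.range (LinearMap.lcomp (Module.End R M) M ψ) = ⊤ := by
    refine eq_top_iff.2 (le_of_le_sup_jacobson_smul_of_fg hfg fun k _ => ?_)
    rw [← add_sub_cancel (k ∘ₗ ψ) k]
    refine Submodule.add_mem_sup ⟨k, rfl⟩ (mem_jacobson_smul_top_of_map_eq_zero e hX fun i => ?_)
    rw [map_sub, map_comp, hψ, LinearMap.comp_id, sub_self]
  obtain ⟨m, g, f, h⟩ := exists_sum_of_mem_finMaps (inFinAdd_iff_id_mem.1 hX)
  choose k hk using fun j => LinearMap.range_eq_top.1 hrange (f j)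
  refine ⟨∑ j, g j ∘ₗ k j, ?_⟩
  rw [h]
  ext x
  simp [← hk]

theorem finite_multSpace_of_map_eq_id {φ : Module.End R X} (hφ : φ ∈ finMaps R M X X)
    {i : Fin s} (h : map e i φ = LinearMap.id) : Module.Finite (D i)ᵐᵒᵖ (MultSpace e i X) := by
  obtain ⟨k, g, f, rfl⟩ := exists_sum_of_mem_finMaps hφ
  refine Module.Finite.of_surjective (∑ j, map e i (g j) ∘ₗ LinearMap.proj j :
    (Fin k → MultSpace e i M) →ₗ[(D i)ᵐᵒᵖ] MultSpace e i X) fun w =>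
      ⟨fun j => map e i (f j) w, ?_⟩
  conv_rhs => rw [← LinearMap.id_apply (R := (D i)ᵐᵒᵖ) w, ← h]
  simp [map_comp]

theorem InFinAdd.dimHom_ne_top (hX : InFinAdd R M X) (i : Fin s) : dimHom e X i ≠ ⊤ :=
  (dimHom_ne_top_iff e i).2 (finite_multSpace_of_map_eq_id e (inFinAdd_iff_id_mem.1 hX)
    (map_id e i))

theorem exists_retract_of_dimHom_le [Module.Finite R M]
    (hX : InFinAdd R M X) (hY : InAdd R M Y) (h : dimHom e X ≤ dimHom e Y) :
    ∃ (α : X →ₗ[R] Y) (β : Y →ₗ[R] X), β ∘ₗ α = LinearMap.id := by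
  have hsplit : ∀ i, ∃ (a : MultSpace e i X →ₗ[(D i)ᵐᵒᵖ] MultSpace e i Y)
      (b : MultSpace e i Y →ₗ[(D i)ᵐᵒᵖ] MultSpace e i X), b ∘ₗ a = LinearMap.id := by
    intro i
    have hrank : Module.rank (D i)ᵐᵒᵖ (MultSpace e i X) ≤
        Module.rank (D i)ᵐᵒᵖ (MultSpace e i Y) :=
      (Cardinal.toENat_le_iff_of_le_aleph0
        (Cardinal.toENat_ne_top.1 (hX.dimHom_ne_top e i)).le).1 (h i)
    obtain ⟨a, ha⟩ := rank_le_iff_exists_linearMap.1 hrank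
    obtain ⟨b, hb⟩ := a.exists_leftInverse_of_injective (LinearMap.ker_eq_bot.2 ha)
    exact ⟨a, b, hb⟩
  choose a b hba using hsplit
  obtain ⟨α, hα⟩ := exists_map_eq e hX.inAdd a
  obtain ⟨β, hβ⟩ := exists_map_eq e hY b
  obtain ⟨θ, hθ⟩ := exists_comp_eq_id_of_map_eq_id e hX (ψ := β ∘ₗ α) fun i => by
    rw [map_comp, hα, hβ, hba]
  exact ⟨α, θ ∘ₗ β, hθ⟩

end Dimensions

/-! ## Ideals of finite colength -/

section RestrictedMinimum

/-- The restricted minimum condition: proper factors of `S` by two-sided ideals have the descending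
chain condition on left submodules. This is what the endomorphism ring of a torsion-free module
inherits from a one-dimensional base. -/
class RestrictedMinimumCondition (S : Type*) [Ring S] : Prop where
  isArtinian_quotient (I : Ideal S) [I.IsTwoSided] (hI : I ≠ ⊥) : IsArtinian S (S ⧸ I)

theorem exists_forall_sup_eq_sup {S P : Type*} [Ring S] [AddCommGroup P] [Module S P]
    (K : Submodule S P) [IsArtinian S (P ⧸ K)] {F : ℕ → Submodule S P} (hF : Antitone F) :
    ∃ N, ∀ k, N ≤ k → K ⊔ F N = K ⊔ F k := by
  obtain ⟨N, hN⟩ := IsArtinian.monotone_stabilizes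
    ⟨fun k => OrderDual.toDual ((F k).map K.mkQ), fun _ _ h => Submodule.map_mono (hF h)⟩
  refine ⟨N, fun k hk => ?_⟩
  rw [← Submodule.comap_map_mkQ, ← Submodule.comap_map_mkQ]
  exact congrArg (Submodule.comap K.mkQ) (hN k hk)

variable {S : Type*} [Ring S]

theorem antitone_ideal_pow (I : Ideal S) : Antitone fun k => I ^ k :=
  fun _ _ h => Ideal.pow_le_pow_right h

theorem exists_jacobson_pow_le [IsNoetherianRing S] (I : Ideal S) [IsArtinian S (S ⧸ I)] :
    ∃ k, Ring.jacobson S ^ k ≤ I := by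
  obtain ⟨k, hk⟩ := exists_forall_sup_eq_sup I (antitone_ideal_pow (Ring.jacobson S))
  refine ⟨k, le_of_le_sup_jacobson_smul_of_fg (IsNoetherian.noetherian _) ?_⟩
  calc Ring.jacobson S ^ k ≤ I ⊔ Ring.jacobson S ^ k := le_sup_right
    _ = I ⊔ Ring.jacobson S • Ring.jacobson S ^ k := by
      rw [hk (k + 1) k.le_succ, Ideal.IsTwoSided.pow_succ, smul_eq_mul]

theorem le_of_le_sup_jacobson_of_isIdempotentElem [IsNoetherianRing S] {I K : Ideal S}
    [I.IsTwoSided] (hK : IsIdempotentElem K) (h : K ≤ I ⊔ Ring.jacobson S) : K ≤ I := by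
  refine le_of_le_sup_jacobson_smul_of_fg (IsNoetherian.noetherian K) ?_
  calc K = K * K := hK.symm
    _ ≤ (I ⊔ Ring.jacobson S) * K := Ideal.mul_mono_left h
    _ = I * K ⊔ Ring.jacobson S * K := Ideal.sup_mul _ _ _
    _ ≤ I ⊔ Ring.jacobson S * K := sup_le_sup_right Ideal.mul_le_left _

theorem exists_isIdempotentElem_pow (I : Ideal S) [I.IsTwoSided] {K : Ideal S}
    [IsArtinian S (S ⧸ K)] (h : ∀ k, K ≤ I ^ k) : ∃ k, IsIdempotentElem (I ^ (k + 1)) := by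
  obtain ⟨N, hN⟩ := exists_forall_sup_eq_sup K (antitone_ideal_pow I)
  have hstable {k : ℕ} (hk : N ≤ k) : I ^ N = I ^ k := by
    rw [← sup_eq_right.2 (h N), ← sup_eq_right.2 (h k), hN k hk]
  refine ⟨N, ?_⟩
  rw [IsIdempotentElem, ← Ideal.IsTwoSided.pow_add, ← hstable (by omega), hstable N.le_succ]

end RestrictedMinimum

/-! ## Supports of ideals and trace ideals -/

section IdealSupport

variable {S : Type u} [Ring S] {s : ℕ} {n : Fin s → ℕ} {D : Fin s → Type w}
  [∀ i, DivisionRing (D i)]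
variable (e : S ⧸ Ring.jacobson S ≃+* ∀ i, Matrix (Fin (n i)) (Fin (n i)) (D i))

/-- The support of an ideal: the indices of the simple factors of `S / J(S)` in which the ideal has
a nonzero image. -/
def idealSupport (I : Ideal S) : Set (Fin s) := {i | ∃ x ∈ I, SimpleRow.matrixOf e i x ≠ 0}

theorem idealSupport_mono {I K : Ideal S} (h : I ≤ K) : idealSupport e I ⊆ idealSupport e K :=
  fun _ ⟨x, hx, hx0⟩ => ⟨x, h hx, hx0⟩

theorem notMem_idealSupport {I : Ideal S} {i : Fin s} :
    i ∉ idealSupport e I ↔ ∀ x ∈ I, SimpleRow.matrixOf e i x = 0 := by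
  simp [idealSupport]

theorem exists_mem_matrixOf_eq_one {I : Ideal S} [I.IsTwoSided] {i : Fin s}
    (h : i ∈ idealSupport e I) :
    ∃ u ∈ I, SimpleRow.matrixOf e i u = 1 ∧ ∀ j, j ≠ i → SimpleRow.matrixOf e j u = 0 := by
  obtain ⟨x, hx, hx0⟩ := h
  obtain ⟨a, b, hab⟩ : ∃ a b, SimpleRow.matrixOf e i x a b ≠ 0 := by
    by_contra! h
    exact hx0 (Matrix.ext h)
  refine ⟨∑ k, SimpleRow.lift e (Matrix.single k a (SimpleRow.matrixOf e i x a b)⁻¹) * (x *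
    SimpleRow.lift e (Matrix.single b k 1)), Submodule.sum_mem _ fun k _ =>
      I.mul_mem_left _ (I.mul_mem_right _ hx), ?_, fun j hj => ?_⟩
  · simp only [map_sum, map_mul, SimpleRow.matrixOf_lift]
    rw [← Matrix.sum_single_one]
    refine Finset.sum_congr rfl fun k _ => ?_
    rw [← mul_assoc, Matrix.single_mul_mul_single, mul_one, inv_mul_cancel₀ hab]
  · simp only [map_sum, map_mul, SimpleRow.matrixOf_lift_of_ne e hj, zero_mul,
      Finset.sum_const_zero]

theorem le_sup_jacobson_of_idealSupport_subset {I K : Ideal S} [K.IsTwoSided]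
    (h : idealSupport e I ⊆ idealSupport e K) : I ≤ K ⊔ Ring.jacobson S := by
  intro x hx
  have hcomponent (i : Fin s) : ∃ t ∈ K, ∀ j, SimpleRow.matrixOf e j t =
      if j = i then SimpleRow.matrixOf e j x else 0 := by
    by_cases hi : SimpleRow.matrixOf e i x = 0
    · refine ⟨0, K.zero_mem, fun j => ?_⟩
      rw [map_zero]
      split_ifs with hj
      · rw [hj, hi]
      · rfl
    · obtain ⟨u, hu, hui, huj⟩ := exists_mem_matrixOf_eq_one e (h ⟨x, hx, hi⟩)
      refine ⟨u * x, K.mul_mem_right _ hu, fun j => ?_⟩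
      rw [map_mul]
      split_ifs with hj
      · subst hj
        rw [hui, one_mul]
      · rw [huj j hj, zero_mul]
  choose t ht htx using hcomponent
  rw [← add_sub_cancel (∑ i, t i) x]
  refine Submodule.add_mem_sup (Submodule.sum_mem _ fun i _ => ht i) ?_
  rw [SimpleRow.mem_jacobson_iff e]
  simp [htx]

theorem idealSupport_subset_idealSupport_pow [∀ i, NeZero (n i)] (I : Ideal S) [I.IsTwoSided]
    (k : ℕ) : idealSupport e I ⊆ idealSupport e (I ^ k) := by
  intro i hi
  obtain ⟨u, hu, hui, -⟩ := exists_mem_matrixOf_eq_one e hi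
  exact ⟨u ^ k, Ideal.pow_mem_pow hu k, by rw [map_pow, hui, one_pow]; exact one_ne_zero⟩

end IdealSupport

section TraceIdeal

variable {R : Type u} [CommRing R] {M : Type v} [AddCommGroup M] [Module R M]
variable {X : Type v} [AddCommGroup X] [Module R X]

variable (M) in
/-- The trace ideal of an endomorphism `f` of `X`: the ideal of `End_R(M)` generated by the
compositions of `f` with maps `M → X` and `X → M`. -/
def traceIdeal (f : Module.End R X) : Ideal (Module.End R M) :=
  Ideal.span {x | ∃ (p : M →ₗ[R] X) (q : X →ₗ[R] M), x = q ∘ₗ f ∘ₗ p}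

theorem comp_mem_traceIdeal (f : Module.End R X) (p : M →ₗ[R] X) (q : X →ₗ[R] M) :
    (q ∘ₗ f ∘ₗ p : Module.End R M) ∈ traceIdeal M f :=
  Ideal.subset_span ⟨p, q, rfl⟩

instance (f : Module.End R X) : (traceIdeal M f).IsTwoSided where
  mul_mem_of_left a hx := by
    induction hx using Submodule.span_induction with
    | mem x h =>
      obtain ⟨p, q, rfl⟩ := h
      exact comp_mem_traceIdeal f (p ∘ₗ a) q
    | zero => rw [zero_mul]; exact zero_mem _
    | add x y _ _ hx hy => rw [add_mul]; exact add_mem hx hy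
    | smul b x _ hx => rw [smul_eq_mul, mul_assoc]; exact Ideal.mul_mem_left _ b hx

theorem InAdd.eq_zero_of_traceIdeal_eq_bot (hX : InAdd R M X) {f : Module.End R X}
    (h : traceIdeal M f = ⊥) : f = 0 :=
  hX.eq_zero_of_comp_eq_zero fun q => hX.eq_zero_of_eq_zero_comp fun p =>
    (Submodule.mem_bot _).1 (h ▸ comp_mem_traceIdeal f p q)

variable [Module.Finite R M]

theorem InAdd.traceIdeal_comp_le (hX : InAdd R M X) (f g : Module.End R X) :
    traceIdeal M (f ∘ₗ g) ≤ traceIdeal M f * traceIdeal M g := by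
  refine Ideal.span_le.2 ?_
  rintro _ ⟨p, q, rfl⟩
  -- `g ∘ p` has finitely generated image, so a map through a power of `M` fits in after it.
  obtain ⟨ψ, hψ, hψp⟩ := hX.exists_finMaps_comp_eq (g ∘ₗ p)
  obtain ⟨k, a, b, rfl⟩ := exists_sum_of_mem_finMaps hψ
  have hsum : (q ∘ₗ (f ∘ₗ g) ∘ₗ p : Module.End R M) =
      ∑ j, (q ∘ₗ f ∘ₗ a j : Module.End R M) * (b j ∘ₗ g ∘ₗ p : Module.End R M) := by
    conv_lhs => rw [LinearMap.comp_assoc, ← hψp]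
    ext x
    simp
  rw [hsum]
  exact Submodule.sum_mem _ fun j _ =>
    Ideal.mul_mem_mul (comp_mem_traceIdeal _ _ _) (comp_mem_traceIdeal _ _ _)

theorem InAdd.traceIdeal_le_pow (hX : InAdd R M X) {f g : Module.End R X} (h : f ∘ₗ g = f)
    (k : ℕ) : traceIdeal M f ≤ traceIdeal M g ^ k := by
  induction k with
  | zero => rw [Submodule.pow_zero, Ideal.one_eq_top]; exact le_top
  | succ k ih =>
    calc traceIdeal M f = traceIdeal M (f ∘ₗ g) := by rw [h]
      _ ≤ traceIdeal M f * traceIdeal M g := hX.traceIdeal_comp_le f g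
      _ ≤ traceIdeal M g ^ k * traceIdeal M g := Ideal.mul_mono_left ih
      _ = traceIdeal M g ^ (k + 1) := by rw [Submodule.pow_succ]

end TraceIdeal

section Supports

open MultSpace

variable {R : Type u} [CommRing R] {M : Type v} [AddCommGroup M] [Module R M]
variable {s : ℕ} {n : Fin s → ℕ} [∀ i, NeZero (n i)] {D : Fin s → Type w}
  [∀ i, DivisionRing (D i)]
variable (e : Module.End R M ⧸ Ring.jacobson (Module.End R M) ≃+*
  ∀ i, Matrix (Fin (n i)) (Fin (n i)) (D i))
variable {X : Type v} [AddCommGroup X] [Module R X]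

theorem mem_idealSupport_traceIdeal [Module.Finite R M] (hX : InAdd R M X) {i : Fin s}
    (f : Module.End R X) : i ∈ idealSupport e (traceIdeal M f) ↔ map e i f ≠ 0 := by
  rw [← not_iff_not, not_not, notMem_idealSupport]
  refine ⟨fun h => map_eq_zero_of_matrixOf e hX fun p q => h _ (comp_mem_traceIdeal f p q),
    fun h x hx => ?_⟩
  induction hx using Submodule.span_induction with
  | mem x hx =>
    obtain ⟨p, q, rfl⟩ := hx
    exact matrixOf_eq_zero_of_map e h p q
  | zero => exact map_zero _
  | add x y _ _ hx hy => rw [map_add, hx, hy, add_zero]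
  | smul a x _ hx => rw [smul_eq_mul, map_mul, hx, mul_zero]

theorem exists_fg_map_eq_id_of_eqOn [Module.Finite R M] {i : Fin s} (h : dimHom e X i ≠ ⊤) :
    ∃ N : Submodule R X, N.FG ∧
      ∀ φ : Module.End R X, (∀ x ∈ N, φ x = x) → map e i φ = LinearMap.id := by
  obtain ⟨t, ht⟩ := ((dimHom_ne_top_iff e i).1 h).fg_top
  choose p hp using exists_eq_map_gen (e := e) (i := i) (X := X)
  refine ⟨⨆ w ∈ t, LinearMap.range (p w), Submodule.fg_biSup _ _ fun w _ => ?_,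
    fun φ hφ => LinearMap.ext_on ht fun w hw => ?_⟩
  · rw [LinearMap.range_eq_map]
    exact Module.Finite.fg_top.map _
  · have hpw : φ ∘ₗ p w = p w := LinearMap.ext fun m =>
      hφ _ (Submodule.mem_iSup_of_mem w (Submodule.mem_iSup_of_mem hw ⟨m, rfl⟩))
    rw [LinearMap.id_apply, hp w, ← map_comp_apply, hpw]

theorem exists_finMaps_map_eq_id [Module.Finite R M] (hX : InAdd R M X) :
    ∃ φ ∈ finMaps R M X X, ∀ i, dimHom e X i ≠ ⊤ → map e i φ = LinearMap.id := by
  choose N hN hmap using fun i : {i // dimHom e X i ≠ ⊤} => exists_fg_map_eq_id_of_eqOn e i.2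
  obtain ⟨φ, hφ, hfix⟩ := hX.exists_finMaps_eqOn (Submodule.fg_iSup _ hN)
  exact ⟨φ, hφ, fun i hi => hmap ⟨i, hi⟩ φ fun x hx => hfix x (Submodule.mem_iSup_of_mem _ hx)⟩

theorem idealSupport_traceIdeal_id_sub [Module.Finite R M] (hX : InAdd R M X)
    {φ : Module.End R X} (hφ : φ ∈ finMaps R M X X)
    (hmap : ∀ i, dimHom e X i ≠ ⊤ → map e i φ = LinearMap.id) :
    idealSupport e (traceIdeal M (LinearMap.id - φ)) = {i | dimHom e X i = ⊤} := by
  ext i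
  rw [mem_idealSupport_traceIdeal e hX, map_sub, map_id, Ne, sub_eq_zero, Set.mem_ofPred_eq]
  refine ⟨fun h => ?_, fun h hid => ?_⟩
  · by_contra hi
    exact h (hmap i hi).symm
  · exact (dimHom_ne_top_iff e i).2 (finite_multSpace_of_map_eq_id e hφ hid.symm) h

variable [IsNoetherian R M]

instance : IsNoetherianRing (Module.End R M) := isNoetherian_of_tower R inferInstance

variable [RestrictedMinimumCondition (Module.End R M)]

theorem inFinAdd_or_exists_isIdempotentElem (hX : InAdd R M X) :
    InFinAdd R M X ∨ ∃ I : Ideal (Module.End R M), I.IsTwoSided ∧ IsIdempotentElem I ∧ I ≠ ⊥ ∧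
      idealSupport e I = {i | dimHom e X i = ⊤} := by
  obtain ⟨φ, hφ, hmap⟩ := exists_finMaps_map_eq_id e hX
  obtain ⟨φ', hφ', hfix⟩ := hX.exists_finMaps_eqOn (range_fg_of_mem_finMaps hφ)
  obtain hbot | hbot := eq_or_ne (traceIdeal M (LinearMap.id - φ')) ⊥
  · left
    rwa [inFinAdd_iff_id_mem, sub_eq_zero.1 (hX.eq_zero_of_traceIdeal_eq_bot hbot)]
  right
  have hcomp : (LinearMap.id - φ') ∘ₗ (LinearMap.id - φ) = LinearMap.id - φ' := by
    ext x
    simp [hfix (φ x) ⟨x, rfl⟩]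
  have hle := hX.traceIdeal_le_pow hcomp
  have := RestrictedMinimumCondition.isArtinian_quotient _ hbot
  obtain ⟨k, hk⟩ := exists_isIdempotentElem_pow _ hle
  refine ⟨_, inferInstance, hk, fun h => hbot (le_bot_iff.1 (h ▸ hle (k + 1))), ?_⟩
  rw [← idealSupport_traceIdeal_id_sub e hX hφ hmap]
  exact (idealSupport_mono e (Ideal.pow_le_self k.succ_ne_zero)).antisymm
    (idealSupport_subset_idealSupport_pow e _ _)

theorem InAdd.inFinAdd_of_dimHom_ne_top (hX : InAdd R M X) (h : ∀ i, dimHom e X i ≠ ⊤) :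
    InFinAdd R M X := by
  refine (inFinAdd_or_exists_isIdempotentElem e hX).resolve_right ?_
  rintro ⟨I, _, hI, hI0, hsupp⟩
  refine hI0 (le_bot_iff.1 (le_of_le_sup_jacobson_of_isIdempotentElem hI
    (le_sup_jacobson_of_idealSupport_subset e fun i hi => ?_)))
  rw [hsupp] at hi
  exact (h i hi).elim

end Supports

/-! ## Countably generated modules and telescopes -/

section CountablyGenerated

variable {R : Type*} [CommRing R] {X Y : Type*} [AddCommGroup X] [Module R X] [AddCommGroup Y]
  [Module R Y]

theorem IsCountablyGenerated.of_surjective (h : IsCountablyGenerated R X) (f : X →ₗ[R] Y)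
    (hf : Function.Surjective f) : IsCountablyGenerated R Y := by
  obtain ⟨c, hc, hs⟩ := h
  refine ⟨f '' c, hc.image f, ?_⟩
  rw [Submodule.span_image, hs, Submodule.map_top, LinearMap.range_eq_top.2 hf]

theorem isCountablyGenerated_of_finite [Module.Finite R X] : IsCountablyGenerated R X := by
  obtain ⟨t, ht⟩ := Module.Finite.fg_top (R := R) (M := X)
  exact ⟨t, t.countable_toSet, ht⟩

theorem isCountablyGenerated_of_iUnion {ι : Type*} [Countable ι] {F : ι → Type*}
    [∀ k, AddCommGroup (F k)] [∀ k, Module R (F k)] (hF : ∀ k, IsCountablyGenerated R (F k))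
    (u : ∀ k, F k →ₗ[R] X) (h : ⨆ k, LinearMap.range (u k) = ⊤) :
    IsCountablyGenerated R X := by
  choose c hc hs using hF
  refine ⟨⋃ k, u k '' c k, Set.countable_iUnion fun k => (hc k).image _, ?_⟩
  rw [Submodule.span_iUnion, ← h]
  congr 1
  ext1 k
  rw [Submodule.span_image, hs, Submodule.map_top]

theorem IsCountablyGenerated.prod (hX : IsCountablyGenerated R X)
    (hY : IsCountablyGenerated R Y) : IsCountablyGenerated R (X × Y) := by
  obtain ⟨c, hc, hs⟩ := hX
  obtain ⟨d, hd, ht⟩ := hY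
  refine ⟨LinearMap.inl R X Y '' c ∪ LinearMap.inr R X Y '' d,
    (hc.image _).union (hd.image _), ?_⟩
  rw [Submodule.span_union, Submodule.span_image, Submodule.span_image, hs, ht,
    Submodule.map_top, Submodule.map_top, LinearMap.sup_range_inl_inr]

theorem IsCountablyGenerated.finsupp (hX : IsCountablyGenerated R X) {ι : Type*} [Countable ι] :
    IsCountablyGenerated R (ι →₀ X) := by
  refine isCountablyGenerated_of_iUnion (fun _ : ι => hX) (fun k => Finsupp.lsingle k) ?_
  exact Finsupp.iSup_lsingle_range

end CountablyGenerated

section Telescope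

theorem pow_mul_pow_add_of_mul_mul_eq {T : Type*} [Monoid T] {x a : T} (h : x * a * a = a)
    (k l : ℕ) : x ^ k * a ^ (l + 1 + k) = a ^ (l + 1) := by
  induction k with
  | zero => rw [pow_zero, one_mul, add_zero]
  | succ k ih =>
    rw [pow_succ, mul_assoc]
    have hstep : x * a ^ (l + 1 + (k + 1)) = a ^ (l + 1 + k) := by
      rw [show l + 1 + (k + 1) = l + k + 1 + 1 by ring, show l + 1 + k = l + k + 1 by ring,
        pow_succ' a (l + k + 1), pow_succ' a (l + k), ← mul_assoc, ← mul_assoc, h]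
    rw [hstep, ih]

variable {R : Type u} [CommRing R] {F : Type v} [AddCommGroup F] [Module R F]
  (A : Module.End R F)

/-- The colimit of the sequence `F → F → F → ⋯` with all maps equal to `A`. -/
abbrev Telescope : Type v :=
  Module.DirectLimit (R := R) (ι := ℕ) (fun _ => F) (fun i j _ => A ^ (j - i))

namespace Telescope

/-- The canonical map from the `k`-th term. -/
def of (k : ℕ) : F →ₗ[R] Telescope A :=
  Module.DirectLimit.of R ℕ (fun _ => F) (fun i j _ => A ^ (j - i)) k

theorem of_comp_pow (k l : ℕ) : of A (k + l) ∘ₗ A ^ l = of A k := by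
  ext x
  have := Module.DirectLimit.of_f (R := R) (ι := ℕ) (G := fun _ => F)
    (f := fun i j _ => A ^ (j - i)) (hij := Nat.le_add_right k l) (x := x)
  rw [Nat.add_sub_cancel_left] at this
  exact this

theorem of_succ_comp (k : ℕ) : of A (k + 1) ∘ₗ A = of A k := by
  have := of_comp_pow A k 1
  rwa [pow_one] at this

theorem range_of_le {k l : ℕ} (h : k ≤ l) :
    LinearMap.range (of A k) ≤ LinearMap.range (of A l) := by
  obtain ⟨d, rfl⟩ := Nat.exists_eq_add_of_le h
  rw [← of_comp_pow A k d]
  exact LinearMap.range_comp_le_range _ _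

theorem exists_of (z : Telescope A) : ∃ k x, of A k x = z := Module.DirectLimit.exists_of z

variable {A} {B : Module.End R F} (hB : B * A * A = A)

/-- The partial inverses of the canonical maps. -/
def inv (k : ℕ) : Telescope A →ₗ[R] F :=
  Module.DirectLimit.lift R ℕ _ _ (fun l => B ^ l * A ^ (k + 1)) (by
    intro i j hij x
    rw [← Module.End.mul_apply, mul_assoc, ← pow_add]
    obtain ⟨d, rfl⟩ := Nat.exists_eq_add_of_le hij
    rw [Nat.add_sub_cancel_left, pow_add, mul_assoc, pow_mul_pow_add_of_mul_mul_eq hB])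

theorem inv_of (k l : ℕ) (x : F) : inv hB k (of A l x) = (B ^ l * A ^ (k + 1)) x :=
  Module.DirectLimit.lift_of _ _ _

theorem inv_comp_of_self (k : ℕ) : inv hB k ∘ₗ of A k = A := by
  ext x
  rw [LinearMap.comp_apply, inv_of, add_comm k 1]
  have := pow_mul_pow_add_of_mul_mul_eq hB k 0
  rw [zero_add, pow_one] at this
  rw [this]

/-- The endomorphism of the telescope that is the identity on the image of the `k`-th term. -/
def proj (k : ℕ) : Module.End R (Telescope A) := of A (k + 1) ∘ₗ inv hB k

theorem proj_of {k l : ℕ} (h : k ≤ l) (x : F) : proj hB l (of A k x) = of A k x := by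
  obtain ⟨d, rfl⟩ := Nat.exists_eq_add_of_le h
  rw [proj, LinearMap.comp_apply, inv_of]
  have := pow_mul_pow_add_of_mul_mul_eq hB k d
  rw [show k + d + 1 = d + 1 + k by ring, this, show d + 1 + k = k + (d + 1) by ring,
    ← LinearMap.comp_apply, of_comp_pow]

/-- The part of the telescope left after subtracting the first projections. -/
def rem : ℕ → Module.End R (Telescope A)
  | 0 => 1
  | k + 1 => (1 - proj hB k) * rem k

theorem rem_of_mem (k : ℕ) (x : F) {l : ℕ} (hl : l ≤ k) :
    rem hB l (of A k x) ∈ LinearMap.range (of A k) := by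
  induction l with
  | zero => exact ⟨x, rfl⟩
  | succ l ih =>
    have := ih (by omega)
    rw [rem, Module.End.mul_apply, LinearMap.sub_apply, Module.End.one_apply]
    exact sub_mem this (range_of_le A hl ⟨_, rfl⟩)

theorem rem_of_eq_zero (k : ℕ) (x : F) {l : ℕ} (hl : k < l) : rem hB l (of A k x) = 0 := by
  induction l, hl using Nat.le_induction with
  | base =>
    obtain ⟨y, hy⟩ := rem_of_mem hB k x le_rfl
    rw [rem, Module.End.mul_apply, ← hy, LinearMap.sub_apply, proj_of hB le_rfl,
      Module.End.one_apply, sub_self]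
  | succ l _ ih => rw [rem, Module.End.mul_apply, ih, map_zero]

theorem exists_rem_eq_zero (z : Telescope A) : ∃ k, ∀ l, k ≤ l → rem hB l z = 0 := by
  obtain ⟨k, x, rfl⟩ := exists_of A z
  exact ⟨k + 1, fun l hl => rem_of_eq_zero hB k x hl⟩

/-- The embedding of the telescope into a countable direct sum. -/
def embed : Telescope A →ₗ[R] (ℕ →₀ F) where
  toFun z := Finsupp.ofSupportFinite (fun k => inv hB k (rem hB k z)) (by
    obtain ⟨k, hk⟩ := exists_rem_eq_zero hB z
    refine (Set.finite_lt_nat k).subset fun l hl => ?_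
    by_contra h
    exact hl (by simp only [hk l (not_lt.1 h), map_zero]))
  map_add' z z' := by
    ext k
    simp [Finsupp.ofSupportFinite_coe]
  map_smul' r z := by
    ext k
    simp [Finsupp.ofSupportFinite_coe]

theorem embed_apply (z : Telescope A) (k : ℕ) : embed hB z k = inv hB k (rem hB k z) := rfl

theorem lsum_comp_embed :
    (Finsupp.lsum R fun k => of A (k + 1)) ∘ₗ embed hB = LinearMap.id := by
  refine LinearMap.ext fun z => ?_
  obtain ⟨k, hk⟩ := exists_rem_eq_zero hB z
  rw [LinearMap.comp_apply, Finsupp.lsum_apply, Finsupp.sum_of_support_subset (s := Finset.range k)]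
  · have h1 : ∀ l, of A (l + 1) (embed hB z l) = rem hB l z - rem hB (l + 1) z := by
      intro l
      rw [embed_apply, rem, Module.End.mul_apply, LinearMap.sub_apply, Module.End.one_apply,
        sub_sub_cancel]
      rfl
    rw [Finset.sum_congr rfl fun l _ => h1 l, Finset.sum_range_sub', hk k le_rfl, sub_zero]
    rfl
  · intro l hl
    rw [Finset.mem_range]
    by_contra h
    refine (Finsupp.mem_support_iff.1 hl) ?_
    rw [embed_apply, hk l (not_lt.1 h), map_zero]
  · simp

include hB in
theorem inAdd {M : Type v} [AddCommGroup M] [Module R M] (hF : InAdd R M F) :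
    InAdd R M (Telescope A) :=
  InAdd.of_retract hF.finsupp_nat (lsum_comp_embed hB)

theorem isCountablyGenerated (hF : IsCountablyGenerated R F) :
    IsCountablyGenerated R (Telescope A) := by
  refine isCountablyGenerated_of_iUnion (fun _ : ℕ => hF) (of A) ?_
  rw [eq_top_iff]
  intro z _
  obtain ⟨k, x, rfl⟩ := exists_of A z
  exact Submodule.mem_iSup_of_mem k ⟨x, rfl⟩

theorem exists_eq_of_comp {M : Type*} [AddCommGroup M] [Module R M] [Module.Finite R M]
    (p : M →ₗ[R] Telescope A) : ∃ k, p = of A (k + 1) ∘ₗ (inv hB k ∘ₗ p) := by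
  obtain ⟨t, ht⟩ := Module.Finite.fg_top (R := R) (M := M)
  choose k x hx using fun m => exists_of A (p m)
  refine ⟨t.sup k, LinearMap.ext_on (s := t) ht fun m hm => ?_⟩
  have := proj_of hB (Finset.le_sup (f := k) hm) (x m)
  rw [hx] at this
  exact this.symm

variable {M : Type v} [AddCommGroup M] [Module R M]
  {s : ℕ} {n : Fin s → ℕ} {D : Fin s → Type w} [∀ i, DivisionRing (D i)]
  (e : Module.End R M ⧸ Ring.jacobson (Module.End R M) ≃+*
    ∀ i, Matrix (Fin (n i)) (Fin (n i)) (D i))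

open MultSpace

include hB in
theorem dimHom_ne_zero_of_map_ne_zero {i : Fin s} (h : map e i A ≠ 0) :
    dimHom e (Telescope A) i ≠ 0 := by
  rw [Ne, dimHom_eq_zero_iff]
  intro h0
  refine h (LinearMap.ext fun w => ?_)
  rw [← inv_comp_of_self hB 0, map_comp_apply, h0 (map e i (of A 0) w), _root_.map_zero,
    LinearMap.zero_apply]

theorem map_of_comp_map {i : Fin s} (hA : map e i A ∘ₗ map e i A = map e i A) (k : ℕ) :
    map e i (of A k) ∘ₗ map e i A = map e i (of A k) := by
  rw [← of_succ_comp A k, map_comp, LinearMap.comp_assoc, hA]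

theorem map_of_eq_map_of_zero {i : Fin s} (hA : map e i A ∘ₗ map e i A = map e i A) (k : ℕ) :
    map e i (of A k) = map e i (of A 0) := by
  induction k with
  | zero => rfl
  | succ k ih => rw [← ih, ← of_succ_comp A k, map_comp, map_of_comp_map e hA]

variable [Module.Finite R M] [∀ i, NeZero (n i)]

include hB in
theorem map_of_zero_surjective {i : Fin s} (hA : map e i A ∘ₗ map e i A = map e i A) :
    Function.Surjective (map e i (of A 0)) := by
  intro w
  obtain ⟨p, rfl⟩ := exists_eq_map_gen w
  obtain ⟨k, hk⟩ := exists_eq_of_comp hB p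
  refine ⟨map e i (inv hB k ∘ₗ p) (gen e i), ?_⟩
  rw [← map_of_eq_map_of_zero e hA (k + 1), ← map_comp_apply, ← hk]

include hB in
theorem dimHom_eq_rank_of_map_eq_comp {i : Fin s} {V : Type*} [AddCommGroup V]
    [Module (D i)ᵐᵒᵖ V] (α : V →ₗ[(D i)ᵐᵒᵖ] MultSpace e i F)
    (β : MultSpace e i F →ₗ[(D i)ᵐᵒᵖ] V) (hβα : β ∘ₗ α = LinearMap.id)
    (hA : map e i A = α ∘ₗ β) :
    dimHom e (Telescope A) i = Cardinal.toENat (Module.rank (D i)ᵐᵒᵖ V) := by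
  have hidem : map e i A ∘ₗ map e i A = map e i A := by
    rw [hA, LinearMap.comp_assoc, ← LinearMap.comp_assoc β, hβα, LinearMap.id_comp]
  have hinv : map e i (inv hB 0) ∘ₗ map e i (of A 0) = α ∘ₗ β := by
    rw [← map_comp, inv_comp_of_self, hA]
  have hof : (map e i (of A 0) ∘ₗ α) ∘ₗ β = map e i (of A 0) := by
    rw [LinearMap.comp_assoc, ← hA, map_of_comp_map e hidem]
  have E : MultSpace e i (Telescope A) ≃ₗ[(D i)ᵐᵒᵖ] V :=
    LinearEquiv.ofLinearMap (β ∘ₗ map e i (inv hB 0)) (map e i (of A 0) ∘ₗ α)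
      (by rw [LinearMap.comp_assoc, ← LinearMap.comp_assoc _ _ (map e i (inv hB 0)), hinv,
        LinearMap.comp_assoc, hβα, LinearMap.comp_id, hβα])
      (by rw [← LinearMap.cancel_right (map_of_zero_surjective hB e hidem), LinearMap.comp_assoc,
        LinearMap.comp_assoc _ _ β, hinv, ← LinearMap.comp_assoc β α β, hβα, LinearMap.id_comp,
        hof, LinearMap.id_comp])
  rw [dimHom_apply, ← Cardinal.toENat_lift, E.lift_rank_eq, Cardinal.toENat_lift]

end Telescope

end Telescope

/-! ## Realizing idempotent ideals -/

section HomIdeal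

variable {R : Type u} [CommRing R] {M : Type v} [AddCommGroup M] [Module R M]
variable {X : Type v} [AddCommGroup X] [Module R X]

variable (X) in
/-- The submodule `Hom_R(M, X) I` of `Hom_R(M, X)`. -/
def homMul (I : Ideal (Module.End R M)) : Submodule R (M →ₗ[R] X) :=
  Submodule.span R {p | ∃ (q : M →ₗ[R] X), ∃ x ∈ I, p = q ∘ₗ x}

theorem comp_mem_homMul {I : Ideal (Module.End R M)} (q : M →ₗ[R] X) {x : Module.End R M}
    (hx : x ∈ I) : q ∘ₗ x ∈ homMul X I := Submodule.subset_span ⟨q, x, hx, rfl⟩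

theorem homMul_mono {I K : Ideal (Module.End R M)} (h : I ≤ K) : homMul X I ≤ homMul X K :=
  Submodule.span_mono fun _ ⟨q, x, hx, hp⟩ => ⟨q, x, h hx, hp⟩

theorem comp_mem_homMul_mul {I K : Ideal (Module.End R M)} {p : M →ₗ[R] X}
    (hp : p ∈ homMul X K) {x : Module.End R M} (hx : x ∈ I) : p ∘ₗ x ∈ homMul X (K * I) := by
  induction hp using Submodule.span_induction with
  | mem p h =>
    obtain ⟨q, y, hy, rfl⟩ := h
    exact comp_mem_homMul q (Ideal.mul_mem_mul hy hx)
  | zero => exact zero_mem _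
  | add a b _ _ ha hb => exact add_mem ha hb
  | smul r a _ ha => exact Submodule.smul_mem _ r ha

theorem exists_eq_sum_comp_of_mem_homMul {κ : Type*} [Fintype κ] {a : κ → Module.End R M}
    {p : M →ₗ[R] X} (hp : p ∈ homMul X (Ideal.span (Set.range a))) :
    ∃ y : κ → M →ₗ[R] X, p = ∑ j, y j ∘ₗ a j := by
  induction hp using Submodule.span_induction with
  | mem p h =>
    obtain ⟨q, x, hx, rfl⟩ := h
    obtain ⟨c, rfl⟩ := (Submodule.mem_span_range_iff_exists_fun (Module.End R M)).1 hx
    exact ⟨fun j => q ∘ₗ c j, by ext; simp⟩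
  | zero => exact ⟨0, by simp⟩
  | add p q _ _ hp hq =>
    obtain ⟨y, rfl⟩ := hp
    obtain ⟨z, rfl⟩ := hq
    exact ⟨y + z, by simp [LinearMap.add_comp, Finset.sum_add_distrib]⟩
  | smul r p _ hp =>
    obtain ⟨y, rfl⟩ := hp
    exact ⟨r • y, by simp [LinearMap.smul_comp, Finset.smul_sum]⟩

variable (X) in
/-- The ideal of the endomorphisms of `X` that carry `Hom_R(M, X)` into `Hom_R(M, X) I`. -/
def homIdeal (I : Ideal (Module.End R M)) : Ideal (Module.End R X) where
  carrier := {C | ∀ p : M →ₗ[R] X, C ∘ₗ p ∈ homMul X I}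
  zero_mem' _ := zero_mem _
  add_mem' hC hD p := add_mem (hC p) (hD p)
  smul_mem' C D hD p := by
    have hle : homMul X I ≤ (homMul X I).comap (LinearMap.compRight R C) := by
      refine Submodule.span_le.2 ?_
      rintro _ ⟨q, x, hx, rfl⟩
      exact comp_mem_homMul (C ∘ₗ q) hx
    exact hle (hD p)

instance (I : Ideal (Module.End R M)) : (homIdeal X I).IsTwoSided where
  mul_mem_of_left D hC p := hC (D ∘ₗ p)

theorem homIdeal_mono {I K : Ideal (Module.End R M)} (h : I ≤ K) :
    homIdeal X I ≤ homIdeal X K :=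
  fun _ hC p => homMul_mono h (hC p)

theorem mul_mem_homIdeal_mul {I K : Ideal (Module.End R M)} {C D : Module.End R X}
    (hC : C ∈ homIdeal X K) (hD : D ∈ homIdeal X I) : C * D ∈ homIdeal X (K * I) := by
  intro p
  have hle : homMul X I ≤ (homMul X (K * I)).comap (LinearMap.compRight R C) := by
    refine Submodule.span_le.2 ?_
    rintro _ ⟨q, x, hx, rfl⟩
    exact comp_mem_homMul_mul (hC q) hx
  exact hle (hD p)

theorem pow_mem_homIdeal_pow {I : Ideal (Module.End R M)} {C : Module.End R X}
    (hC : C ∈ homIdeal X I) (k : ℕ) : C ^ k ∈ homIdeal X (I ^ k) := by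
  induction k with
  | zero =>
    intro p
    rw [Submodule.pow_zero, Ideal.one_eq_top]
    exact comp_mem_homMul (I := ⊤) p (x := 1) Submodule.mem_top
  | succ k ih =>
    rw [pow_succ, Submodule.pow_succ]
    exact mul_mem_homIdeal_mul ih hC

/-- The diagonal action of `End_R(M)` on a direct sum of copies of `M`. -/
def diag (ι : Type*) : Module.End R M →+* Module.End R (ι →₀ M) where
  toFun a := Finsupp.mapRange.linearMap a
  map_one' := Finsupp.mapRange.linearMap_id
  map_mul' a b := Finsupp.mapRange.linearMap_comp a b
  map_zero' := by ext; simp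
  map_add' a b := by ext; simp

theorem diag_single {ι : Type*} (a : Module.End R M) (k : ι) (x : M) :
    diag ι a (Finsupp.single k x) = Finsupp.single k (a x) :=
  Finsupp.mapRange_single (hf := map_zero a)

theorem lapply_comp_diag_comp_lsingle {ι : Type*} (a : Module.End R M) (k : ι) :
    Finsupp.lapply k ∘ₗ diag ι a ∘ₗ Finsupp.lsingle k = a := by
  ext x
  simp [diag_single]

theorem exists_eq_sum_mul_diag {ι : Type} {κ : Type*} [Fintype κ] {a : κ → Module.End R M}
    {C : Module.End R (ι →₀ M)} (hC : C ∈ homIdeal (ι →₀ M) (Ideal.span (Set.range a))) :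
    ∃ y : κ → Module.End R (ι →₀ M), C = ∑ j, y j * diag ι (a j) := by
  choose y hy using fun k => exists_eq_sum_comp_of_mem_homMul (hC (Finsupp.lsingle k))
  refine ⟨fun j => Finsupp.lsum R fun k => y k j, ?_⟩
  ext k : 1
  rw [hy]
  ext x : 1
  simp [LinearMap.sum_apply, diag_single]

theorem diag_mem_homIdeal [Module.Finite R M] {ι : Type} {I : Ideal (Module.End R M)}
    [I.IsTwoSided] {a : Module.End R M} (ha : a ∈ I) : diag ι a ∈ homIdeal (ι →₀ M) I := by
  intro p
  obtain ⟨t, ht⟩ := exists_eq_sum_lsingle_comp p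
  have hsum : diag ι a ∘ₗ p = ∑ k ∈ t, Finsupp.lsingle k ∘ₗ (a * (Finsupp.lapply k ∘ₗ p)) := by
    conv_lhs => rw [ht]
    ext x : 1
    simp [diag_single]
  rw [hsum]
  exact Submodule.sum_mem _ fun k _ => comp_mem_homMul _ (I.mul_mem_right _ ha)

end HomIdeal

section IdempotentLifting

open MultSpace

variable {R : Type u} [CommRing R] {M : Type v} [AddCommGroup M] [Module R M]
variable {X : Type v} [AddCommGroup X] [Module R X]
variable {s : ℕ} {n : Fin s → ℕ} [∀ i, NeZero (n i)] {D : Fin s → Type w}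
  [∀ i, DivisionRing (D i)]
variable (e : Module.End R M ⧸ Ring.jacobson (Module.End R M) ≃+*
  ∀ i, Matrix (Fin (n i)) (Fin (n i)) (D i))

theorem map_eq_zero_of_mem_homIdeal {I : Ideal (Module.End R M)} {i : Fin s}
    (hi : i ∉ idealSupport e I) {C : Module.End R X} (hC : C ∈ homIdeal X I) :
    map e i C = 0 := by
  refine map_eq_zero_of_map_comp_eq_zero e fun p => ?_
  have hzero : ∀ r ∈ homMul X I, map e i r = 0 := by
    intro r hr
    induction hr using Submodule.span_induction with
    | mem r h =>
      obtain ⟨q, x, hx, rfl⟩ := h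
      rw [map_comp, MultSpace.map_eq_zero_iff.2 ((notMem_idealSupport e).1 hi x hx),
        LinearMap.comp_zero]
    | zero => exact map_zero _
    | add a b _ _ ha hb => rw [map_add, ha, hb, add_zero]
    | smul r a _ ha =>
      rw [← LinearMap.id_comp a, ← LinearMap.smul_comp, map_comp, ha, LinearMap.comp_zero]
  exact hzero _ (hC p)

theorem mem_homIdeal_jacobson [Module.Finite R M] (hX : InAdd R M X) {C : Module.End R X}
    (hC : ∀ i, map e i C = 0) : C ∈ homIdeal X (Ring.jacobson (Module.End R M)) := by
  intro p
  obtain ⟨ψ, hψ, hψp⟩ := hX.exists_finMaps_comp_eq (C ∘ₗ p)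
  obtain ⟨k, g, f, rfl⟩ := exists_sum_of_mem_finMaps hψ
  have hsum : (∑ j, g j ∘ₗ f j) ∘ₗ C ∘ₗ p = ∑ j, g j ∘ₗ (f j ∘ₗ C ∘ₗ p) := by
    ext x
    simp
  rw [← hψp, hsum]
  exact Submodule.sum_mem _ fun j _ => comp_mem_homMul _
    ((SimpleRow.mem_jacobson_iff e).2 fun i => matrixOf_eq_zero_of_map e (hC i) p (f j))

omit [∀ i, NeZero (n i)] in
theorem notMem_idealSupport_jacobson_pow_succ (i : Fin s) (k : ℕ) :
    i ∉ idealSupport e (Ring.jacobson (Module.End R M) ^ (k + 1)) :=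
  (notMem_idealSupport e).2 fun _ hx =>
    (SimpleRow.mem_jacobson_iff e).1 (Ideal.pow_le_self k.succ_ne_zero hx) i

/-- The action of `End_R(X)` on the product of the multiplicity spaces of `X`. -/
def mapRingHom (X : Type v) [AddCommGroup X] [Module R X] :
    Module.End R X →+* ∀ i, Module.End (D i)ᵐᵒᵖ (MultSpace e i X) :=
  RingHom.pi fun i =>
    { map e i with
      map_one' := map_id e i
      map_mul' := map_comp e i }

theorem exists_map_eq_of_isIdempotentElem [Module.Finite R M] (hX : InAdd R M X)
    {ε : ∀ i, Module.End (D i)ᵐᵒᵖ (MultSpace e i X)} (hε : ∀ i, IsIdempotentElem (ε i)) (k : ℕ) :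
    ∃ E : Module.End R X, E - E * E ∈ homIdeal X (Ring.jacobson (Module.End R M) ^ k) ∧
      ∀ i, map e i E = ε i := by
  let K := homIdeal X (Ring.jacobson (Module.End R M) ^ (k + 1))
  let f : Module.End R X ⧸ K →+* ∀ i, Module.End (D i)ᵐᵒᵖ (MultSpace e i X) :=
    Ideal.Quotient.lift K (mapRingHom e X) fun C hC => funext fun i =>
      map_eq_zero_of_mem_homIdeal e (notMem_idealSupport_jacobson_pow_succ e i k) hC
  have hker : ∀ x ∈ RingHom.ker f, IsNilpotent x := by
    intro x hx
    obtain ⟨C, rfl⟩ := Ideal.Quotient.mk_surjective x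
    have hC : C ∈ homIdeal X (Ring.jacobson (Module.End R M)) :=
      mem_homIdeal_jacobson e hX fun i => congrFun (RingHom.mem_ker.1 hx) i
    refine ⟨k + 1, ?_⟩
    rw [← _root_.map_pow, Ideal.Quotient.eq_zero_iff_mem]
    exact pow_mem_homIdeal_pow hC (k + 1)
  obtain ⟨E₀, hE₀⟩ := exists_map_eq e hX ε
  obtain ⟨x, hx, hfx⟩ := exists_isIdempotentElem_eq_of_ker_isNilpotent f hker ε
    ⟨Ideal.Quotient.mk K E₀, funext hE₀⟩ (funext hε)
  obtain ⟨E, rfl⟩ := Ideal.Quotient.mk_surjective x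
  refine ⟨E, ?_, fun i => congrFun hfx i⟩
  refine homIdeal_mono (Ideal.pow_le_pow_right k.le_succ) (Ideal.Quotient.eq_zero_iff_mem.1 ?_)
  rw [_root_.map_sub, _root_.map_mul, hx.eq, sub_self]

end IdempotentLifting

section TransitionMap

open MultSpace

section IndexMaps

variable (R : Type*) [CommRing R] (M : Type*) [AddCommGroup M] [Module R M]

/-- The `j`-th embedding of `M^(ℕ)` into itself along a partition of `ℕ` into copies of `ℕ`. -/
def indexIncl (j : ℕ) : Module.End R (ℕ →₀ M) := Finsupp.lmapDomain M R (Nat.pair j)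

/-- The retraction of `indexIncl`. -/
def indexProj (j : ℕ) : Module.End R (ℕ →₀ M) :=
  Finsupp.lsum R fun k =>
    if (Nat.unpair k).1 = j then Finsupp.lsingle (Nat.unpair k).2 else 0

theorem indexProj_mul_indexIncl_self (j : ℕ) : indexProj R M j * indexIncl R M j = 1 := by
  ext l x : 2
  simp [indexProj, indexIncl]

theorem indexProj_mul_indexIncl_of_ne {j k : ℕ} (h : k ≠ j) :
    indexProj R M j * indexIncl R M k = 0 := by
  ext l x : 2
  simp [indexProj, indexIncl, h]

end IndexMaps

variable {R : Type u} [CommRing R] {M : Type v} [AddCommGroup M] [Module R M]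

theorem diag_mul_indexProj (a : Module.End R M) (j : ℕ) :
    diag ℕ a * indexProj R M j = indexProj R M j * diag ℕ a := by
  ext l x : 2
  by_cases h : (Nat.unpair l).1 = j <;> simp [indexProj, diag_single, h]

theorem mul_span_range_le {S κ : Type*} [Ring S] [Finite κ] (a : κ → S)
    [(Ideal.span (Set.range a)).IsTwoSided] :
    Ideal.span (Set.range a) * Ideal.span (Set.range a) ≤
      Ideal.span (Set.range fun j : κ × κ => a j.1 * a j.2) := by
  cases nonempty_fintype κ
  refine Ideal.mul_le.2 fun x hx y hy => ?_
  obtain ⟨c, rfl⟩ := (Submodule.mem_span_range_iff_exists_fun S).1 hy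
  rw [Finset.mul_sum]
  refine Submodule.sum_mem _ fun j _ => ?_
  obtain ⟨d, hd⟩ := (Submodule.mem_span_range_iff_exists_fun S).1
    ((Ideal.span (Set.range a)).mul_mem_right (c j) hx)
  rw [smul_eq_mul, ← mul_assoc, ← hd, Finset.sum_mul]
  refine Submodule.sum_mem _ fun k _ => ?_
  rw [smul_eq_mul, mul_assoc]
  exact Ideal.mul_mem_left _ _ (Ideal.subset_span ⟨(k, j), rfl⟩)

/-- The transition map of the telescope that realizes an ideal `I` of `End_R(M)` with generators
`a_1, …, a_m`. On the first of countably many copies of `M^(ℕ)` inside `M^(ℕ)` it acts as `E`, and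
the further copies receive the diagonal maps `a_j`. -/
def transitionMap {m : ℕ} (a : Fin m → Module.End R M) (E : Module.End R (ℕ →₀ M)) :
    Module.End R (ℕ →₀ M) :=
  indexIncl R M 0 * (E * indexProj R M 0) + ∑ j : Fin m, indexIncl R M (j + 1) * diag ℕ (a j)

variable {m : ℕ} (a : Fin m → Module.End R M) (E : Module.End R (ℕ →₀ M))

theorem indexProj_zero_mul_transitionMap :
    indexProj R M 0 * transitionMap a E = E * indexProj R M 0 := by
  rw [transitionMap, mul_add, ← mul_assoc, indexProj_mul_indexIncl_self, one_mul, Finset.mul_sum,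
    Finset.sum_eq_zero, add_zero]
  intro j _
  rw [← mul_assoc, indexProj_mul_indexIncl_of_ne R M j.val.succ_ne_zero, zero_mul]

theorem indexProj_succ_mul_transitionMap (j : Fin m) :
    indexProj R M (j + 1) * transitionMap a E = diag ℕ (a j) := by
  rw [transitionMap, mul_add, ← mul_assoc,
    indexProj_mul_indexIncl_of_ne R M j.val.succ_ne_zero.symm, zero_mul, zero_add,
    Finset.mul_sum, Finset.sum_eq_single j]
  · rw [← mul_assoc, indexProj_mul_indexIncl_self, one_mul]
  · intro k _ hk
    have hkj : (k : ℕ) + 1 ≠ j + 1 := fun h => hk (Fin.ext (Nat.succ_injective h))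
    rw [← mul_assoc, indexProj_mul_indexIncl_of_ne R M hkj, zero_mul]
  · simp

theorem homIdeal_le_span_transitionMap [(Ideal.span (Set.range a)).IsTwoSided]
    (hI : IsIdempotentElem (Ideal.span (Set.range a))) :
    homIdeal (ℕ →₀ M) (Ideal.span (Set.range a)) ≤
      Ideal.span {transitionMap a E * transitionMap a E} := by
  intro C hC
  obtain ⟨y, rfl⟩ := exists_eq_sum_mul_diag
    (homIdeal_mono (hI.symm.le.trans (mul_span_range_le a)) hC)
  refine Submodule.sum_mem _ fun j _ => ?_
  have hdiag : y j * diag ℕ (a j.1 * a j.2) =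
      (y j * (indexProj R M (j.2 + 1) * indexProj R M (j.1 + 1))) *
        (transitionMap a E * transitionMap a E) := by
    rw [map_mul, ← indexProj_succ_mul_transitionMap a E j.2, ← mul_assoc (diag ℕ (a j.1)),
      diag_mul_indexProj, ← indexProj_succ_mul_transitionMap a E j.1]
    simp only [mul_assoc]
  rw [hdiag]
  exact Ideal.mul_mem_left _ _ (Ideal.subset_span rfl)

variable {a E}

theorem exists_mul_transitionMap_mul_transitionMap_eq [Module.Finite R M]
    [(Ideal.span (Set.range a)).IsTwoSided] (hI : IsIdempotentElem (Ideal.span (Set.range a)))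
    (hE : E - E * E ∈ homIdeal (ℕ →₀ M) (Ideal.span (Set.range a))) :
    ∃ B, B * transitionMap a E * transitionMap a E = transitionMap a E := by
  set A := transitionMap a E with hA
  have hle : homIdeal (ℕ →₀ M) (Ideal.span (Set.range a)) ≤ Ideal.span {A * A} :=
    homIdeal_le_span_transitionMap a E hI
  have hEA : E * indexProj R M 0 ∈ Ideal.span {A * A} := by
    have heq : E * indexProj R M 0 =
        indexProj R M 0 * (A * A) + (E - E * E) * indexProj R M 0 := by
      rw [← mul_assoc, hA, indexProj_zero_mul_transitionMap, mul_assoc E,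
        indexProj_zero_mul_transitionMap, sub_mul, mul_assoc]
      abel
    rw [heq]
    exact add_mem (Ideal.mul_mem_left _ _ (Ideal.subset_span rfl))
      (hle (Ideal.mul_mem_right _ _ hE))
  have hAA : A ∈ Ideal.span {A * A} :=
    add_mem (Ideal.mul_mem_left _ _ hEA) (Submodule.sum_mem _ fun j _ =>
      Ideal.mul_mem_left _ _ (hle (diag_mem_homIdeal (Ideal.subset_span ⟨j, rfl⟩))))
  obtain ⟨B, hB⟩ := Ideal.mem_span_singleton'.1 hAA
  exact ⟨B, by rw [mul_assoc, hB]⟩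

variable {s : ℕ} {n : Fin s → ℕ} [∀ i, NeZero (n i)] {D : Fin s → Type w}
  [∀ i, DivisionRing (D i)]
variable (e : Module.End R M ⧸ Ring.jacobson (Module.End R M) ≃+*
  ∀ i, Matrix (Fin (n i)) (Fin (n i)) (D i))

theorem map_transitionMap_ne_zero {i : Fin s}
    (hi : i ∈ idealSupport e (Ideal.span (Set.range a))) : map e i (transitionMap a E) ≠ 0 := by
  intro h0
  refine (notMem_idealSupport e).2 (fun x hx => ?_) hi
  obtain ⟨c, rfl⟩ := (Submodule.mem_span_range_iff_exists_fun (Module.End R M)).1 hx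
  rw [_root_.map_sum]
  refine Finset.sum_eq_zero fun j _ => ?_
  have hj : map e i (a j) = 0 := by
    rw [← lapply_comp_diag_comp_lsingle (a j) (0 : ℕ), ← indexProj_succ_mul_transitionMap a E j,
      map_comp, map_comp, Module.End.mul_eq_comp, map_comp, h0, LinearMap.comp_zero,
      LinearMap.zero_comp, LinearMap.comp_zero]
  rw [smul_eq_mul, _root_.map_mul, MultSpace.map_eq_zero_iff.1 hj, mul_zero]

variable [Module.Finite R M]

theorem map_transitionMap_of_notMem [(Ideal.span (Set.range a)).IsTwoSided] {i : Fin s}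
    (hi : i ∉ idealSupport e (Ideal.span (Set.range a))) :
    map e i (transitionMap a E) =
      map e i (indexIncl R M 0) ∘ₗ map e i E ∘ₗ map e i (indexProj R M 0) := by
  rw [transitionMap, map_add, map_sum, Finset.sum_eq_zero, add_zero]
  · simp only [Module.End.mul_eq_comp, map_comp]
  · intro j _
    rw [Module.End.mul_eq_comp, map_comp, map_eq_zero_of_mem_homIdeal e hi
      (diag_mem_homIdeal (Ideal.subset_span ⟨j, rfl⟩)), LinearMap.comp_zero]

end TransitionMap

section RealizeIdeal

open MultSpace

variable {R : Type u} [CommRing R] {M : Type v} [AddCommGroup M] [Module R M] [Module.Finite R M]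
variable {s : ℕ} {n : Fin s → ℕ} [∀ i, NeZero (n i)] {D : Fin s → Type w}
  [∀ i, DivisionRing (D i)]
variable (e : Module.End R M ⧸ Ring.jacobson (Module.End R M) ≃+*
  ∀ i, Matrix (Fin (n i)) (Fin (n i)) (D i))

theorem exists_multSpace_finsupp_retract (c : ℕ) (i : Fin s) :
    ∃ (α : (Fin c → (D i)ᵐᵒᵖ) →ₗ[(D i)ᵐᵒᵖ] MultSpace e i (ℕ →₀ M))
      (β : MultSpace e i (ℕ →₀ M) →ₗ[(D i)ᵐᵒᵖ] (Fin c → (D i)ᵐᵒᵖ)), β ∘ₗ α = LinearMap.id := by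
  have htop : dimHom e (ℕ →₀ M) i = ⊤ := by
    rw [dimHom_finsupp_nat, dimHom_self]
    exact ENat.top_mul (Nat.cast_ne_zero.2 (NeZero.ne (n i)))
  have hle : Cardinal.lift.{max v w} (Module.rank (D i)ᵐᵒᵖ (Fin c → (D i)ᵐᵒᵖ)) ≤
      Cardinal.lift.{w} (Module.rank (D i)ᵐᵒᵖ (MultSpace e i (ℕ →₀ M))) := by
    rw [rank_fun', Fintype.card_fin, Cardinal.lift_natCast]
    rw [dimHom_apply, Cardinal.toENat_eq_top] at htop
    exact Cardinal.natCast_lt_aleph0.le.trans (by simpa using htop)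
  obtain ⟨α, hα⟩ := lift_rank_le_iff_exists_linearMap.1 hle
  obtain ⟨β, hβ⟩ := α.exists_leftInverse_of_injective (LinearMap.ker_eq_bot.2 hα)
  exact ⟨α, β, hβ⟩

variable [IsNoetherianRing (Module.End R M)] {I : Ideal (Module.End R M)} [I.IsTwoSided]
  [IsArtinian (Module.End R M) (Module.End R M ⧸ I)]

theorem exists_inAdd_dimHom_eq_of_notMem (hI : IsIdempotentElem I) (c : Fin s → ℕ) :
    ∃ (X : Type v) (_ : AddCommGroup X) (_ : Module R X), InAdd R M X ∧
      IsCountablyGenerated R X ∧ (∀ i ∉ idealSupport e I, dimHom e X i = c i) ∧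
      ∀ i ∈ idealSupport e I, dimHom e X i ≠ 0 := by
  obtain ⟨k, hk⟩ := exists_jacobson_pow_le I
  choose α β hβα using fun i => exists_multSpace_finsupp_retract e (c i) i
  obtain ⟨E, hE, hαβ⟩ := exists_map_eq_of_isIdempotentElem e inAdd_self.finsupp_nat
    (ε := fun i => α i ∘ₗ β i) (fun i => LinearMap.ext fun w =>
      congrArg (α i) (LinearMap.congr_fun (hβα i) (β i w))) k
  obtain ⟨m, a, rfl⟩ := Submodule.fg_iff_exists_fin_generating_family.1 (IsNoetherian.noetherian I)
  obtain ⟨B, hB⟩ := exists_mul_transitionMap_mul_transitionMap_eq hI (homIdeal_mono hk hE)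
  refine ⟨Telescope (transitionMap a E), inferInstance, inferInstance,
    Telescope.inAdd hB inAdd_self.finsupp_nat,
    Telescope.isCountablyGenerated isCountablyGenerated_of_finite.finsupp, fun i hi => ?_,
    fun i hi => Telescope.dimHom_ne_zero_of_map_ne_zero hB e (map_transitionMap_ne_zero e hi)⟩
  have hincl : map e i (indexProj R M 0) ∘ₗ map e i (indexIncl R M 0) = LinearMap.id := by
    rw [← map_comp, ← map_id, ← Module.End.mul_eq_comp, indexProj_mul_indexIncl_self]
    rfl
  rw [Telescope.dimHom_eq_rank_of_map_eq_comp hB e (map e i (indexIncl R M 0) ∘ₗ α i)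
      (β i ∘ₗ map e i (indexProj R M 0)), rank_fun', Fintype.card_fin, Cardinal.toENat_nat]
  · rw [LinearMap.comp_assoc, ← LinearMap.comp_assoc (α i), hincl, LinearMap.id_comp, hβα]
  · rw [map_transitionMap_of_notMem e hi, hαβ]
    rfl

theorem exists_inAdd_dimHom_eq (hI : IsIdempotentElem I) (c : Fin s → ℕ) :
    ∃ (X : Type v) (_ : AddCommGroup X) (_ : Module R X), InAdd R M X ∧
      IsCountablyGenerated R X ∧ (∀ i ∉ idealSupport e I, dimHom e X i = c i) ∧
      ∀ i ∈ idealSupport e I, dimHom e X i = ⊤ := by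
  obtain ⟨X, _, _, hX, hXc, hX_out, -⟩ := exists_inAdd_dimHom_eq_of_notMem e hI c
  obtain ⟨Y, _, _, hY, hYc, hY_out, hY_in⟩ := exists_inAdd_dimHom_eq_of_notMem e hI 0
  refine ⟨X × (ℕ →₀ Y), inferInstance, inferInstance, hX.prod hY.finsupp_nat,
    hXc.prod hYc.finsupp, fun i hi => ?_, fun i hi => ?_⟩
  · rw [dimHom_prod, dimHom_finsupp_nat, Pi.add_apply, Pi.smul_apply, hX_out i hi, hY_out i hi]
    simp
  · rw [dimHom_prod, dimHom_finsupp_nat, Pi.add_apply, Pi.smul_apply, smul_eq_mul,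
      ENat.top_mul (hY_in i hi), add_top]

end RealizeIdeal

/-! ## Direct summands and their complements -/

section IdempotentSplitting

variable {R : Type u} [CommRing R] {M : Type v} [AddCommGroup M] [Module R M]
variable {X : Type v} [AddCommGroup X] [Module R X]

theorem rangeRestrict_comp_subtype {ε : Module.End R X} (hε : IsIdempotentElem ε) :
    ε.rangeRestrict ∘ₗ (LinearMap.range ε).subtype = LinearMap.id := by
  ext ⟨_, x, rfl⟩
  exact LinearMap.congr_fun hε x

theorem rangeRestrict_one_sub_comp_self {ε : Module.End R X} (hε : IsIdempotentElem ε) :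
    (1 - ε).rangeRestrict ∘ₗ ε = 0 := by
  ext x
  exact LinearMap.congr_fun hε.one_sub_mul_self x

theorem self_comp_subtype_range_one_sub {ε : Module.End R X} (hε : IsIdempotentElem ε) :
    ε ∘ₗ (LinearMap.range (1 - ε)).subtype = 0 := by
  ext ⟨_, x, rfl⟩
  exact LinearMap.congr_fun hε.mul_one_sub_self x

theorem isCompl_range_range_one_sub {ε : Module.End R X} (hε : IsIdempotentElem ε) :
    IsCompl (LinearMap.range ε) (LinearMap.range (1 - ε)) := by
  rw [← LinearMap.IsIdempotentElem.ker_eq_range_one_sub hε]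
  exact LinearMap.IsIdempotentElem.isCompl hε

theorem isIdempotentElem_comp_of_comp_eq_id {Y : Type v} [AddCommGroup Y] [Module R Y]
    {α : Y →ₗ[R] X} {β : X →ₗ[R] Y} (h : β ∘ₗ α = LinearMap.id) :
    IsIdempotentElem (α ∘ₗ β : Module.End R X) := by
  rw [IsIdempotentElem, Module.End.mul_eq_comp, LinearMap.comp_assoc, ← LinearMap.comp_assoc _ α,
    h, LinearMap.id_comp]

theorem inFinAdd_range {ε : Module.End R X} (hε : IsIdempotentElem ε) (h : ε ∈ finMaps R M X X) :
    InFinAdd R M (LinearMap.range ε) :=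
  inFinAdd_of_retract (rangeRestrict_comp_subtype hε) h

theorem InAdd.range {ε : Module.End R X} (hX : InAdd R M X) (hε : IsIdempotentElem ε) :
    InAdd R M (LinearMap.range ε) :=
  hX.of_retract (rangeRestrict_comp_subtype hε)

theorem IsCountablyGenerated.range {ε : Module.End R X} (hX : IsCountablyGenerated R X) :
    IsCountablyGenerated R (LinearMap.range ε) :=
  hX.of_surjective ε.rangeRestrict ε.surjective_rangeRestrict

variable {s : ℕ} {n : Fin s → ℕ} {D : Fin s → Type w} [∀ i, DivisionRing (D i)]
variable (e : Module.End R M ⧸ Ring.jacobson (Module.End R M) ≃+*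
  ∀ i, Matrix (Fin (n i)) (Fin (n i)) (D i))

theorem dimHom_eq_range_add_range_one_sub {ε : Module.End R X} (hε : IsIdempotentElem ε) :
    dimHom e X = dimHom e (LinearMap.range ε) + dimHom e (LinearMap.range (1 - ε)) :=
  dimHom_eq_add e (rangeRestrict_comp_subtype hε) (rangeRestrict_comp_subtype hε.one_sub)
    (add_sub_cancel ε 1)

variable [∀ i, NeZero (n i)] {Y : Type v} [AddCommGroup Y] [Module R Y]

theorem dimHom_range_one_sub_eq_top_smul (hd : dimHom e X = (⊤ : ℕ∞) • dimHom e Y)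
    {ε : Module.End R X} (hε : IsIdempotentElem ε) (h : ε ∈ finMaps R M X X) :
    dimHom e (LinearMap.range (1 - ε)) = (⊤ : ℕ∞) • dimHom e Y := by
  ext1 i
  have hsum := congrFun (dimHom_eq_range_add_range_one_sub e hε) i
  rw [hd, Pi.add_apply, Pi.smul_apply, smul_eq_mul] at hsum
  rw [Pi.smul_apply, smul_eq_mul]
  by_cases h0 : dimHom e Y i = 0
  · rw [h0, mul_zero] at hsum ⊢
    exact (add_eq_zero.1 hsum.symm).2
  · rw [ENat.top_mul h0] at hsum ⊢
    exact (WithTop.add_eq_top.1 hsum.symm).resolve_left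
      ((inFinAdd_range hε h).dimHom_ne_top e i)

theorem exists_isIdempotentElem_of_dimHom_le [Module.Finite R M] (hX : InFinAdd R M X)
    (hY : InAdd R M Y) (h : dimHom e X ≤ dimHom e Y) :
    ∃ ε : Module.End R Y, IsIdempotentElem ε ∧ ε ∈ finMaps R M Y Y ∧
      dimHom e Y = dimHom e X + dimHom e (LinearMap.range (1 - ε)) := by
  obtain ⟨α, β, hβα⟩ := exists_retract_of_dimHom_le e hX hY h
  have hε := isIdempotentElem_comp_of_comp_eq_id hβα
  exact ⟨α ∘ₗ β, hε, comp_right_mem_finMaps (hX.mem_finMaps α) β,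
    dimHom_eq_add e hβα (rangeRestrict_comp_subtype hε.one_sub) (add_sub_cancel _ _)⟩

end IdempotentSplitting

/-! ## Finite summands containing a given map -/

section FiniteIdempotents

open MultSpace

variable {R : Type u} [CommRing R] {M : Type v} [AddCommGroup M] [Module R M]
variable {X Y : Type v} [AddCommGroup X] [Module R X] [AddCommGroup Y] [Module R Y]

/-- The left ideal of the endomorphisms of `M` that factor through `x : M → X`. -/
def factorIdeal (x : M →ₗ[R] X) : Ideal (Module.End R M) :=
  LinearMap.range (LinearMap.lcomp (Module.End R M) M x)

theorem comp_mem_factorIdeal (h : X →ₗ[R] M) (x : M →ₗ[R] X) :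
    (h ∘ₗ x : Module.End R M) ∈ factorIdeal x := ⟨h, rfl⟩

theorem factorIdeal_comp_le (φ : X →ₗ[R] Y) (x : M →ₗ[R] X) :
    factorIdeal (φ ∘ₗ x) ≤ factorIdeal x := by
  rintro _ ⟨h, rfl⟩
  exact comp_mem_factorIdeal (h ∘ₗ φ) x

theorem InAdd.exists_comp_eq_of_factorIdeal_le [Module.Finite R M] (hY : InAdd R M Y)
    {x : M →ₗ[R] X} {y : M →ₗ[R] Y} (h : factorIdeal y ≤ factorIdeal x) :
    ∃ τ : X →ₗ[R] Y, τ ∘ₗ x = y := by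
  obtain ⟨ψ, hψ, hψy⟩ := hY.exists_finMaps_comp_eq y
  obtain ⟨m, g, f, rfl⟩ := exists_sum_of_mem_finMaps hψ
  choose k hk using fun j => h (comp_mem_factorIdeal (f j) y)
  refine ⟨∑ j, g j ∘ₗ k j, ?_⟩
  rw [← hψy]
  ext m
  simpa using Finset.sum_congr rfl fun j _ => congrArg (g j) (LinearMap.congr_fun (hk j) m)

theorem InAdd.factorIdeal_le_traceIdeal_mul [Module.Finite R M] (hX : InAdd R M X)
    (x : M →ₗ[R] X) :
    factorIdeal x ≤ traceIdeal M (LinearMap.id : X →ₗ[R] X) * factorIdeal x := by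
  rintro _ ⟨h, rfl⟩
  obtain ⟨ψ, hψ, hψx⟩ := hX.exists_finMaps_comp_eq x
  obtain ⟨m, g, f, rfl⟩ := exists_sum_of_mem_finMaps hψ
  have heq : h ∘ₗ x = ∑ j, (h ∘ₗ LinearMap.id ∘ₗ g j : Module.End R M) *
      (f j ∘ₗ x : Module.End R M) := by
    conv_lhs => rw [← hψx]
    ext m
    simp
  change h ∘ₗ x ∈ _
  rw [heq]
  exact Submodule.sum_mem _ fun j _ =>
    Ideal.mul_mem_mul (comp_mem_traceIdeal _ _ _) (comp_mem_factorIdeal _ _)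

theorem exists_isIdempotentElem_factorIdeal_le [IsNoetherianRing (Module.End R M)]
    (x : M →ₗ[R] X) :
    ∃ ε : Module.End R X, IsIdempotentElem ε ∧ ε ∈ finMaps R M X X ∧
      ∀ η : Module.End R X, IsIdempotentElem η → η ∈ finMaps R M X X → ε * η = 0 → η * ε = 0 →
        factorIdeal (η ∘ₗ x) ≤ factorIdeal (ε ∘ₗ x) := by
  obtain ⟨_, ⟨ε, ⟨hε, hεfin⟩, rfl⟩, hmax⟩ := set_has_maximal_iff_noetherian.2
    (inferInstance : IsNoetherianRing (Module.End R M))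
    ((fun ε : Module.End R X => factorIdeal (ε ∘ₗ x)) ''
      {ε | IsIdempotentElem ε ∧ ε ∈ finMaps R M X X})
    ⟨_, 0, ⟨IsIdempotentElem.zero, zero_mem _⟩, rfl⟩
  refine ⟨ε, hε, hεfin, fun η hη hηfin hεη hηε => ?_⟩
  have hle (φ : Module.End R X) (hφ : φ * (ε + η) = φ) :
      factorIdeal (φ ∘ₗ x) ≤ factorIdeal ((ε + η) ∘ₗ x) := by
    rw [← hφ, Module.End.mul_eq_comp, LinearMap.comp_assoc]
    exact factorIdeal_comp_le _ _
  have hsum : IsIdempotentElem (ε + η) := hε.add hη (by rw [hεη, hηε, add_zero])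
  have heq : factorIdeal (ε ∘ₗ x) = factorIdeal ((ε + η) ∘ₗ x) :=
    (hle ε (by rw [mul_add, hε.eq, hεη, add_zero])).eq_of_not_lt
      (hmax _ ⟨ε + η, ⟨hsum, add_mem hεfin hηfin⟩, rfl⟩)
  exact (hle η (by rw [mul_add, hη.eq, hηε, zero_add])).trans heq.ge

theorem factorIdeal_comp_le_of_comp_eq_zero {ε : Module.End R X} {x : M →ₗ[R] X}
    (hmax : ∀ η : Module.End R X, IsIdempotentElem η → η ∈ finMaps R M X X → ε * η = 0 →
      η * ε = 0 → factorIdeal (η ∘ₗ x) ≤ factorIdeal (ε ∘ₗ x))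
    (hY : InFinAdd R M Y) {γ : Y →ₗ[R] X} {δ : X →ₗ[R] Y} (hδγ : δ ∘ₗ γ = LinearMap.id)
    (hεγ : ε ∘ₗ γ = 0) (hδε : δ ∘ₗ ε = 0) {u : X →ₗ[R] Y} (hu : u ∘ₗ ε = 0) :
    factorIdeal (u ∘ₗ x) ≤ factorIdeal (ε ∘ₗ x) := by
  have hretract (δ' : X →ₗ[R] Y) (hδ'γ : δ' ∘ₗ γ = LinearMap.id) (hδ'ε : δ' ∘ₗ ε = 0)
      (k : Y →ₗ[R] M) : (k ∘ₗ δ' ∘ₗ x : Module.End R M) ∈ factorIdeal (ε ∘ₗ x) := by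
    refine hmax (γ ∘ₗ δ') (isIdempotentElem_comp_of_comp_eq_id hδ'γ)
      (comp_right_mem_finMaps (hY.mem_finMaps γ) δ') ?_ ?_ ⟨k ∘ₗ δ', ?_⟩
    · rw [Module.End.mul_eq_comp, ← LinearMap.comp_assoc, hεγ, LinearMap.zero_comp]
    · rw [Module.End.mul_eq_comp, LinearMap.comp_assoc, hδ'ε, LinearMap.comp_zero]
    · change k ∘ₗ (δ' ∘ₗ γ) ∘ₗ δ' ∘ₗ x = _
      rw [hδ'γ, LinearMap.id_comp]
  -- Subtracting `u ∘ γ ∘ δ` makes `u` vanish on `γ`, so that `δ + v` also retracts `γ`.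
  set v : X →ₗ[R] Y := u - u ∘ₗ γ ∘ₗ δ with hv
  have hvγ : v ∘ₗ γ = 0 := by
    rw [hv, LinearMap.sub_comp, LinearMap.comp_assoc, LinearMap.comp_assoc, hδγ,
      LinearMap.comp_id, sub_self]
  have hvε : v ∘ₗ ε = 0 := by
    rw [hv, LinearMap.sub_comp, hu, LinearMap.comp_assoc, LinearMap.comp_assoc, hδε,
      LinearMap.comp_zero, LinearMap.comp_zero, sub_zero]
  rintro _ ⟨k, rfl⟩
  have heq : k ∘ₗ u ∘ₗ x = k ∘ₗ (δ + v) ∘ₗ x - k ∘ₗ δ ∘ₗ x + (k ∘ₗ u ∘ₗ γ) ∘ₗ δ ∘ₗ x := by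
    ext
    simp [hv]
  change k ∘ₗ u ∘ₗ x ∈ _
  rw [heq]
  exact add_mem (sub_mem (hretract (δ + v) (by rw [LinearMap.add_comp, hδγ, hvγ, add_zero])
    (by rw [LinearMap.add_comp, hδε, hvε, add_zero]) k) (hretract δ hδγ hδε k))
    (hretract δ hδγ hδε _)

theorem traceIdeal_id_mul_le {J K : Ideal (Module.End R M)}
    (h : ∀ (p : M →ₗ[R] Y) (q : Y →ₗ[R] M), ∀ y ∈ J, (q ∘ₗ p : Module.End R M) * y ∈ K) :
    traceIdeal M (LinearMap.id : Y →ₗ[R] Y) * J ≤ K := by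
  refine Ideal.mul_le.2 fun t ht y hy => ?_
  induction ht using Submodule.span_induction with
  | mem t ht =>
    obtain ⟨p, q, rfl⟩ := ht
    exact h p q y hy
  | zero => rw [zero_mul]; exact zero_mem _
  | add a b _ _ ha hb => rw [add_mul]; exact add_mem ha hb
  | smul a b _ hb => rw [smul_mul_assoc]; exact Submodule.smul_mem _ _ hb

theorem exists_comp_eq_of_factorIdeal_one_sub_le [Module.Finite R M] (hX : InAdd R M X)
    {ε : Module.End R X} (hε : IsIdempotentElem ε) (hεfin : ε ∈ finMaps R M X X)
    {x : M →ₗ[R] X} (h : factorIdeal ((1 - ε) ∘ₗ x) ≤ factorIdeal (ε ∘ₗ x)) :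
    ∃ ε' : Module.End R X, IsIdempotentElem ε' ∧ ε' ∈ finMaps R M X X ∧ ε' ∘ₗ x = x := by
  obtain ⟨τ, hτ⟩ := hX.exists_comp_eq_of_factorIdeal_le h
  set ν : Module.End R X := (1 - ε) * τ * ε with hν
  have hεν : ε * ν = 0 := by
    rw [hν, ← mul_assoc, ← mul_assoc, hε.mul_one_sub_self, zero_mul, zero_mul]
  have hνε : ν * ε = ν := by rw [hν, mul_assoc, hε.eq]
  refine ⟨ε + ν, ?_, add_mem hεfin (comp_left_mem_finMaps hεfin _), ?_⟩
  · have hνν : ν * ν = 0 := by rw [← hνε, mul_assoc, hνε, hεν, mul_zero]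
    rw [IsIdempotentElem, mul_add, add_mul, add_mul, hε.eq, hνε, hεν, hνν, add_zero, add_zero]
  · have hνx : ν ∘ₗ x = (1 - ε) ∘ₗ τ ∘ₗ ε ∘ₗ x := rfl
    rw [LinearMap.add_comp, hνx, hτ, ← LinearMap.comp_assoc, ← Module.End.mul_eq_comp,
      hε.one_sub.eq, ← LinearMap.add_comp, add_sub_cancel]
    rfl

theorem InAdd.isIdempotentElem_traceIdeal_id [Module.Finite R M] (hX : InAdd R M X) :
    IsIdempotentElem (traceIdeal M (LinearMap.id : X →ₗ[R] X)) :=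
  le_antisymm Ideal.mul_le_left (hX.traceIdeal_comp_le LinearMap.id LinearMap.id)

variable {s : ℕ} {n : Fin s → ℕ} [∀ i, NeZero (n i)] {D : Fin s → Type w}
  [∀ i, DivisionRing (D i)]
variable (e : Module.End R M ⧸ Ring.jacobson (Module.End R M) ≃+*
  ∀ i, Matrix (Fin (n i)) (Fin (n i)) (D i))

variable [Module.Finite R M] [IsNoetherianRing (Module.End R M)]

theorem traceIdeal_id_le_of_dimHom (hX : InAdd R M X) (hY : InAdd R M Y)
    (h : ∀ i, dimHom e Y i = 0 → dimHom e X i = 0) :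
    traceIdeal M (LinearMap.id : X →ₗ[R] X) ≤ traceIdeal M (LinearMap.id : Y →ₗ[R] Y) := by
  refine le_of_le_sup_jacobson_of_isIdempotentElem hX.isIdempotentElem_traceIdeal_id
    (le_sup_jacobson_of_idealSupport_subset e fun i => ?_)
  rw [mem_idealSupport_traceIdeal e hX, mem_idealSupport_traceIdeal e hY, Ne, Ne,
    ← dimHom_eq_zero_iff_map_id, ← dimHom_eq_zero_iff_map_id]
  exact mt (h i)

omit [IsNoetherianRing (Module.End R M)] in
theorem exists_retract_orthogonal (hX : InAdd R M X) (hY : InFinAdd R M Y)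
    (hd : dimHom e X = (⊤ : ℕ∞) • dimHom e Y) {ε : Module.End R X} (hε : IsIdempotentElem ε)
    (hεfin : ε ∈ finMaps R M X X) :
    ∃ (γ : Y →ₗ[R] X) (δ : X →ₗ[R] Y), δ ∘ₗ γ = LinearMap.id ∧ ε ∘ₗ γ = 0 ∧ δ ∘ₗ ε = 0 := by
  have hle : dimHom e Y ≤ dimHom e (LinearMap.range (1 - ε)) := by
    rw [dimHom_range_one_sub_eq_top_smul e hd hε hεfin]
    exact fun i => le_mul_of_one_le_left' le_top
  obtain ⟨γ, δ, hδγ⟩ := exists_retract_of_dimHom_le e hY (hX.range hε.one_sub) hle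
  refine ⟨(LinearMap.range (1 - ε)).subtype ∘ₗ γ, δ ∘ₗ (1 - ε).rangeRestrict, ?_, ?_, ?_⟩
  · rw [LinearMap.comp_assoc, ← LinearMap.comp_assoc γ, rangeRestrict_comp_subtype hε.one_sub,
      LinearMap.id_comp, hδγ]
  · rw [← LinearMap.comp_assoc, self_comp_subtype_range_one_sub hε, LinearMap.zero_comp]
  · rw [LinearMap.comp_assoc, rangeRestrict_one_sub_comp_self hε, LinearMap.comp_zero]

theorem exists_isIdempotentElem_comp_eq (hX : InAdd R M X) (hY : InFinAdd R M Y)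
    (hd : dimHom e X = (⊤ : ℕ∞) • dimHom e Y) (x : M →ₗ[R] X) :
    ∃ ε : Module.End R X, IsIdempotentElem ε ∧ ε ∈ finMaps R M X X ∧ ε ∘ₗ x = x := by
  obtain ⟨ε, hε, hεfin, hmax⟩ := exists_isIdempotentElem_factorIdeal_le x
  obtain ⟨γ, δ, hδγ, hεγ, hδε⟩ := exists_retract_orthogonal e hX hY hd hε hεfin
  refine exists_comp_eq_of_factorIdeal_one_sub_le hX hε hεfin ?_
  calc factorIdeal ((1 - ε) ∘ₗ x)
      ≤ traceIdeal M (LinearMap.id : X →ₗ[R] X) * factorIdeal ((1 - ε) ∘ₗ x) :=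
        hX.factorIdeal_le_traceIdeal_mul _
    _ ≤ traceIdeal M (LinearMap.id : Y →ₗ[R] Y) * factorIdeal ((1 - ε) ∘ₗ x) :=
        Ideal.mul_mono_left (traceIdeal_id_le_of_dimHom e hX hY.inAdd fun i hi => by
          rw [hd, Pi.smul_apply, hi, smul_zero])
    _ ≤ factorIdeal (ε ∘ₗ x) := traceIdeal_id_mul_le ?_
  rintro p q _ ⟨h, rfl⟩
  have hu : (p ∘ₗ h ∘ₗ (1 - ε)) ∘ₗ ε = 0 := by
    rw [LinearMap.comp_assoc, LinearMap.comp_assoc, ← Module.End.mul_eq_comp,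
      hε.one_sub_mul_self, LinearMap.comp_zero, LinearMap.comp_zero]
  exact factorIdeal_comp_le_of_comp_eq_zero hmax hY hδγ hεγ hδε hu (comp_mem_factorIdeal q _)

end FiniteIdempotents

/-! ## Direct sums of objects of `add(M)` -/

section DirectSums

theorem iSupIndep_sigma {α : Type*} [CompleteLattice α] [IsModularLattice α]
    [IsCompactlyGenerated α] {ι : Type*} {β : ι → Type*} {f : Sigma β → α}
    (h : iSupIndep fun i => ⨆ b, f ⟨i, b⟩) (hf : ∀ i, iSupIndep fun b => f ⟨i, b⟩) :
    iSupIndep f := by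
  classical
  rw [iSupIndep_iff_supIndep]
  intro t
  have ht : t ⊆ (t.image Sigma.fst).sigma fun i => t.preimage (Sigma.mk i)
      sigma_mk_injective.injOn := by
    rintro ⟨i, b⟩ hb
    rw [Finset.mem_sigma, Finset.mem_preimage]
    exact ⟨Finset.mem_image_of_mem _ hb, hb⟩
  refine Finset.SupIndep.subset (Finset.SupIndep.sigma ?_ fun i _ => (hf i).supIndep' _) ht
  exact Finset.SupIndep.antitone_fun
    (fun i _ => Finset.sup_le fun b _ => le_iSup (fun b => f ⟨i, b⟩) b) (h.supIndep' _)

variable {R : Type u} [CommRing R] {M : Type v} [AddCommGroup M] [Module R M]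
variable {X : Type v} [AddCommGroup X] [Module R X]

theorem isDirectSumInFinAdd_iff : IsDirectSumInFinAdd R M X ↔
    ∃ (κ : Type v) (N : κ → Submodule R X), iSupIndep N ∧ ⨆ k, N k = ⊤ ∧ ∀ k, InFinAdd R M (N k) :=
  exists_congr fun _ => exists_congr fun N => (and_congr_left' <|
    DirectSum.isInternal_submodule_iff_iSupIndep_and_iSup_eq_top (dec_ι := Classical.decEq _)
      N).trans and_assoc

theorem isDirectSumOfFinite_iff : IsDirectSumOfFinite R X ↔
    ∃ (κ : Type v) (N : κ → Submodule R X), iSupIndep N ∧ ⨆ k, N k = ⊤ ∧ ∀ k, (N k).FG :=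
  exists_congr fun _ => exists_congr fun N => (and_congr_left' <|
    DirectSum.isInternal_submodule_iff_iSupIndep_and_iSup_eq_top (dec_ι := Classical.decEq _)
      N).trans and_assoc

theorem isDirectSumInFinAdd_of_iSupIndep {κ : Type v} {N : κ → Submodule R X}
    (hi : iSupIndep N) (hs : ⨆ k, N k = ⊤) (h : ∀ k, IsDirectSumInFinAdd R M (N k)) :
    IsDirectSumInFinAdd R M X := by
  simp only [isDirectSumInFinAdd_iff] at h ⊢
  choose l L hL hL' hfin using h
  have hsup (k : κ) : ⨆ j, (L k j).map (N k).subtype = N k := by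
    rw [← Submodule.map_iSup, hL' k, Submodule.map_top, Submodule.range_subtype]
  refine ⟨Σ k, l k, fun a => (L a.1 a.2).map (N a.1).subtype,
    iSupIndep_sigma ?_ fun k => ?_, ?_, fun a => ?_⟩
  · simpa only [hsup] using hi
  · exact LinearMap.iSupIndep_map _ (N k).injective_subtype (hL k)
  · rw [iSup_sigma]
    simpa only [hsup] using hs
  · let E := (L a.1 a.2).equivMapOfInjective _ (N a.1).injective_subtype
    exact (hfin a.1 a.2).of_retract (α := E.symm.toLinearMap) (β := E.toLinearMap)
      (by ext x; simp)

theorem InFinAdd.isDirectSumInFinAdd (h : InFinAdd R M X) : IsDirectSumInFinAdd R M X := by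
  refine isDirectSumInFinAdd_iff.2 ⟨PUnit, fun _ => ⊤, iSupIndep_subsingleton _, by simp,
    fun _ => ?_⟩
  exact h.of_retract (α := (⊤ : Submodule R X).subtype)
    (β := (Submodule.topEquiv (R := R) (M := X)).symm.toLinearMap) (by ext; simp)

theorem isDirectSumInFinAdd_of_isCompl {N L : Submodule R X} (h : IsCompl N L)
    (hN : IsDirectSumInFinAdd R M N) (hL : IsDirectSumInFinAdd R M L) :
    IsDirectSumInFinAdd R M X := by
  refine isDirectSumInFinAdd_of_iSupIndep (N := fun b : ULift Bool => cond b.down N L) ?_ ?_ ?_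
  · rw [iSupIndep_pair (i := ⟨true⟩) (j := ⟨false⟩) (by simp) (by rintro ⟨_ | _⟩ <;> simp)]
    exact h.disjoint
  · rw [ULift.down_surjective.iSup_comp (fun b => cond b N L), iSup_bool_eq]
    exact h.sup_eq_top
  · rintro ⟨_ | _⟩
    exacts [hL, hN]

theorem iSupIndep_range_of_orthogonal {ι : Type*} {d : ι → Module.End R X}
    (h : ∀ j, IsIdempotentElem (d j)) (h' : Pairwise fun j k => d j * d k = 0) :
    iSupIndep fun j => LinearMap.range (d j) := by
  intro j
  have hle : ⨆ k, ⨆ (_ : k ≠ j), LinearMap.range (d k) ≤ LinearMap.ker (d j) :=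
    iSup₂_le fun k hk => LinearMap.range_le_ker_iff.2 (h' hk.symm)
  exact (LinearMap.IsIdempotentElem.isCompl (h j)).disjoint.mono_right hle

theorem InAdd.iSup_range_eq_top (hX : InAdd R M X) :
    ⨆ q : M →ₗ[R] X, LinearMap.range q = ⊤ := by
  obtain ⟨ι, f, g, h⟩ := hX
  refine eq_top_iff.2 fun x _ => ?_
  rw [← LinearMap.id_apply (R := R) x, ← h, LinearMap.comp_apply, ← (f x).sum_single,
    Finsupp.sum, _root_.map_sum]
  exact Submodule.sum_mem _ fun k _ =>
    Submodule.mem_iSup_of_mem (g ∘ₗ Finsupp.lsingle k) ⟨f x k, rfl⟩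

theorem InAdd.exists_iSup_range_eq_top (hX : InAdd R M X) (hc : IsCountablyGenerated R X) :
    ∃ p : ℕ → M →ₗ[R] X, ⨆ k, LinearMap.range (p k) = ⊤ := by
  obtain ⟨c, hc, hspan⟩ := hc
  choose t ht using fun x => Submodule.mem_iSup_iff_exists_finset.1
    (hX.iSup_range_eq_top.symm ▸ Submodule.mem_top : x ∈ ⨆ q : M →ₗ[R] X, LinearMap.range q)
  have hT : (insert 0 (⋃ x ∈ c, (t x : Set (M →ₗ[R] X)))).Countable :=
    (hc.biUnion fun x _ => (t x).countable_toSet).insert 0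
  obtain ⟨p, hp⟩ := hT.exists_eq_range (Set.insert_nonempty _ _)
  refine ⟨p, eq_top_iff.2 (hspan.symm.le.trans (Submodule.span_le.2 fun x hx => ?_))⟩
  refine (iSup₂_le fun q hq => ?_ : ⨆ q ∈ t x, LinearMap.range q ≤ _) (ht x)
  obtain ⟨k, rfl⟩ : q ∈ Set.range p := hp ▸ Set.mem_insert_of_mem _ (Set.mem_biUnion hx hq)
  exact le_iSup (fun k => LinearMap.range (p k)) k

end DirectSums

section IncreasingIdempotents

theorem mul_eq_min_of_forall_succ {S : Type*} [Semigroup S] {E : ℕ → S}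
    (hE : ∀ k, IsIdempotentElem (E k)) (hl : ∀ k, E k * E (k + 1) = E k)
    (hr : ∀ k, E (k + 1) * E k = E k) (j k : ℕ) : E j * E k = E (min j k) := by
  have hle (j k : ℕ) (hjk : j ≤ k) : E j * E k = E j ∧ E k * E j = E j := by
    induction k, hjk using Nat.le_induction with
    | base => exact ⟨hE j, hE j⟩
    | succ k _ ih =>
      exact ⟨by rw [← ih.1, mul_assoc, hl], by rw [← ih.2, ← mul_assoc, hr]⟩
  rcases le_total j k with h | h
  · rw [min_eq_left h, (hle j k h).1]
  · rw [min_eq_right h, (hle k j h).2]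

variable {S : Type*} [Ring S] {E : ℕ → S}

theorem isIdempotentElem_succ_sub (hE : ∀ j k, E j * E k = E (min j k)) (k : ℕ) :
    IsIdempotentElem (E (k + 1) - E k) := by
  simp only [IsIdempotentElem, mul_sub, sub_mul, hE, min_self, min_eq_left k.le_succ,
    min_eq_right k.le_succ, sub_self, sub_zero]

theorem succ_sub_mul_succ_sub_of_ne (hE : ∀ j k, E j * E k = E (min j k)) {j k : ℕ}
    (hjk : j ≠ k) : (E (j + 1) - E j) * (E (k + 1) - E k) = 0 := by
  simp only [mul_sub, sub_mul, hE]
  rcases hjk.lt_or_gt with h | h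
  · rw [min_eq_left (by lia : j + 1 ≤ k + 1), min_eq_left (by lia : j ≤ k + 1),
      min_eq_left (by lia : j + 1 ≤ k), min_eq_left h.le, sub_self]
  · rw [min_eq_right (by lia : k + 1 ≤ j + 1), min_eq_right (by lia : k + 1 ≤ j),
      min_eq_right (by lia : k ≤ j + 1), min_eq_right h.le, sub_self, sub_self, sub_zero]

end IncreasingIdempotents

section CountableDecomposition

variable {R : Type u} [CommRing R] {M : Type v} [AddCommGroup M] [Module R M]
variable {X : Type v} [AddCommGroup X] [Module R X]

theorem isDirectSumInFinAdd_of_mul_eq_min {E : ℕ → Module.End R X} (h0 : E 0 = 0)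
    (hE : ∀ j k, E j * E k = E (min j k)) (hfin : ∀ k, E k ∈ finMaps R M X X)
    (htop : ⨆ k, LinearMap.range (E k) = ⊤) : IsDirectSumInFinAdd R M X := by
  have hle (k : ℕ) : LinearMap.range (E k) ≤ ⨆ j, LinearMap.range (E (j + 1) - E j) := by
    rintro _ ⟨x, rfl⟩
    rw [← sub_zero (E k), ← h0, ← Finset.sum_range_sub E k, LinearMap.sum_apply]
    exact Submodule.sum_mem _ fun j _ => Submodule.mem_iSup_of_mem j ⟨x, rfl⟩
  refine isDirectSumInFinAdd_of_iSupIndep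
    (N := fun k : ULift ℕ => LinearMap.range (E (k.down + 1) - E k.down))
    ((iSupIndep_range_of_orthogonal (isIdempotentElem_succ_sub hE) fun _ _ =>
      succ_sub_mul_succ_sub_of_ne hE).comp ULift.down_injective) ?_ fun k => ?_
  · rw [ULift.down_surjective.iSup_comp fun k => LinearMap.range (E (k + 1) - E k), eq_top_iff,
      ← htop]
    exact iSup_le hle
  · exact (inFinAdd_range (isIdempotentElem_succ_sub hE _)
      (Submodule.sub_mem _ (hfin _) (hfin _))).isDirectSumInFinAdd

variable [Module.Finite R M] [IsNoetherianRing (Module.End R M)]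
variable {Y : Type v} [AddCommGroup Y] [Module R Y]
variable {s : ℕ} {n : Fin s → ℕ} [∀ i, NeZero (n i)] {D : Fin s → Type w} [∀ i, DivisionRing (D i)]
variable (e : Module.End R M ⧸ Ring.jacobson (Module.End R M) ≃+*
  ∀ i, Matrix (Fin (n i)) (Fin (n i)) (D i))

theorem exists_larger_isIdempotentElem (hX : InAdd R M X) (hY : InFinAdd R M Y)
    (hd : dimHom e X = (⊤ : ℕ∞) • dimHom e Y) {ε : Module.End R X} (hε : IsIdempotentElem ε)
    (hfin : ε ∈ finMaps R M X X) (p : M →ₗ[R] X) :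
    ∃ ε' : Module.End R X, IsIdempotentElem ε' ∧ ε' ∈ finMaps R M X X ∧ ε * ε' = ε ∧
      ε' * ε = ε ∧ ε' ∘ₗ p = p := by
  obtain ⟨d, hdd, hdfin, hdp⟩ := exists_isIdempotentElem_comp_eq e (hX.range hε.one_sub) hY
    (dimHom_range_one_sub_eq_top_smul e hd hε hfin) ((1 - ε).rangeRestrict ∘ₗ p)
  set ι := (LinearMap.range (1 - ε)).subtype
  set π := (1 - ε).rangeRestrict
  set d' : Module.End R X := ι ∘ₗ d ∘ₗ π with hd'
  have hεd : ε * d' = 0 := by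
    rw [hd', Module.End.mul_eq_comp, ← LinearMap.comp_assoc, self_comp_subtype_range_one_sub hε,
      LinearMap.zero_comp]
  have hdε : d' * ε = 0 := by
    rw [hd', Module.End.mul_eq_comp, LinearMap.comp_assoc, LinearMap.comp_assoc,
      rangeRestrict_one_sub_comp_self hε, LinearMap.comp_zero, LinearMap.comp_zero]
  have hd'd' : IsIdempotentElem d' := by
    have hassoc : d' * d' = ι ∘ₗ (d ∘ₗ (π ∘ₗ ι) ∘ₗ d) ∘ₗ π := rfl
    rw [IsIdempotentElem, hassoc, rangeRestrict_comp_subtype hε.one_sub, LinearMap.id_comp,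
      ← Module.End.mul_eq_comp, hdd]
  have hd'p : d' ∘ₗ p = (1 - ε) ∘ₗ p := congrArg (ι ∘ₗ ·) hdp
  refine ⟨ε + d', hε.add hd'd' (by rw [hεd, hdε, add_zero]),
    add_mem hfin (comp_left_mem_finMaps (comp_right_mem_finMaps hdfin _) _), ?_, ?_, ?_⟩
  · rw [mul_add, hε, hεd, add_zero]
  · rw [add_mul, hε, hdε, add_zero]
  · rw [LinearMap.add_comp, hd'p, ← LinearMap.add_comp, add_sub_cancel]
    rfl

theorem isDirectSumInFinAdd_of_dimHom_eq_top_smul (hX : InAdd R M X)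
    (hc : IsCountablyGenerated R X) (hY : InFinAdd R M Y)
    (hd : dimHom e X = (⊤ : ℕ∞) • dimHom e Y) : IsDirectSumInFinAdd R M X := by
  obtain ⟨p, hp⟩ := hX.exists_iSup_range_eq_top hc
  choose! next hidem hfin hl hr hcomp using
    fun (k : ℕ) (ε : Module.End R X) (h : IsIdempotentElem ε ∧ ε ∈ finMaps R M X X) =>
      exists_larger_isIdempotentElem e hX hY hd h.1 h.2 (p k)
  let E : ℕ → Module.End R X := fun k => Nat.rec 0 next k
  have hE (k : ℕ) : IsIdempotentElem (E k) ∧ E k ∈ finMaps R M X X := by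
    induction k with
    | zero => exact ⟨.zero, Submodule.zero_mem _⟩
    | succ k ih => exact ⟨hidem k _ ih, hfin k _ ih⟩
  refine isDirectSumInFinAdd_of_mul_eq_min (E := E) rfl
    (mul_eq_min_of_forall_succ (fun k => (hE k).1) (fun k => hl k _ (hE k))
      fun k => hr k _ (hE k)) (fun k => (hE k).2)
    (eq_top_iff.2 (hp.symm.le.trans (iSup_le fun k => ?_)))
  have hEp : E (k + 1) ∘ₗ p k = p k := hcomp k _ (hE k)
  rw [← hEp]
  exact (LinearMap.range_comp_le_range _ _).trans (le_iSup (fun k => LinearMap.range (E k)) (k + 1))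

end CountableDecomposition

/-! ## Kaplansky's theorem on direct summands of direct sums -/

section Kaplansky

theorem sSupIndep_insert {α : Type*} [CompleteLattice α] [IsModularLattice α] {t : Set α} {a : α}
    (ht : sSupIndep t) (ha : Disjoint a (sSup t)) : sSupIndep (insert a t) := by
  intro b hb
  by_cases hba : b = a
  · subst hba
    exact ha.mono_right (sSup_le_sSup fun c hc => hc.1.resolve_left hc.2)
  · have hbt : b ∈ t := hb.resolve_left hba
    rw [Set.insert_sdiff_of_notMem _ (fun h => hba h.symm), sSup_insert, sup_comm]
    refine (ht hbt).disjoint_sup_right_of_disjoint_sup_left (ha.symm.mono_left ?_)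
    exact sup_le (le_sSup hbt) (sSup_le_sSup Set.sdiff_subset)

theorem exists_countable_closed {ι : Type*} (T : ι → Finset ι) (c : ι) :
    ∃ K : Set ι, K.Countable ∧ c ∈ K ∧ ∀ x ∈ K, (T x : Set ι) ⊆ K := by
  let L : ℕ → Set ι := fun k => Nat.rec {c} (fun _ L => ⋃ x ∈ L, (T x : Set ι)) k
  have hL (k : ℕ) : (L k).Countable := by
    induction k with
    | zero => exact Set.countable_singleton c
    | succ k ih => exact ih.biUnion fun x _ => (T x).countable_toSet
  refine ⟨⋃ k, L k, Set.countable_iUnion hL, Set.mem_iUnion_of_mem 0 rfl, fun x hx y hy => ?_⟩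
  obtain ⟨k, hk⟩ := Set.mem_iUnion.1 hx
  exact Set.mem_iUnion_of_mem (k + 1) (Set.mem_biUnion hk hy)

variable {R : Type u} [CommRing R] {M : Type v} [AddCommGroup M] [Module R M] {ι : Type*}

theorem exists_finset_single_mem_supported [Module.Finite R M] (φ : Module.End R (ι →₀ M))
    (x : ι) : ∃ t : Finset ι, ∀ m, φ (Finsupp.single x m) ∈ Finsupp.supported M R (t : Set ι) := by
  classical
  obtain ⟨g, hg⟩ := Module.Finite.fg_top (R := R) (M := M)
  let t := g.biUnion fun m => (φ (Finsupp.single x m)).support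
  have hspan : Submodule.span R (g : Set M) ≤
      (Finsupp.supported M R (t : Set ι)).comap (φ ∘ₗ Finsupp.lsingle x) :=
    Submodule.span_le.2 fun m hm => Finset.coe_subset.2 <|
      Finset.subset_biUnion_of_mem (fun m => (φ (Finsupp.single x m)).support) hm
  exact ⟨t, fun m => hspan (hg ▸ Submodule.mem_top)⟩

theorem exists_countable_supported_mem_invtSubmodule [Module.Finite R M]
    (φ : Module.End R (ι →₀ M)) (c : ι) :
    ∃ K : Set ι, K.Countable ∧ c ∈ K ∧ Finsupp.supported M R K ∈ Module.End.invtSubmodule φ := by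
  choose T hT using exists_finset_single_mem_supported φ
  obtain ⟨K, hK, hc, hTK⟩ := exists_countable_closed T c
  refine ⟨K, hK, hc, fun z hz => ?_⟩
  rw [Submodule.mem_comap, ← z.sum_single, Finsupp.sum, _root_.map_sum]
  exact Submodule.sum_mem _ fun x hx => Finsupp.supported_mono (hTK x (hz hx)) (hT x _)

theorem isCountablyGenerated_map_supported [Module.Finite R M] {N : Type*} [AddCommGroup N]
    [Module R N] (φ : (ι →₀ M) →ₗ[R] N) {K : Set ι} (hK : K.Countable) :
    IsCountablyGenerated R ((Finsupp.supported M R K).map φ) := by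
  have := hK.to_subtype
  let E : Finsupp.supported M R K ≃ₗ[R] (K →₀ M) := Finsupp.supportedEquivFinsupp K
  exact (isCountablyGenerated_of_finite.finsupp (ι := K)).of_surjective
    (φ.submoduleMap (Finsupp.supported M R K) ∘ₗ E.symm.toLinearMap)
    ((φ.submoduleMap_surjective _).comp E.symm.surjective)

variable {X : Type v} [AddCommGroup X] [Module R X]

theorem exists_isIdempotentElem_range_eq_map_supported {f : X →ₗ[R] (ι →₀ M)}
    {g : (ι →₀ M) →ₗ[R] X} (hgf : g ∘ₗ f = LinearMap.id) {K : Set ι}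
    (hK : Finsupp.supported M R K ∈ Module.End.invtSubmodule (f ∘ₗ g)) :
    ∃ ψ : Module.End R X, IsIdempotentElem ψ ∧
      LinearMap.range ψ = (Finsupp.supported M R K).map g := by
  classical
  let ψ : Module.End R X := g ∘ₗ (Finsupp.supported M R K).subtype ∘ₗ
    Finsupp.restrictDom M R K ∘ₗ f
  have hmem (x : X) : ψ x ∈ (Finsupp.supported M R K).map g :=
    Submodule.mem_map_of_mem (Finsupp.restrictDom M R K (f x)).2
  have hfix : ∀ x ∈ (Finsupp.supported M R K).map g, ψ x = x := by
    rintro _ ⟨z, hz, rfl⟩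
    have hres : Finsupp.restrictDom M R K (f (g z)) = ⟨f (g z), hK hz⟩ :=
      LinearMap.congr_fun (Finsupp.restrictDom_comp_subtype K) ⟨f (g z), hK hz⟩
    change g (Finsupp.restrictDom M R K (f (g z)) : ι →₀ M) = g z
    rw [hres]
    exact LinearMap.congr_fun hgf (g z)
  refine ⟨ψ, LinearMap.ext fun x => hfix _ (hmem x), le_antisymm ?_ fun x hx => ⟨x, hfix x hx⟩⟩
  rintro _ ⟨x, rfl⟩
  exact hmem x

theorem map_one_sub_sup_range (ψ : Module.End R X) (N : Submodule R X) :
    N.map (1 - ψ) ⊔ LinearMap.range ψ = N ⊔ LinearMap.range ψ := by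
  refine le_antisymm (sup_le ?_ le_sup_right) (sup_le (fun x hx => ?_) le_sup_right)
  · rintro _ ⟨x, hx, rfl⟩
    exact sub_mem (Submodule.mem_sup_left hx) (Submodule.mem_sup_right ⟨x, rfl⟩)
  · rw [← sub_add_cancel x (ψ x)]
    exact add_mem (Submodule.mem_sup_left ⟨x, hx, rfl⟩) (Submodule.mem_sup_right ⟨x, rfl⟩)

/-- A stage of Kaplansky's transfinite construction for the retraction `g` of `f`: a set `K` of
coordinates preserved by `f ∘ g`, and a decomposition of `g (M^(K))` into countably generated
submodules. -/
structure IsPartialDecomposition (f : X →ₗ[R] (ι →₀ M)) (g : (ι →₀ M) →ₗ[R] X)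
    (p : Set ι × Set (Submodule R X)) : Prop where
  mem_invtSubmodule : Finsupp.supported M R p.1 ∈ Module.End.invtSubmodule (f ∘ₗ g)
  sSupIndep : sSupIndep p.2
  isCountablyGenerated : ∀ C ∈ p.2, IsCountablyGenerated R C
  sSup_eq : sSup p.2 = (Finsupp.supported M R p.1).map g

namespace IsPartialDecomposition

variable {f : X →ₗ[R] (ι →₀ M)} {g : (ι →₀ M) →ₗ[R] X}

theorem empty : IsPartialDecomposition f g (∅, ∅) :=
  ⟨by simp, sSupIndep_empty, by simp, by simp⟩

theorem iUnion_of_isChain {c : Set (Set ι × Set (Submodule R X))}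
    (hc : IsChain (· ≤ ·) c) (h : ∀ p ∈ c, IsPartialDecomposition f g p) :
    IsPartialDecomposition f g (⋃ p : c, p.1.1, ⋃ p : c, p.1.2) where
  mem_invtSubmodule := by
    rw [Finsupp.supported_iUnion]
    exact iSup_le fun p : c => (h p.1 p.2).mem_invtSubmodule.trans
      (Submodule.comap_mono (le_iSup (fun p : c => Finsupp.supported M R p.1.1) p))
  sSupIndep := by
    refine sSupIndep_iUnion_of_directed (fun p q => ?_) fun p => (h p p.2).sSupIndep
    obtain hpq | hqp := hc.total p.2 q.2
    · exact ⟨q, hpq.2, le_rfl⟩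
    · exact ⟨p, le_rfl, hqp.2⟩
  isCountablyGenerated C hC := by
    obtain ⟨p, hp⟩ := Set.mem_iUnion.1 hC
    exact (h p p.2).isCountablyGenerated C hp
  sSup_eq := by
    rw [sSup_iUnion, Finsupp.supported_iUnion, Submodule.map_iSup]
    exact iSup_congr fun p => (h p p.2).sSup_eq

theorem exists_le_mem [Module.Finite R M] (hgf : g ∘ₗ f = LinearMap.id)
    {p : Set ι × Set (Submodule R X)} (hp : IsPartialDecomposition f g p) (c : ι) :
    ∃ q, IsPartialDecomposition f g q ∧ p ≤ q ∧ c ∈ q.1 := by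
  obtain ⟨L, hL, hcL, hLinv⟩ := exists_countable_supported_mem_invtSubmodule (f ∘ₗ g) c
  obtain ⟨ψ, hψ, hrange⟩ :=
    exists_isIdempotentElem_range_eq_map_supported hgf hp.mem_invtSubmodule
  set C : Submodule R X := (Finsupp.supported M R L).map ((1 - ψ) ∘ₗ g) with hC
  have hdisj : Disjoint C (sSup p.2) := by
    rw [hp.sSup_eq, ← hrange]
    exact (isCompl_range_range_one_sub hψ).disjoint.symm.mono_left
      (LinearMap.map_le_range.trans (LinearMap.range_comp_le_range _ _))
  refine ⟨(p.1 ∪ L, insert C p.2), ⟨?_, sSupIndep_insert hp.sSupIndep hdisj, ?_, ?_⟩,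
    ⟨Set.subset_union_left, Set.subset_insert _ _⟩, Or.inr hcL⟩
  · rw [Finsupp.supported_union]
    exact Sublattice.sup_mem hp.mem_invtSubmodule hLinv
  · rintro _ (rfl | h)
    · exact isCountablyGenerated_map_supported _ hL
    · exact hp.isCountablyGenerated _ h
  · rw [sSup_insert, hp.sSup_eq, Finsupp.supported_union, Submodule.map_sup, ← hrange, hC,
      Submodule.map_comp, map_one_sub_sup_range, sup_comm]

end IsPartialDecomposition

theorem InAdd.exists_sSupIndep [Module.Finite R M] (hX : InAdd R M X) :
    ∃ 𝒟 : Set (Submodule R X), sSupIndep 𝒟 ∧ sSup 𝒟 = ⊤ ∧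
      ∀ C ∈ 𝒟, IsCountablyGenerated R C := by
  obtain ⟨ι, f, g, hgf⟩ := hX
  obtain ⟨⟨K, 𝒟⟩, -, hp, hmax⟩ := zorn_le_nonempty₀ {p | IsPartialDecomposition f g p}
    (fun c hcS hc _ _ => ⟨_, IsPartialDecomposition.iUnion_of_isChain hc hcS, fun p hp =>
      ⟨Set.subset_iUnion (fun p : c => p.1.1) ⟨p, hp⟩,
        Set.subset_iUnion (fun p : c => p.1.2) ⟨p, hp⟩⟩⟩) (∅, ∅) .empty
  have hK : K = Set.univ := Set.eq_univ_of_forall fun c => by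
    obtain ⟨q, hq, hle, hc⟩ := hp.exists_le_mem hgf c
    exact (hmax hq hle).1 hc
  refine ⟨𝒟, hp.sSupIndep, ?_, hp.isCountablyGenerated⟩
  rw [hp.sSup_eq, hK, Finsupp.supported_univ, Submodule.map_top, LinearMap.range_eq_top]
  exact LinearMap.surjective_of_comp_eq_id f g hgf

end Kaplansky

section CoordinateProjections

variable {R : Type u} [CommRing R] {M : Type v} [AddCommGroup M] [Module R M]
variable {X : Type v} [AddCommGroup X] [Module R X] {κ : Type*} {N : κ → Submodule R X}

theorem isCompl_iSup_ne (h : iSupIndep N) (htop : ⨆ k, N k = ⊤) (k : κ) :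
    IsCompl (N k) (⨆ j, ⨆ (_ : j ≠ k), N j) :=
  ⟨h k, codisjoint_iff.2 ((iSup_split_single N k).symm.trans htop)⟩

theorem exists_projections_of_iSupIndep (h : iSupIndep N) (htop : ⨆ k, N k = ⊤) :
    ∃ π : ∀ k, X →ₗ[R] N k, (∀ k, π k ∘ₗ (N k).subtype = LinearMap.id) ∧
      Pairwise fun j k => π j ∘ₗ (N k).subtype = 0 := by
  refine ⟨fun k => Submodule.projectionOnto _ _ (isCompl_iSup_ne h htop k),
    fun k =>
    Submodule.projectionOnto_comp_subtype (isCompl_iSup_ne h htop k), fun j k hjk => ?_⟩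
  ext ⟨x, hx⟩
  have hxj : x ∈ ⨆ i, ⨆ (_ : i ≠ j), N i :=
    (le_iSup₂_of_le (f := fun i (_ : i ≠ j) => N i) k hjk.symm le_rfl) hx
  exact congrArg Subtype.val (Submodule.projectionOnto_apply_of_mem_right
    (isCompl_iSup_ne h htop j) hxj)

theorem exists_finset_sum_of_iSup_eq_top [Module.Finite R M] (htop : ⨆ k, N k = ⊤)
    {π : ∀ k, X →ₗ[R] N k} (hπ : ∀ k, π k ∘ₗ (N k).subtype = LinearMap.id)
    (hπ' : Pairwise fun j k => π j ∘ₗ (N k).subtype = 0) (p : M →ₗ[R] X) :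
    ∃ t : Finset κ, p = ∑ k ∈ t, (N k).subtype ∘ₗ π k ∘ₗ p := by
  classical
  obtain ⟨g, hg⟩ := Module.Finite.fg_top (R := R) (M := M)
  choose t ht using fun m => Submodule.mem_iSup_iff_exists_finset.1
    (htop.symm ▸ Submodule.mem_top : p m ∈ ⨆ k, N k)
  refine ⟨g.biUnion t, LinearMap.ext_on hg fun m hm => ?_⟩
  have hle : (⨆ k ∈ t m, N k) ≤ LinearMap.eqLocus LinearMap.id
      (∑ k ∈ g.biUnion t, (N k).subtype ∘ₗ π k) := iSup₂_le fun k hk x hx => by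
    have hk' : k ∈ g.biUnion t := Finset.mem_biUnion.2 ⟨m, hm, hk⟩
    rw [LinearMap.mem_eqLocus, LinearMap.id_apply, LinearMap.sum_apply,
      Finset.sum_eq_single_of_mem k hk' fun j _ hj => ?_]
    · exact (congrArg Subtype.val (LinearMap.congr_fun (hπ k) ⟨x, hx⟩)).symm
    · exact congrArg Subtype.val (LinearMap.congr_fun (hπ' hj) ⟨x, hx⟩)
  have hpm := hle (ht m)
  rw [LinearMap.mem_eqLocus, LinearMap.id_apply] at hpm
  simp only [LinearMap.sum_apply, LinearMap.comp_apply] at hpm ⊢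
  exact hpm

end CoordinateProjections

/-! ## The monoid of dimension vectors -/

section DimensionMonoid

variable {R : Type u} [CommRing R] {M : Type v} [AddCommGroup M] [Module R M]
variable {s : ℕ} {n : Fin s → ℕ} {D : Fin s → Type w} [∀ i, DivisionRing (D i)]
variable (e : Module.End R M ⧸ Ring.jacobson (Module.End R M) ≃+*
  ∀ i, Matrix (Fin (n i)) (Fin (n i)) (D i))

/-- The monoid `B = D_M(V^*(M))`. -/
def dimMonoid : AddSubmonoid (Fin s → ℕ∞) where
  carrier := imageVStar e
  zero_mem' := ⟨PUnit, inferInstance, inferInstance,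
    inAdd_self.of_retract (α := 0) (β := 0) (by ext),
    isCountablyGenerated_of_finite, dimHom_zero e⟩
  add_mem' := by
    rintro _ _ ⟨X, _, _, hX, hXc, rfl⟩ ⟨Y, _, _, hY, hYc, rfl⟩
    exact ⟨X × Y, inferInstance, inferInstance, hX.prod hY, hXc.prod hYc, dimHom_prod e⟩

variable {e}

theorem dimHom_mem_dimMonoid {X : Type v} [AddCommGroup X] [Module R X] (hX : InAdd R M X)
    (hc : IsCountablyGenerated R X) : dimHom e X ∈ dimMonoid e :=
  ⟨X, inferInstance, inferInstance, hX, hc, rfl⟩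

theorem castVec_apply (x : Fin s → ℕ) (i : Fin s) : castVec x i = x i := rfl

theorem castVec_ne_top (x : Fin s → ℕ) (i : Fin s) : castVec x i ≠ ⊤ := ENat.natCast_ne_top _

theorem exists_castVec_eq {b : Fin s → ℕ∞} (h : ∀ i, b i ≠ ⊤) : ∃ x, castVec x = b :=
  ⟨fun i => (b i).toNat, funext fun i => ENat.natCast_toNat (h i)⟩

theorem add_left_cancel_of_ne_top {a b c : Fin s → ℕ∞} (ha : ∀ i, a i ≠ ⊤) (h : a + b = a + c) :
    b = c :=
  funext fun i => WithTop.add_left_cancel (ha i) (congrFun h i)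

variable [∀ i, NeZero (n i)]

theorem castVec_mem_dimMonoid [Module.Finite R M] : castVec n ∈ dimMonoid e := by
  rw [← dimHom_self e]
  exact dimHom_mem_dimMonoid inAdd_self isCountablyGenerated_of_finite

theorem top_smul_mem_dimMonoid [Module.Finite R M] {b : Fin s → ℕ∞} (hb : b ∈ dimMonoid e) :
    (⊤ : ℕ∞) • b ∈ dimMonoid e := by
  obtain ⟨X, _, _, hX, hXc, rfl⟩ := hb
  rw [← dimHom_finsupp_nat e]
  exact dimHom_mem_dimMonoid hX.finsupp_nat hXc.finsupp

theorem isOrderUnit_top_dimMonoid [Module.Finite R M] :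
    IsOrderUnit ℕ∞ (dimMonoid e) (castVec n) := by
  refine ⟨castVec_mem_dimMonoid, fun b _ => ⟨⊤, (⊤ : ℕ∞) • castVec n,
    top_smul_mem_dimMonoid castVec_mem_dimMonoid, funext fun i => ?_⟩⟩
  have hni : (n i : ℕ∞) ≠ 0 := Nat.cast_ne_zero.2 (NeZero.ne (n i))
  rw [Pi.add_apply, Pi.smul_apply, smul_eq_mul, castVec_apply, ENat.top_mul hni, add_top]

variable [IsNoetherian R M] [RestrictedMinimumCondition (Module.End R M)]

theorem exists_inFinAdd_dimHom_eq {b : Fin s → ℕ∞} (hb : b ∈ dimMonoid e) (h : ∀ i, b i ≠ ⊤) :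
    ∃ (X : Type v) (_ : AddCommGroup X) (_ : Module R X), InFinAdd R M X ∧ dimHom e X = b := by
  obtain ⟨X, _, _, hX, -, rfl⟩ := hb
  exact ⟨X, _, _, hX.inFinAdd_of_dimHom_ne_top e h, rfl⟩

theorem imageV_eq :
    imageV e = castVec '' (finitePart (dimMonoid e) : Set (Fin s → ℕ)) := by
  ext b
  constructor
  · rintro ⟨X, _, _, hX, rfl⟩
    obtain ⟨x, hx⟩ := exists_castVec_eq (hX.dimHom_ne_top e)
    have := hX.finite
    refine ⟨x, ?_, hx⟩
    change castVec x ∈ dimMonoid e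
    rw [hx]
    exact dimHom_mem_dimMonoid hX.inAdd isCountablyGenerated_of_finite
  · rintro ⟨x, hx, rfl⟩
    exact exists_inFinAdd_dimHom_eq hx (castVec_ne_top x)

theorem mem_dimMonoid_of_add_mem {a c : Fin s → ℕ∞} (ha : a ∈ dimMonoid e)
    (ha_top : ∀ i, a i ≠ ⊤) (h : a + c ∈ dimMonoid e) : c ∈ dimMonoid e := by
  obtain ⟨X, _, _, hX, rfl⟩ := exists_inFinAdd_dimHom_eq ha ha_top
  obtain ⟨Y, _, _, hY, hYc, hd⟩ := h
  obtain ⟨ε, hε, -, hYε⟩ := exists_isIdempotentElem_of_dimHom_le e hX hY (hd ▸ le_self_add)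
  rw [add_left_cancel_of_ne_top ha_top (hd.symm.trans hYε)]
  exact dimHom_mem_dimMonoid (hY.range hε.one_sub) hYc.range

theorem isOrderUnit_finitePart_dimMonoid : IsOrderUnit ℕ (finitePart (dimMonoid e)) n := by
  have hnA : n ∈ finitePart (dimMonoid e) := castVec_mem_dimMonoid
  refine ⟨hnA, fun b hb => ?_⟩
  have hle : b ≤ (∑ i, b i) • n := fun i => by
    rw [Pi.smul_apply, smul_eq_mul]
    exact (Finset.single_le_sum (fun _ _ => Nat.zero_le _) (Finset.mem_univ i)).trans
      (Nat.le_mul_of_pos_right _ (NeZero.pos (n i)))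
  refine ⟨∑ i, b i, (∑ i, b i) • n - b, ?_, add_tsub_cancel_of_le hle⟩
  refine mem_dimMonoid_of_add_mem (a := castVec b) hb (castVec_ne_top b) ?_
  rw [← map_add, add_tsub_cancel_of_le hle]
  exact nsmul_mem hnA (∑ i, b i)

end DimensionMonoid

section Extension

open SystemOfSupports

variable {s : ℕ} {H : Set (Fin s)} (x : {i : Fin s // i ∉ H} → ℕ)

theorem extend_apply_of_mem {i : Fin s} (hi : i ∈ H) : extend H x i = ⊤ := dif_pos hi

theorem extend_apply_of_notMem {i : Fin s} (hi : i ∉ H) : extend H x i = x ⟨i, hi⟩ :=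
  dif_neg hi

theorem extend_eq_top_iff (i : Fin s) : extend H x i = ⊤ ↔ i ∈ H := by
  by_cases hi : i ∈ H
  · simp [extend_apply_of_mem x hi, hi]
  · simp [extend_apply_of_notMem x hi, hi]

theorem extend_add (y : {i : Fin s // i ∉ H} → ℕ) :
    extend H (x + y) = extend H x + extend H y := by
  ext1 i
  by_cases hi : i ∈ H
  · simp [extend_apply_of_mem _ hi]
  · simp [extend_apply_of_notMem _ hi]

theorem extend_add_extend_zero {K : Set (Fin s)} (h : H ⊆ K) :
    extend H x + extend K 0 =
      extend K fun i : {i : Fin s // i ∉ K} => x ⟨i.1, fun hi => i.2 (h hi)⟩ := by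
  ext1 i
  by_cases hi : i ∈ K
  · simp [extend_apply_of_mem _ hi]
  · simp [extend_apply_of_notMem _ hi, extend_apply_of_notMem x (fun hi' => hi (h hi'))]

theorem setOf_top_smul_extend_eq_top :
    {i | ((⊤ : ℕ∞) • extend H x) i = ⊤} = H ∪ Subtype.val '' {i | x i ≠ 0} := by
  ext i
  by_cases hi : i ∈ H
  · simp [extend_apply_of_mem x hi, hi]
  · by_cases hxi : x ⟨i, hi⟩ = 0 <;> simp [extend_apply_of_notMem x hi, hi, hxi]

theorem extend_empty (x : Fin s → ℕ) : extend ∅ (fun i => x i.1) = castVec x :=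
  funext fun i => extend_apply_of_notMem _ (Set.notMem_empty i)

theorem exists_extend_eq (b : Fin s → ℕ∞) : ∃ x, extend {i | b i = ⊤} x = b := by
  refine ⟨fun i => (b i.1).toNat, funext fun i => ?_⟩
  by_cases hi : b i = ⊤
  · rw [extend_apply_of_mem _ (show i ∈ {i | b i = ⊤} from hi), hi]
  · rw [extend_apply_of_notMem _ (show i ∉ {i | b i = ⊤} from hi)]
    exact ENat.natCast_toNat hi

end Extension

section SupportsOfDimensions

open SystemOfSupports

variable {R : Type u} [CommRing R] {M : Type v} [AddCommGroup M] [Module R M]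
variable {s : ℕ} {n : Fin s → ℕ} {D : Fin s → Type w} [∀ i, DivisionRing (D i)]
variable (e : Module.End R M ⧸ Ring.jacobson (Module.End R M) ≃+*
  ∀ i, Matrix (Fin (n i)) (Fin (n i)) (D i))

/-- The sets of indices at which elements of `D_M(V^*(M))` are infinite: the supports of the
system that describes this monoid. -/
def infiniteSupports : Set (Set (Fin s)) :=
  (fun b => {i | b i = ⊤}) '' (dimMonoid e : Set (Fin s → ℕ∞))

variable {e}

theorem empty_mem_infiniteSupports : ∅ ∈ infiniteSupports e :=
  ⟨0, zero_mem _, by simp⟩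

theorem union_mem_infiniteSupports {H K : Set (Fin s)} (hH : H ∈ infiniteSupports e)
    (hK : K ∈ infiniteSupports e) : H ∪ K ∈ infiniteSupports e := by
  obtain ⟨b, hb, rfl⟩ := hH
  obtain ⟨c, hc, rfl⟩ := hK
  exact ⟨b + c, add_mem hb hc, by ext i; simp⟩

variable [∀ i, NeZero (n i)]

theorem union_support_mem_infiniteSupports [Module.Finite R M] {H : Set (Fin s)}
    {x : {i : Fin s // i ∉ H} → ℕ} (hx : extend H x ∈ dimMonoid e) :
    H ∪ Subtype.val '' {i | x i ≠ 0} ∈ infiniteSupports e :=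
  ⟨(⊤ : ℕ∞) • extend H x, top_smul_mem_dimMonoid hx, setOf_top_smul_extend_eq_top x⟩

variable [IsNoetherian R M] [RestrictedMinimumCondition (Module.End R M)]

theorem extend_mem_dimMonoid_of_nonempty {H : Set (Fin s)} (hH : H ∈ infiniteSupports e)
    (hne : H.Nonempty) (x : {i : Fin s // i ∉ H} → ℕ) : extend H x ∈ dimMonoid e := by
  classical
  obtain ⟨_, ⟨X, _, _, hX, -, rfl⟩, rfl⟩ := hH
  obtain hfin | ⟨I, hI, hII, hI0, hsupp⟩ := inFinAdd_or_exists_isIdempotentElem e hX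
  · obtain ⟨i, hi⟩ := hne
    exact (hfin.dimHom_ne_top e i hi).elim
  have := RestrictedMinimumCondition.isArtinian_quotient I hI0
  revert x
  beta_reduce
  rw [← hsupp]
  intro x
  obtain ⟨Y, _, _, hY, hYc, hY_out, hY_in⟩ := exists_inAdd_dimHom_eq e hII
    fun i => if hi : i ∈ idealSupport e I then 0 else x ⟨i, hi⟩
  convert dimHom_mem_dimMonoid hY hYc using 1
  ext1 i
  by_cases hi : i ∈ idealSupport e I
  · rw [extend_apply_of_mem x hi, hY_in i hi]
  · rw [extend_apply_of_notMem x hi, hY_out i hi, dif_neg hi]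

theorem extend_zero_mem_dimMonoid {H : Set (Fin s)} (hH : H ∈ infiniteSupports e) :
    extend H 0 ∈ dimMonoid e := by
  obtain rfl | hne := H.eq_empty_or_nonempty
  · have hzero : extend ∅ (0 : {i : Fin s // i ∉ (∅ : Set (Fin s))} → ℕ) = 0 :=
      (extend_empty 0).trans (map_zero _)
    exact hzero ▸ zero_mem _
  · exact extend_mem_dimMonoid_of_nonempty hH hne 0

variable (e) in
/-- The system of supports that describes `D_M(V^*(M))`. -/
def systemOfSupports : SystemOfSupports n where
  pos i := NeZero.pos (n i)
  supports := infiniteSupports e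
  A H :=
    { carrier := {x | extend H.1 x ∈ dimMonoid e}
      zero_mem' := extend_zero_mem_dimMonoid H.2
      add_mem' := fun {x y} hx hy => by
        rw [Set.mem_ofPred_eq, extend_add]
        exact add_mem hx hy }
  empty_mem := empty_mem_infiniteSupports
  unit_mem := by
    change extend ∅ (fun i => n i.1) ∈ dimMonoid e
    rw [extend_empty]
    exact castVec_mem_dimMonoid
  union_mem _ hH _ hK := union_mem_infiniteSupports hH hK
  supp_mem _ _ hx := union_support_mem_infiniteSupports hx
  proj_mem H K h x hx := by
    change extend K.1 _ ∈ dimMonoid e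
    rw [← extend_add_extend_zero x h]
    exact add_mem hx (extend_zero_mem_dimMonoid K.2)

theorem carrier_systemOfSupports :
    (systemOfSupports e).carrier = (dimMonoid e : Set (Fin s → ℕ∞)) := by
  refine Set.Subset.antisymm (Set.iUnion_subset fun H => ?_) fun b hb => ?_
  · rintro _ ⟨x, hx, rfl⟩
    exact hx
  · obtain ⟨x, hx⟩ := exists_extend_eq b
    refine Set.mem_iUnion.2 ⟨⟨{i | b i = ⊤}, b, hb, rfl⟩, x, ?_, hx⟩
    change extend {i | b i = ⊤} x ∈ dimMonoid e
    rwa [hx]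

theorem systemOfSupports_A_eq_top (H : (systemOfSupports e).supports) (hH : H.1 ≠ ∅) :
    (systemOfSupports e).A H = ⊤ :=
  eq_top_iff.2 fun x _ =>
    extend_mem_dimMonoid_of_nonempty H.2 (Set.nonempty_iff_ne_empty.2 hH) x

theorem isAlmostFree_systemOfSupports : (systemOfSupports e).IsAlmostFree := by
  refine ⟨fun H a ha b hb => ?_, systemOfSupports_A_eq_top⟩
  rintro ⟨c, rfl⟩
  refine ⟨c, ?_, rfl⟩
  by_cases hH : H.1 = ∅
  · refine mem_dimMonoid_of_add_mem ha (fun i => ?_) (extend_add a c ▸ hb)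
    rw [Ne, extend_eq_top_iff, hH]
    exact Set.notMem_empty i
  · rw [systemOfSupports_A_eq_top H hH]
    exact AddSubmonoid.mem_top c

end SupportsOfDimensions

/-! ## Which modules are direct sums of finitely generated ones -/

section InfiniteSums

theorem finite_support_of_sum_le {κ : Type*} {f : κ → ℕ} {b : ℕ∞} (hb : b ≠ ⊤)
    (h : ∀ T : Finset κ, ∑ k ∈ T, (f k : ℕ∞) ≤ b) : f.support.Finite := by
  by_contra hinf
  obtain ⟨T, hT, hcard⟩ := Set.Infinite.exists_subset_card_eq hinf (b.toNat + 1)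
  have hTb : ((b.toNat + 1 : ℕ) : ℕ∞) ≤ b := calc
    ((b.toNat + 1 : ℕ) : ℕ∞) = ∑ _k ∈ T, (1 : ℕ∞) := by simp [hcard]
    _ ≤ ∑ k ∈ T, (f k : ℕ∞) := Finset.sum_le_sum fun k hk =>
      Nat.one_le_cast.2 (Nat.one_le_iff_ne_zero.2 (hT hk))
    _ ≤ b := h T
  rw [← ENat.natCast_toNat hb, Nat.cast_le, ENat.toNat_natCast] at hTb
  lia

variable {s : ℕ} {κ : Type*} {d : κ → Fin s → ℕ} {b : Fin s → ℕ∞}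

theorem exists_finset_forall_notMem_eq_zero
    (h : ∀ i (T : Finset κ), ∑ k ∈ T, (d k i : ℕ∞) ≤ b i) :
    ∃ T : Finset κ, ∀ i, b i ≠ ⊤ → ∀ k ∉ T, d k i = 0 := by
  have hfin : (⋃ i : {i // b i ≠ ⊤}, (fun k => d k i.1).support).Finite :=
    Set.finite_iUnion fun i => finite_support_of_sum_le i.2 (h i.1)
  refine ⟨hfin.toFinset, fun i hi k hk => ?_⟩
  by_contra hne
  exact hk (hfin.mem_toFinset.2 (Set.mem_iUnion.2 ⟨⟨i, hi⟩, hne⟩))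

theorem exists_finset_disjoint_sum_ne_zero
    (h : ∀ i (T : Finset κ), (∀ k ∉ T, d k i = 0) → b i ≤ ∑ k ∈ T, (d k i : ℕ∞))
    (T : Finset κ) :
    ∃ T' : Finset κ, Disjoint T T' ∧ ∀ i, b i = ⊤ → ∑ k ∈ T', d k i ≠ 0 := by
  classical
  have hex (i : {i // b i = ⊤}) : ∃ k ∉ T, d k i.1 ≠ 0 := by
    by_contra! hzero
    have htop := h i.1 T hzero
    rw [i.2, ← Nat.cast_sum] at htop
    exact ENat.natCast_ne_top _ (top_le_iff.1 htop)
  choose k hkT hk using hex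
  refine ⟨Finset.univ.image k, ?_, fun i hi hsum => hk ⟨i, hi⟩ ?_⟩
  · rw [Finset.disjoint_right, Finset.forall_mem_image]
    exact fun i _ => hkT i
  · exact Finset.sum_eq_zero_iff.1 hsum _ (Finset.mem_image_of_mem k (Finset.mem_univ _))

theorem exists_eq_castVec_add_top_smul
    (hle : ∀ i (T : Finset κ), ∑ k ∈ T, (d k i : ℕ∞) ≤ b i)
    (hge : ∀ i (T : Finset κ), (∀ k ∉ T, d k i = 0) → b i ≤ ∑ k ∈ T, (d k i : ℕ∞)) :
    ∃ T T' : Finset κ,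
      b = castVec (∑ k ∈ T, d k) + (⊤ : ℕ∞) • castVec (∑ k ∈ T', d k) := by
  obtain ⟨T, hT⟩ := exists_finset_forall_notMem_eq_zero hle
  obtain ⟨T', hdisj, hT'⟩ := exists_finset_disjoint_sum_ne_zero hge T
  refine ⟨T, T', funext fun i => ?_⟩
  rw [Pi.add_apply, Pi.smul_apply, castVec_apply, castVec_apply, smul_eq_mul, Finset.sum_apply,
    Finset.sum_apply]
  by_cases hi : b i = ⊤
  · rw [ENat.top_mul (Nat.cast_ne_zero.2 (hT' i hi)), add_top, hi]
  · rw [Finset.sum_eq_zero fun k hk => hT i hi k (Finset.disjoint_right.1 hdisj hk),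
      Nat.cast_zero, mul_zero, add_zero, Nat.cast_sum]
    exact le_antisymm (hge i T (hT i hi)) (hle i T)

end InfiniteSums

section DirectSumCriterion

variable {R : Type u} [CommRing R] {M : Type v} [AddCommGroup M] [Module R M]
variable {X : Type v} [AddCommGroup X] [Module R X]

theorem IsDirectSumInFinAdd.isDirectSumOfFinite [Module.Finite R M]
    (h : IsDirectSumInFinAdd R M X) : IsDirectSumOfFinite R X := by
  obtain ⟨κ, N, hN, hfin⟩ := h
  exact ⟨κ, N, hN, fun k => Module.Finite.iff_fg.1 (hfin k).finite⟩

variable {s : ℕ} {n : Fin s → ℕ} [∀ i, NeZero (n i)] {D : Fin s → Type w}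
  [∀ i, DivisionRing (D i)]
variable {e : Module.End R M ⧸ Ring.jacobson (Module.End R M) ≃+*
  ∀ i, Matrix (Fin (n i)) (Fin (n i)) (D i)}

theorem addInftyMul_subset_dimMonoid [Module.Finite R M] :
    addInftyMul (finitePart (dimMonoid e)) ⊆ dimMonoid e := by
  rintro _ ⟨a₁, h₁, a₂, h₂, rfl⟩
  exact add_mem h₁ (top_smul_mem_dimMonoid h₂)

theorem IsDirectSumOfFinite.dimHom_mem_addInftyMul [Module.Finite R M] (hX : InAdd R M X)
    (h : IsDirectSumOfFinite R X) : dimHom e X ∈ addInftyMul (finitePart (dimMonoid e)) := by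
  obtain ⟨κ, N, hi, htop, hfg⟩ := isDirectSumOfFinite_iff.1 h
  obtain ⟨π, hπ, hπ'⟩ := exists_projections_of_iSupIndep hi htop
  have hN (k : κ) : InAdd R M (N k) := hX.of_retract (hπ k)
  have hN_finite (k : κ) : Module.Finite R (N k) := Module.Finite.iff_fg.2 (hfg k)
  have hN_ne_top (k : κ) : ∀ i, dimHom e (N k) i ≠ ⊤ := (hN k).inFinAdd.dimHom_ne_top e
  choose d hd using fun k => exists_castVec_eq (hN_ne_top k)
  have hd_apply (k : κ) (i : Fin s) : (d k i : ℕ∞) = dimHom e (N k) i := congrFun (hd k) i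
  have hd_mem (k : κ) : d k ∈ finitePart (dimMonoid e) := by
    change castVec (d k) ∈ dimMonoid e
    rw [hd]
    exact dimHom_mem_dimMonoid (hN k) isCountablyGenerated_of_finite
  obtain ⟨T, T', hT⟩ : ∃ T T' : Finset κ,
      dimHom e X = castVec (∑ k ∈ T, d k) + (⊤ : ℕ∞) • castVec (∑ k ∈ T', d k) := by
    refine exists_eq_castVec_add_top_smul (fun i T => ?_) fun i T hzero => ?_
    · simp only [hd_apply]
      exact sum_dimHom_le e (fun k => (N k).subtype) π hπ (fun j k hjk => hπ' hjk)
        (fun k => hN_ne_top k i) T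
    · simp only [hd_apply]
      refine dimHom_le_sum e (fun k => (N k).subtype) π
        (exists_finset_sum_of_iSup_eq_top htop hπ hπ') (fun k => hN_ne_top k i) T fun k hk => ?_
      rw [← hd_apply, hzero k hk, Nat.cast_zero]
  exact ⟨_, sum_mem fun k _ => hd_mem k, _, sum_mem fun k _ => hd_mem k, hT⟩

theorem dimMonoid_eq_addInftyMul_of_forall_isDirectSumOfFinite [Module.Finite R M]
    (h : ∀ (X : Type v) [AddCommGroup X] [Module R X], InAdd R M X → IsDirectSumOfFinite R X) :
    (dimMonoid e : Set (Fin s → ℕ∞)) = addInftyMul (finitePart (dimMonoid e)) := by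
  refine Set.Subset.antisymm ?_ addInftyMul_subset_dimMonoid
  rintro _ ⟨X, _, _, hX, -, rfl⟩
  exact (h X hX).dimHom_mem_addInftyMul hX

variable [IsNoetherian R M] [RestrictedMinimumCondition (Module.End R M)]

theorem isDirectSumInFinAdd_of_dimHom_mem_addInftyMul (hX : InAdd R M X)
    (hc : IsCountablyGenerated R X)
    (h : dimHom e X ∈ addInftyMul (finitePart (dimMonoid e))) : IsDirectSumInFinAdd R M X := by
  obtain ⟨a₁, h₁, a₂, h₂, hd⟩ := h
  obtain ⟨Y₁, _, _, hY₁, hd₁⟩ := exists_inFinAdd_dimHom_eq h₁ (castVec_ne_top a₁)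
  obtain ⟨Y₂, _, _, hY₂, hd₂⟩ := exists_inFinAdd_dimHom_eq h₂ (castVec_ne_top a₂)
  rw [← hd₁, ← hd₂] at hd
  obtain ⟨ε, hε, hε_fin, hXε⟩ :=
    exists_isIdempotentElem_of_dimHom_le e hY₁ hX (hd ▸ le_self_add)
  have hcompl : dimHom e (LinearMap.range (1 - ε)) = (⊤ : ℕ∞) • dimHom e Y₂ :=
    add_left_cancel_of_ne_top (hY₁.dimHom_ne_top e) (hXε.symm.trans hd)
  exact isDirectSumInFinAdd_of_isCompl (isCompl_range_range_one_sub hε)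
    (inFinAdd_range hε hε_fin).isDirectSumInFinAdd
    (isDirectSumInFinAdd_of_dimHom_eq_top_smul e (hX.range hε.one_sub) hc.range hY₂ hcompl)

theorem InAdd.isDirectSumInFinAdd_of_dimMonoid_eq
    (h : (dimMonoid e : Set (Fin s → ℕ∞)) = addInftyMul (finitePart (dimMonoid e)))
    (hX : InAdd R M X) : IsDirectSumInFinAdd R M X := by
  obtain ⟨𝒟, hind, htop, hcg⟩ := hX.exists_sSupIndep
  rw [sSupIndep_iff] at hind
  rw [sSup_eq_iSup'] at htop
  obtain ⟨π, hπ, -⟩ := exists_projections_of_iSupIndep hind htop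
  refine isDirectSumInFinAdd_of_iSupIndep hind htop fun C => ?_
  have hC : InAdd R M C.1 := hX.of_retract (hπ C)
  exact isDirectSumInFinAdd_of_dimHom_mem_addInftyMul hC (hcg C.1 C.2)
    (h.le (dimHom_mem_dimMonoid hC (hcg C.1 C.2)))

theorem forall_isDirectSumInFinAdd_iff :
    (∀ (X : Type v) [AddCommGroup X] [Module R X], InAdd R M X → IsDirectSumInFinAdd R M X) ↔
      (dimMonoid e : Set (Fin s → ℕ∞)) = addInftyMul (finitePart (dimMonoid e)) :=
  ⟨fun h => dimMonoid_eq_addInftyMul_of_forall_isDirectSumOfFinite fun X _ _ hX =>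
    (h X hX).isDirectSumOfFinite, fun h _ _ _ hX => hX.isDirectSumInFinAdd_of_dimMonoid_eq h⟩

theorem forall_isDirectSumOfFinite_iff :
    (∀ (X : Type v) [AddCommGroup X] [Module R X], InAdd R M X → IsDirectSumOfFinite R X) ↔
      (dimMonoid e : Set (Fin s → ℕ∞)) = addInftyMul (finitePart (dimMonoid e)) :=
  ⟨dimMonoid_eq_addInftyMul_of_forall_isDirectSumOfFinite, fun h _ _ _ hX =>
    (hX.isDirectSumInFinAdd_of_dimMonoid_eq h).isDirectSumOfFinite⟩

end DirectSumCriterion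

/-! ## Torsion-free modules over one-dimensional domains -/

section TorsionFree

theorem isArtinian_of_isTorsionBy {R : Type*} [CommRing R] [IsNoetherianRing R]
    [Ring.KrullDimLE 1 R] {P : Type*} [AddCommGroup P] [Module R P] [Module.Finite R P] {r : R}
    (hr : r ∈ nonZeroDivisors R) (h : Module.IsTorsionBy R P r) : IsArtinian R P := by
  have hset : Module.IsTorsionBySet R P (Ideal.span {r}) :=
    (Module.isTorsionBySet_span_singleton_iff r).2 h
  let _ : Module (R ⧸ Ideal.span {r}) P := hset.module
  have : IsScalarTower R (R ⧸ Ideal.span {r}) P := hset.isScalarTower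
  have : Module.Finite (R ⧸ Ideal.span {r}) P := .of_restrictScalars_finite R _ P
  have : IsArtinianRing (R ⧸ Ideal.span {r}) := isArtinian_of_tower R
    (isFiniteLength_iff_isNoetherian_isArtinian.1
      (isFiniteLength_quotient_span_singleton R hr)).2
  have : IsArtinian (R ⧸ Ideal.span {r}) P := isArtinian_of_fg_of_artinian'
  exact isArtinian_of_surjective_algebraMap (S := R) (R := R ⧸ Ideal.span {r})
    Ideal.Quotient.mk_surjective

variable {R : Type u} [CommRing R] [IsDomain R] {M : Type v} [AddCommGroup M] [Module R M]
  [Module.Finite R M]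

variable (R M) in
theorem exists_linearIndepOn_smul_mem_span : ∃ (I : Set M) (r : R), LinearIndepOn R id I ∧
    r ≠ 0 ∧ ∀ m : M, r • m ∈ Submodule.span R I := by
  obtain ⟨I, hI, hmax⟩ := exists_maximal_linearIndepOn R (id : M → M)
  rw [Set.image_id] at hmax
  have htorsion : Module.IsTorsion R (M ⧸ Submodule.span R I) := by
    intro y
    obtain ⟨m, rfl⟩ := Submodule.mkQ_surjective _ y
    by_cases hm : m ∈ I
    · exact ⟨1, (one_smul _ _).trans
        ((Submodule.Quotient.mk_eq_zero _).2 (Submodule.subset_span hm))⟩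
    · obtain ⟨a, ha, ham⟩ := hmax m hm
      exact ⟨⟨a, mem_nonZeroDivisors_of_ne_zero ha⟩,
        (Submodule.Quotient.mk_eq_zero _).2 ham⟩
  obtain ⟨r, hr, hr0⟩ := Submodule.annihilator_top_inter_nonZeroDivisors htorsion
  refine ⟨I, r, hI, nonZeroDivisors.ne_zero hr0, fun m => ?_⟩
  rw [← Submodule.Quotient.mk_eq_zero, Submodule.Quotient.mk_smul]
  exact Submodule.mem_annihilator.1 hr _ Submodule.mem_top

variable [IsNoetherianRing R]

variable (R M) in
theorem exists_smul_eq_sum_smul : ∃ (κ : Type v) (_ : Fintype κ) (x : κ → M)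
    (c : κ → M →ₗ[R] R) (r : R), r ≠ 0 ∧ ∀ m, r • m = ∑ i, c i m • x i := by
  obtain ⟨I, r, hI, hr, hspan⟩ := exists_linearIndepOn_smul_mem_span R M
  have : Finite I := hI.finite_of_isNoetherian
  have := Fintype.ofFinite I
  rw [← Subtype.range_coe (s := I)] at hspan
  let ρ := (LinearMap.lsmul R M r).codRestrict _ hspan
  refine ⟨I, inferInstance, Subtype.val, fun i => Finsupp.lapply i ∘ₗ hI.repr ∘ₗ ρ, r, hr,
    fun m => ?_⟩
  have hrepr := LinearIndependent.linearCombination_repr hI (ρ m)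
  rw [Finsupp.linearCombination_apply, Finsupp.sum_fintype _ _ (by simp)] at hrepr
  exact hrepr.symm

variable [Module.IsTorsionFree R M]

theorem exists_algebraMap_mem_of_ne_bot {I : Ideal (Module.End R M)} [I.IsTwoSided]
    (hI : I ≠ ⊥) : ∃ r : R, r ≠ 0 ∧ algebraMap R (Module.End R M) r ∈ I := by
  obtain ⟨f, hf, hf0⟩ := Submodule.exists_mem_ne_zero_of_ne_bot hI
  obtain ⟨κ, _, x, c, r, hr, hc⟩ := exists_smul_eq_sum_smul R M
  obtain ⟨m, hm⟩ : ∃ m, f m ≠ 0 := by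
    by_contra! h
    exact hf0 (LinearMap.ext h)
  obtain ⟨j, hj⟩ : ∃ j, c j (f m) ≠ 0 := by
    by_contra! h
    have hrfm := hc (f m)
    simp only [h, zero_smul, Finset.sum_const_zero] at hrfm
    exact hm ((smul_eq_zero.1 hrfm).resolve_left hr)
  refine ⟨r * c j (f m), mul_ne_zero hr hj, ?_⟩
  have hsum : algebraMap R (Module.End R M) (r * c j (f m)) =
      ∑ i, (c j).smulRight (x i) * (f * (c i).smulRight m) := by
    ext y
    simp only [Module.algebraMap_end_apply, LinearMap.sum_apply, Module.End.mul_apply,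
      LinearMap.smulRight_apply, map_smul, mul_smul]
    rw [smul_comm, hc, Finset.smul_sum]
    exact Finset.sum_congr rfl fun i _ => by rw [smul_smul, smul_smul, mul_comm]
  rw [hsum]
  exact sum_mem fun i _ => I.mul_mem_left _ (I.mul_mem_right _ hf)

instance [Ring.KrullDimLE 1 R] : RestrictedMinimumCondition (Module.End R M) where
  isArtinian_quotient I _ hI := by
    obtain ⟨r, hr, hrI⟩ := exists_algebraMap_mem_of_ne_bot hI
    have htorsion : Module.IsTorsionBy R (Module.End R M ⧸ I) r := by
      intro y
      obtain ⟨f, rfl⟩ := Submodule.mkQ_surjective _ y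
      rw [Submodule.mkQ_apply, ← Submodule.Quotient.mk_smul, Submodule.Quotient.mk_eq_zero,
        Algebra.smul_def]
      exact I.mul_mem_right f hrI
    exact isArtinian_of_tower R
      (isArtinian_of_isTorsionBy (mem_nonZeroDivisors_of_ne_zero hr) htorsion)

end TorsionFree

theorem mainTheorem9_general {R : Type u} [CommRing R]
    {M : Type v} [AddCommGroup M] [Module R M] [IsNoetherian R M]
    [RestrictedMinimumCondition (Module.End R M)]
    {s : ℕ} {n : Fin s → ℕ} (hn : ∀ i, 0 < n i)
    {D : Fin s → Type w} [∀ i, DivisionRing (D i)]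
    (e : Module.End R M ⧸ Ring.jacobson (Module.End R M) ≃+*
      ∀ i, Matrix (Fin (n i)) (Fin (n i)) (D i)) :
    ∃ B : AddSubmonoid (Fin s → ℕ∞),
      (B : Set (Fin s → ℕ∞)) = imageVStar e ∧
      dimHom e M = castVec n ∧
      IsOrderUnit ℕ∞ B (castVec n) ∧
      IsOrderUnit ℕ (finitePart B) n ∧
      (∃ 𝒮 : SystemOfSupports n, 𝒮.IsAlmostFree ∧ (B : Set (Fin s → ℕ∞)) = 𝒮.carrier) ∧
      imageV e = castVec '' (finitePart B : Set (Fin s → ℕ)) ∧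
      ((∀ (X : Type v) [AddCommGroup X] [Module R X], InAdd R M X → IsDirectSumInFinAdd R M X) ↔
        (B : Set (Fin s → ℕ∞)) = addInftyMul (finitePart B)) ∧
      ((∀ (X : Type v) [AddCommGroup X] [Module R X], InAdd R M X → IsDirectSumOfFinite R X) ↔
        (B : Set (Fin s → ℕ∞)) = addInftyMul (finitePart B)) := by
  have (i : Fin s) : NeZero (n i) := ⟨(hn i).ne'⟩
  exact ⟨dimMonoid e, rfl, dimHom_self e, isOrderUnit_top_dimMonoid,
    isOrderUnit_finitePart_dimMonoid,
    ⟨systemOfSupports e, isAlmostFree_systemOfSupports, carrier_systemOfSupports.symm⟩,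
    imageV_eq, forall_isDirectSumInFinAdd_iff, forall_isDirectSumOfFinite_iff⟩

theorem mainTheorem9 {R : Type u} [CommRing R] [IsDomain R] [IsNoetherianRing R]
    (hR : ringKrullDim R = 1)
    {M : Type v} [AddCommGroup M] [Module R M] [Module.Finite R M] [Module.IsTorsionFree R M]
    {s : ℕ} {n : Fin s → ℕ} (hn : ∀ i, 0 < n i)
    {D : Fin s → Type w} [∀ i, DivisionRing (D i)]
    (e : Module.End R M ⧸ Ring.jacobson (Module.End R M) ≃+*
      ∀ i, Matrix (Fin (n i)) (Fin (n i)) (D i)) :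
    ∃ B : AddSubmonoid (Fin s → ℕ∞),
      (B : Set (Fin s → ℕ∞)) = imageVStar e ∧
      dimHom e M = castVec n ∧
      IsOrderUnit ℕ∞ B (castVec n) ∧
      IsOrderUnit ℕ (finitePart B) n ∧
      (∃ 𝒮 : SystemOfSupports n, 𝒮.IsAlmostFree ∧ (B : Set (Fin s → ℕ∞)) = 𝒮.carrier) ∧
      imageV e = castVec '' (finitePart B : Set (Fin s → ℕ)) ∧
      ((∀ (X : Type v) [AddCommGroup X] [Module R X], InAdd R M X → IsDirectSumInFinAdd R M X) ↔
        (B : Set (Fin s → ℕ∞)) = addInftyMul (finitePart B)) ∧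
      ((∀ (X : Type v) [AddCommGroup X] [Module R X], InAdd R M X → IsDirectSumOfFinite R X) ↔
        (B : Set (Fin s → ℕ∞)) = addInftyMul (finitePart B)) := by
  have : Ring.KrullDimLE 1 R := Ring.krullDimLE_iff.2 hR.le
  exact mainTheorem9_general hn e

end
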